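/- Let $e_1,e_2,e_3$ be three distinct integers. For each integer $n\ge 1$ let $E_n$ be the elliptic curve over $\mathbb{Q}$ given by $y^2=(x-e_1n)(x-e_2n)(x-e_3n)$, and let $E_n^{\ast}(\mathbb{Z})$ be the set of points $P=(x,y)\in E_n(\mathbb{Q})$ other than the point at infinity with $x\in\mathbb{Z}$ (hence $y\in\mathbb{Z}$) and $y\neq 0$. Put $\mathcal{H}(P)=\max\{|y|^{1/3},|x|^{1/2}\}$, and let $\delta=4$ if $e_1e_2e_3\neq 0$ and $\delta=6$ otherwise. Then there are constants $c,C>0$ and $B_0$, depending only on $e_1,e_2,e_3$, such that $$\sum_{n\ge 1}\#\{P\in E_n^{\ast}(\mathbb{Z}) : \mathcal{H}(P)\le B\}\ \ge\ cB\quad\text{for all real } B\ge B_0,$$ and $$\sum_{n\ge 1}\#\{P\in E_n^{\ast}(\mathbb{Z}) : \mathcal{H}(P)\le B\}\ \le\ C\,B(\log B)^{\delta}\quad\text{for all real } B\ge 2.$$ In particular the sum is finite. -/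

import Mathlib

open scoped ENNReal

/-- The elliptic curve `E_{n,e}` over `ℚ`, given by `y² = (x - e₁ n) (x - e₂ n) (x - e₃ n)`,
as a Weierstrass curve. -/
def twistCurve (e₁ e₂ e₃ : ℤ) (n : ℕ+) : WeierstrassCurve ℚ where
  a₁ := 0
  a₂ := -((e₁ + e₂ + e₃) * (n : ℕ))
  a₃ := 0
  a₄ := (e₁ * e₂ + e₂ * e₃ + e₃ * e₁) * (n : ℕ) ^ 2
  a₆ := -(e₁ * e₂ * e₃ * (n : ℕ) ^ 3)

theorem twistCurve_equation_iff (e₁ e₂ e₃ : ℤ) (n : ℕ+) (x y : ℚ) :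
    (twistCurve e₁ e₂ e₃ n).toAffine.Equation x y ↔
      y ^ 2 = (x - e₁ * (n : ℕ)) * (x - e₂ * (n : ℕ)) * (x - e₃ * (n : ℕ)) := by
  rw [WeierstrassCurve.Affine.equation_iff]
  simp only [twistCurve]
  constructor <;> intro h <;> linear_combination h

/-- The non-trivial integral points of `E_{n,e}`: the rational points `P` (other than the point at
infinity, which has no `x`-coordinate) with `x(P) ∈ ℤ` and `y(P) ≠ 0`. -/
def nontrivialIntegralPoints (e₁ e₂ e₃ : ℤ) (n : ℕ+) :
    Set (twistCurve e₁ e₂ e₃ n).toAffine.Point :=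
  {P | ∃ (x y : ℚ) (h : (twistCurve e₁ e₂ e₃ n).toAffine.Nonsingular x y),
    P = .some x y h ∧ (∃ m : ℤ, x = m) ∧ y ≠ 0}

/-- The exponential naive height `max {|y|^{1/3}, |x|^{1/2}}` of the point `(x, y)`. It is only
used for points other than the one at infinity, where the value `0` is a convention. -/
noncomputable def naiveHeight {W : WeierstrassCurve ℚ} : W.toAffine.Point → ℝ
  | .zero => 0
  | .some x y _ => max (|(y : ℝ)| ^ (1 / 3 : ℝ)) (|(x : ℝ)| ^ (1 / 2 : ℝ))

/-- The sum over all `n ≥ 1` of the number of non-trivial integral points of `E_{n,e}` of naive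
height at most `B`, as an element of `[0, ∞]`. -/
noncomputable def integralPointSum (e₁ e₂ e₃ : ℤ) (B : ℝ) : ℝ≥0∞ :=
  ∑' n : ℕ+, (({P ∈ nontrivialIntegralPoints e₁ e₂ e₃ n | naiveHeight P ≤ B}).encard : ℝ≥0∞)

/-- The exponent `δ_e` of the logarithm. -/
def logExponent (e₁ e₂ e₃ : ℤ) : ℕ :=
  if e₁ * e₂ * e₃ ≠ 0 then 4 else 6

/-! For an integral point put `Xᵢ = x - eᵢ n`. Then `X₀ X₁ X₂ = y²`, and the `Xᵢ` satisfy one linear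
relation whose coefficients depend only on the `eᵢ`. As `(X, y)` determines both `n` and the point,
the upper bound amounts to counting such `(X, y)` with `0 < |y| ≤ B³`.

Descent (`exists_torsorPoint`): up to finitely many choices of bounded data, `Xᵢ` is a constant
times `(s₀ s₁ s₂) w² sᵢ zᵢ²`, where `z` is a primitive point on the conic `∑ αᵢ sᵢ zᵢ² = 0`, the
`sᵢ` are squarefree and coprime, and `w³ (s₀ s₁ s₂)² z₀ z₁ z₂ ≤ B³`. A given `(s, z)` leaves `O(B /
D)` values of `w`, with `D³ = (s₀ s₁ s₂)² z₀ z₁ z₂`. It remains to bound the number of `(s, z)` in a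
dyadic box by `D` times a decaying factor.

Two counts compete. Fixing `z`, the admissible `s` have well-spaced ratios `s₁ / s₀`
(`card_coeffs_le`, `card_box_le_of_points`); this is good for small `z`. Fixing `s`, a Holzer-type
reflection gives a zero `v` of bounded size to which `z` is proportional modulo almost all of `s₀ s₁
s₂` (`exists_small_primitive_zero`). Points sharing `v` are orthogonal to each other modulo that
number, hence well spaced on the conic (`card_conic_points_le`), and the pairs `(s, v)` are few
(`card_small_pairs_le`); this is good for large `z`. When two of the `sᵢ` equal 1, `v` may have a
zero coordinate, and classes labelled by divisors replace it (`dvd_diagForm_of_gcd_eq`).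

The smaller count is `D` times a factor decaying geometrically in two linear functions of the five
dyadic exponents (`exists_card_dyadic_le`). The decay makes one of the five sums converge, so `(log
B)⁴` remains. The lower bound comes from an explicit one-parameter family of points. -/

/-! ### Diagonal ternary forms: coprimality and orthogonality modulo the coefficients -/

/-- The symmetric bilinear form `k₀ x₀ y₀ + k₁ x₁ y₁ + k₂ x₂ y₂`. -/
def diagForm (k x y : Fin 3 → ℤ) : ℤ := k 0 * x 0 * y 0 + k 1 * x 1 * y 1 + k 2 * x 2 * y 2

/-- The `i`-th coordinate of the cross product of `x` and `y`. -/
def minor (x y : Fin 3 → ℤ) (i : Fin 3) : ℤ := x (i + 1) * y (i + 2) - x (i + 2) * y (i + 1)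

/-- Integral vectors whose coordinates have no common factor, in Bézout form. -/
def IsPrimitive (z : Fin 3 → ℤ) : Prop := ∃ u : Fin 3 → ℤ, u 0 * z 0 + u 1 * z 1 + u 2 * z 2 = 1

/-- Positive, squarefree and pairwise coprime `s`, coprime to the coefficients `α`. -/
structure Admissible (α s : Fin 3 → ℤ) : Prop where
  pos : ∀ i, 0 < s i
  sqf : ∀ i, Squarefree (s i)
  cop : ∀ i j, i ≠ j → IsCoprime (s i) (s j)
  copα : ∀ i j, IsCoprime (s i) (α j)

/-- Written cyclically from the index `i`, the form lets one argument serve all three coordinates.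
-/
theorem diagForm_rotate (k x y : Fin 3 → ℤ) (i : Fin 3) :
    diagForm k x y = k i * x i * y i + k (i + 1) * x (i + 1) * y (i + 1)
      + k (i + 2) * x (i + 2) * y (i + 2) := by
  fin_cases i <;> simp [diagForm] <;> ring

theorem IsPrimitive.rotate {z : Fin 3 → ℤ} (h : IsPrimitive z) (i : Fin 3) :
    ∃ u : Fin 3 → ℤ, u i * z i + u (i + 1) * z (i + 1) + u (i + 2) * z (i + 2) = 1 := by
  obtain ⟨u, hu⟩ := h
  refine ⟨u, ?_⟩
  fin_cases i <;> simp <;> linarith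

/-- A prime dividing `s` and `x` divides `y` by the equation. Then its square divides `e s t²`, and
since `s` is squarefree it divides `t`, against primitivity. -/
theorem isCoprime_of_conic {s a b e x y t u v w : ℤ} (hs : Squarefree s) (hb : IsCoprime s b)
    (he : IsCoprime s e) (h : a * x ^ 2 + b * y ^ 2 + e * s * t ^ 2 = 0)
    (hu : u * x + v * y + w * t = 1) : IsCoprime s x := by
  refine isCoprime_of_prime_dvd (fun h0 => hs.ne_zero h0.1) fun p hp hps hpx => ?_
  have hpb : ¬ p ∣ b := fun hd => hp.not_isUnit (hb.isUnit_of_dvd' hps hd)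
  have hpe : ¬ p ∣ e := fun hd => hp.not_isUnit (he.isUnit_of_dvd' hps hd)
  have hpy : p ∣ y := by
    have : p ∣ b * y ^ 2 := by
      have : b * y ^ 2 = -(a * x ^ 2) - e * s * t ^ 2 := by linarith
      rw [this]
      exact dvd_sub ((dvd_neg).2 ((hpx.pow two_ne_zero).mul_left a))
        ((hps.mul_left e).mul_right _)
    exact hp.dvd_of_dvd_pow ((hp.dvd_or_dvd this).resolve_left hpb)
  have hpt : p ∣ t := by
    obtain ⟨x', rfl⟩ := hpx
    obtain ⟨y', rfl⟩ := hpy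
    obtain ⟨s', rfl⟩ := hps
    have hps' : ¬ p ∣ s' := by
      rintro ⟨s'', rfl⟩
      exact hp.not_isUnit (hs p ⟨s'', by ring⟩)
    have h2 : p * (e * s' * t ^ 2) = p * (p * (-(a * x' ^ 2) - b * y' ^ 2)) := by linarith
    have h3 := mul_left_cancel₀ hp.ne_zero h2
    have h4 : p ∣ e * s' * t ^ 2 := ⟨_, h3⟩
    rcases hp.dvd_or_dvd h4 with h5 | h5
    · rcases hp.dvd_or_dvd h5 with h6 | h6
      · exact absurd h6 hpe
      · exact absurd h6 hps'
    · exact hp.dvd_of_dvd_pow h5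
  exact hp.not_dvd_one (hu ▸ dvd_add (dvd_add (hpx.mul_left u) (hpy.mul_left v)) (hpt.mul_left w))

theorem Admissible.isCoprime_coord {α s z : Fin 3 → ℤ} (hs : Admissible α s)
    (hz : diagForm (α * s) z z = 0) (hp : IsPrimitive z) {i j : Fin 3} (hij : i ≠ j) :
    IsCoprime (s i) (z j) := by
  rw [diagForm_rotate _ _ _ i] at hz
  obtain ⟨u, hu⟩ := hp.rotate i
  simp only [Pi.mul_apply] at hz
  have c1 : i ≠ i + 1 := by fin_cases i <;> decide
  have c2 : i ≠ i + 2 := by fin_cases i <;> decide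
  have hj : j = i + 1 ∨ j = i + 2 :=
    (by decide : ∀ i j : Fin 3, i ≠ j → j = i + 1 ∨ j = i + 2) i j hij
  have e1 := (hs.copα i (i + 1)).mul_right (hs.cop i _ c1)
  have e2 := (hs.copα i (i + 2)).mul_right (hs.cop i _ c2)
  rcases hj with rfl | rfl
  · exact isCoprime_of_conic (a := α (i + 1) * s (i + 1)) (y := z (i + 2)) (t := z i)
      (u := u (i + 1)) (v := u (i + 2)) (w := u i) (hs.sqf i) e2
      (hs.copα i i) (by linarith) (by linarith)
  · exact isCoprime_of_conic (a := α (i + 2) * s (i + 2)) (y := z (i + 1)) (t := z i)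
      (u := u (i + 2)) (v := u (i + 1)) (w := u i) (hs.sqf i) e1
      (hs.copα i i) (by linarith) (by linarith)

/-- If `x` and `y` are both proportional modulo `m` to a zero `v` of a form whose `i`-th coefficient
vanishes modulo `m`, then they are orthogonal modulo `m`. -/
theorem dvd_diagForm {k v x y : Fin 3 → ℤ} {m : ℤ} {i : Fin 3} (hv : diagForm k v v = 0)
    (hk : m ∣ k i) (hc : IsCoprime m (v (i + 2))) (hx : m ∣ minor v x i) (hy : m ∣ minor v y i) :
    m ∣ diagForm k x y := by
  rw [diagForm_rotate _ _ _ i] at hv ⊢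
  obtain ⟨q, hq⟩ := hk
  obtain ⟨r, hr⟩ := hx
  obtain ⟨t, ht⟩ := hy
  unfold minor at hr ht
  have : m ∣ v (i + 2) ^ 2 * (k i * x i * y i + k (i + 1) * x (i + 1) * y (i + 1)
      + k (i + 2) * x (i + 2) * y (i + 2)) := by
    refine ⟨v (i + 2) ^ 2 * q * x i * y i - k (i + 1) * r * v (i + 2) * y (i + 1)
      - k (i + 1) * t * v (i + 1) * x (i + 2) - x (i + 2) * y (i + 2) * q * v i ^ 2, ?_⟩
    linear_combination (v (i + 2) ^ 2 * x i * y i - x (i + 2) * y (i + 2) * v i ^ 2) * hq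
      - k (i + 1) * v (i + 2) * y (i + 1) * hr - k (i + 1) * v (i + 1) * x (i + 2) * ht
      + x (i + 2) * y (i + 2) * hv
  exact (hc.pow_right).dvd_of_dvd_mul_left this

/-! ### Small zeros of a conic by reflection -/

/-- The discriminant of the binary form that gives the last coordinate of the reflection of the zero `z`
in a vector of the plane spanned by `f` and `e`. -/
theorem reflection_disc (k z f e : Fin 3 → ℤ) (hz : diagForm k z z = 0) :
    (diagForm k f f * z 2 - 2 * diagForm k z f * f 2) * (diagForm k e e * z 2 - 2 * diagForm k z e * e 2)
      - (diagForm k f e * z 2 - diagForm k z f * e 2 - diagForm k z e * f 2) ^ 2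
      = k 0 * k 1 * (z 0 * minor f e 0 + z 1 * minor f e 1 + z 2 * minor f e 2) ^ 2 := by
  simp only [diagForm, minor] at *
  simp only [show (0 : Fin 3) + 1 = 1 from rfl, show (0 : Fin 3) + 2 = 2 from rfl,
    show (1 : Fin 3) + 1 = 2 from rfl, show (1 : Fin 3) + 2 = 0 from rfl,
    show (2 : Fin 3) + 1 = 0 from rfl, show (2 : Fin 3) + 2 = 1 from rfl]
  linear_combination (-(k 0 * (f 2 * e 0 - f 0 * e 2) ^ 2 + k 1 * (f 1 * e 2 - f 2 * e 1) ^ 2)) * hz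

/-- A positive definite binary form of determinant `Δ` takes a positive value at most `2 √Δ`. -/
theorem exists_small_value {A B C : ℤ} (hA : 0 < A) (hd : 0 < A * C - B ^ 2) :
    ∃ x y : ℤ, 0 < A * x ^ 2 + 2 * B * x * y + C * y ^ 2 ∧
      (A * x ^ 2 + 2 * B * x * y + C * y ^ 2) ^ 2 ≤ 4 * (A * C - B ^ 2) := by
  set Δ : ℤ := A * C - B ^ 2 with hΔ
  have hA' : (0 : ℝ) < A := by exact_mod_cast hA
  have hD' : (0 : ℝ) < Δ := by exact_mod_cast hd
  set r := √(Δ : ℝ) with hr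
  have hrpos : 0 < r := Real.sqrt_pos.2 hD'
  have hr2 : r ^ 2 = Δ := Real.sq_sqrt hD'.le
  rcases lt_or_ge (A : ℝ) r with h | h
  · refine ⟨1, 0, by simpa using hA, ?_⟩
    have : (A : ℝ) ^ 2 ≤ Δ := by rw [← hr2]; gcongr
    have : A ^ 2 ≤ Δ := by exact_mod_cast this
    nlinarith
  -- Dirichlet approximation of `-B / A` with denominator `k ≤ √(A / r)`. In `A q = (A j + B k)² + Δ
  -- k²` both terms on the right are then at most `A r`.
  · set N := ⌊√(A / r)⌋₊ with hN
    have h1 : 1 ≤ √(A / r) := by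
      rw [Real.one_le_sqrt, le_div_iff₀ hrpos]; linarith
    have hN1 : 0 < N := Nat.floor_pos.2 h1
    obtain ⟨j, k, hk, hkN, hjk⟩ := Real.exists_int_int_abs_mul_sub_le (-(B / A : ℝ)) hN1
    refine ⟨j, k, ?_, ?_⟩
    · have h2 : A * (A * j ^ 2 + 2 * B * j * k + C * k ^ 2) = (A * j + B * k) ^ 2 + Δ * k ^ 2 := by
        rw [hΔ]; ring
      have h3 : 0 < Δ * k ^ 2 := by positivity
      have h4 : 0 < A * (A * j ^ 2 + 2 * B * j * k + C * k ^ 2) := by rw [h2]; positivity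
      exact pos_of_mul_pos_right h4 hA.le
    · have hsq : √((A : ℝ) / r) ^ 2 = A / r := Real.sq_sqrt (by positivity)
      have hNle : (N : ℝ) ≤ √(A / r) := Nat.floor_le (by positivity)
      have hNlt : √((A : ℝ) / r) < N + 1 := Nat.lt_floor_add_one _
      have hk' : (k : ℝ) ^ 2 ≤ A / r := by
        rw [← hsq]
        have : (k : ℝ) ≤ N := by exact_mod_cast hkN
        have : (0 : ℝ) < k := by exact_mod_cast hk
        gcongr
        linarith
      have hlin : (A * j + B * k : ℝ) ^ 2 ≤ A * r := by
        have e1 : (A * j + B * k : ℝ) = -(A * (k * (-(B / A : ℝ)) - j)) := by field_simp; ring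
        have e2 : |(A * j + B * k : ℝ)| ≤ A * (1 / (N + 1)) := by
          rw [e1, abs_neg, abs_mul, abs_of_pos hA']; gcongr
        have e3 : (A * (1 / (N + 1 : ℝ))) ^ 2 ≤ A * r := by
          have : (A : ℝ) / r ≤ (N + 1) ^ 2 := by rw [← hsq]; gcongr
          rw [div_le_iff₀ hrpos] at this
          rw [mul_pow, div_pow, one_pow, mul_one_div, div_le_iff₀ (by positivity)]
          nlinarith
        calc _ = |(A * j + B * k : ℝ)| ^ 2 := (sq_abs _).symm
          _ ≤ _ := by gcongr
          _ ≤ _ := e3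
      have h2 : (A : ℝ) * (A * j ^ 2 + 2 * B * j * k + C * k ^ 2)
          = (A * j + B * k) ^ 2 + Δ * k ^ 2 := by
        rw [hΔ]; push_cast; ring
      have h3 : (A * j ^ 2 + 2 * B * j * k + C * k ^ 2 : ℝ) ≤ 2 * r := by
        have : (Δ : ℝ) * k ^ 2 ≤ A * r := by
          rw [← hr2]
          calc r ^ 2 * (k : ℝ) ^ 2 ≤ r ^ 2 * (A / r) := by gcongr
            _ = A * r := by field_simp
        nlinarith
      have h4 : (0 : ℝ) ≤ (A * j ^ 2 + 2 * B * j * k + C * k ^ 2 : ℝ) := by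
        have : (0 : ℝ) ≤ A * (A * j ^ 2 + 2 * B * j * k + C * k ^ 2) := by rw [h2]; positivity
        exact nonneg_of_mul_nonneg_right this hA'
      have h5 : (A * j ^ 2 + 2 * B * j * k + C * k ^ 2 : ℝ) ^ 2 ≤ 4 * Δ := by
        rw [← hr2]; nlinarith
      exact_mod_cast h5

theorem prod_dvd_of_coprime {s : Fin 3 → ℤ} {d : ℤ} (hc : ∀ i j, i ≠ j → IsCoprime (s i) (s j))
    (h : ∀ i, s i ∣ d) : s 0 * s 1 * s 2 ∣ d :=
  IsCoprime.mul_dvd ((hc 0 2 (by decide)).mul_left (hc 1 2 (by decide)))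
    (IsCoprime.mul_dvd (hc 0 1 (by decide)) (h 0) (h 1)) (h 2)

/-- The expansion `z × (c × u) = (z · u) c - (z · c) u`. It solves `z × t = c` for `c` orthogonal to
a primitive `z`. -/
theorem minor_minor {z c u : Fin 3 → ℤ} (hu : u 0 * z 0 + u 1 * z 1 + u 2 * z 2 = 1)
    (hc : c 0 * z 0 + c 1 * z 1 + c 2 * z 2 = 0) (i : Fin 3) :
    minor z (minor c u) i = c i := by
  fin_cases i
  · simp [minor]; linear_combination c 0 * hu - u 0 * hc
  · simp [minor]; linear_combination c 1 * hu - u 1 * hc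
  · simp [minor]; linear_combination c 2 * hu - u 2 * hc

theorem minor_minor_minor (a b u : Fin 3 → ℤ) (i : Fin 3) :
    minor (minor a u) (minor b u) i
      = u i * (u 0 * minor a b 0 + u 1 * minor a b 1 + u 2 * minor a b 2) := by
  fin_cases i <;> simp [minor] <;> ring

/-- The vector is `Q(t)` times the reflection of `z` in `t`, and reflections are isometries. -/
theorem diagForm_reflection (k z t : Fin 3 → ℤ) (hz : diagForm k z z = 0) :
    diagForm k (fun i => diagForm k t t * z i - 2 * diagForm k z t * t i)
      (fun i => diagForm k t t * z i - 2 * diagForm k z t * t i) = 0 := by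
  have : diagForm k (fun i => diagForm k t t * z i - 2 * diagForm k z t * t i)
      (fun i => diagForm k t t * z i - 2 * diagForm k z t * t i)
      = diagForm k t t ^ 2 * diagForm k z z := by
    generalize hA : diagForm k t t = A
    generalize hB : diagForm k z t = B
    simp only [diagForm] at *
    linear_combination (4 * B ^ 2) * hA - 4 * A * B * hB
  rw [this, hz, mul_zero]

/-- A basis of the orthogonal complement of a vector `n` whose cross product is `n`. -/
theorem exists_orthogonal_basis (n : Fin 3 → ℤ) (h : n 0 ≠ 0) :
    ∃ m m' : Fin 3 → ℤ, m 0 * n 0 + m 1 * n 1 + m 2 * n 2 = 0 ∧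
      m' 0 * n 0 + m' 1 * n 1 + m' 2 * n 2 = 0 ∧ ∀ i, minor m m' i = n i := by
  obtain ⟨p, hp⟩ := Int.gcd_dvd_left (n 0) (n 1)
  obtain ⟨r, hr⟩ := Int.gcd_dvd_right (n 0) (n 1)
  have hg := Int.gcd_eq_gcd_ab (n 0) (n 1)
  set g : ℤ := (Int.gcd (n 0) (n 1) : ℤ)
  set a := Int.gcdA (n 0) (n 1)
  set b := Int.gcdB (n 0) (n 1)
  have hg0 : g ≠ 0 := by rintro h0; rw [h0, zero_mul] at hp; exact h hp
  have hab : p * a + r * b = 1 := by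
    apply mul_left_cancel₀ hg0
    linear_combination (-a) * hp - b * hr - hg
  refine ⟨![r, -p, 0], ![n 2 * a, n 2 * b, -g], ?_, ?_, ?_⟩
  · simp; rw [hr]; nth_rewrite 1 [hp]; ring
  · simp; linear_combination (-n 2) * hg
  · intro i
    fin_cases i
    · simp [minor]; linear_combination -hp
    · simp [minor]; linear_combination -hr
    · simp [minor]; linear_combination (n 2) * hab

/-- A version of Holzer's theorem inside the lattice of the `v` that are proportional to a given
zero `z` of a conic modulo its coefficients: this lattice contains a zero of size bounded in terms
of the coefficients only. -/
theorem exists_small_reflection {α s z : Fin 3 → ℤ} (hs : Admissible α s)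
    (hz : diagForm (α * s) z z = 0) (hp : IsPrimitive z) (h0 : 0 < α 0) (h1 : 0 < α 1)
    (hpos : ∀ i, 0 < z i) :
    ∃ v : Fin 3 → ℤ, v 2 ≠ 0 ∧ diagForm (α * s) v v = 0 ∧ (∀ i, s i ∣ minor z v i) ∧
      v 2 ^ 2 ≤ 4 * (α 0 * α 1 * s 0 * s 1) := by
  have hs0 := hs.pos 0
  have hs1 := hs.pos 1
  have hs2 := hs.pos 2
  have hz2 := hpos 2
  obtain ⟨u, hu⟩ := id hp
  -- Since `s * m` and `s * m'` are orthogonal to `z`, the vectors `f = (s * m) × u` and `e = (s *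
  -- m') × u` satisfy `z × f = s * m` and `z × e = s * m'`. So every combination `t` of `f` and `e`
  -- is proportional to `z` modulo each `sᵢ`, and `z, f, e` have determinant `S`.
  obtain ⟨m, m', hm, hm', hmm⟩ := exists_orthogonal_basis (s * z)
    (by simpa using ⟨hs0.ne', (hpos 0).ne'⟩)
  simp only [Pi.mul_apply] at hm hm' hmm
  set S := s 0 * s 1 * s 2 with hS
  have hSpos : 0 < S := by positivity
  have hcf := minor_minor (c := s * m) hu (by simp; linarith)
  have hce := minor_minor (c := s * m') hu (by simp; linarith)
  have hcc : ∀ i, minor (s * m) (s * m') i = S * z i := by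
    intro i
    have := hmm i
    fin_cases i
    · simp [minor] at this ⊢; linear_combination (s 1 * s 2) * this
    · simp [minor] at this ⊢; linear_combination (s 0 * s 2) * this
    · simp [minor] at this ⊢; linear_combination (s 0 * s 1) * this
  have hdet : z 0 * minor (minor (s * m) u) (minor (s * m') u) 0
      + z 1 * minor (minor (s * m) u) (minor (s * m') u) 1
      + z 2 * minor (minor (s * m) u) (minor (s * m') u) 2 = S := by
    simp only [minor_minor_minor, hcc]
    linear_combination S * (u 0 * z 0 + u 1 * z 1 + u 2 * z 2 + 1) * hu
  set f := minor (s * m) u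
  set e := minor (s * m') u
  set k := α * s with hk
  have hk0 : 0 < k 0 := by simp [hk]; positivity
  have hk1 : 0 < k 1 := by simp [hk]; positivity
  have hdisc := reflection_disc k z f e hz
  rw [hdet] at hdisc
  set A := diagForm k f f * z 2 - 2 * diagForm k z f * f 2 with hA
  set B := diagForm k f e * z 2 - diagForm k z f * e 2 - diagForm k z e * f 2 with hB
  set C := diagForm k e e * z 2 - 2 * diagForm k z e * e 2 with hC
  have hdpos : 0 < A * C - B ^ 2 := by rw [hdisc]; positivity
  have hApos : 0 < A := by
    have e1 : A * z 2 = k 0 * (f 0 * z 2 - z 0 * f 2) ^ 2 + k 1 * (f 1 * z 2 - z 1 * f 2) ^ 2 := by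
      rw [hA]; simp only [diagForm] at hz ⊢; linear_combination (-f 2 ^ 2) * hz
    have e2 : 0 ≤ A * z 2 := by rw [e1]; positivity
    have e3 : 0 ≤ A := nonneg_of_mul_nonneg_left e2 hz2
    rcases e3.lt_or_eq with h | h
    · exact h
    · rw [← h] at hdpos; nlinarith [sq_nonneg B]
  obtain ⟨x, y, hq, hq2⟩ := exists_small_value hApos hdpos
  set t : Fin 3 → ℤ := fun i => x * f i + y * e i with ht
  have hzt : ∀ i, s i ∣ minor z t i := by
    intro i
    have : minor z t i = x * minor z f i + y * minor z e i := by simp only [minor, ht]; ring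
    rw [this, hcf, hce]
    exact ⟨x * m i + y * m' i, by simp only [Pi.mul_apply]; ring⟩
  have hzz : ∀ i, s i ∣ minor z z i := fun i => by
    rw [show minor z z i = 0 by simp only [minor]; ring]; exact dvd_zero _
  have hcopz : ∀ i, IsCoprime (s i) (z (i + 2)) := fun i =>
    hs.isCoprime_coord hz hp (by fin_cases i <;> decide)
  have hki : ∀ i, s i ∣ k i := fun i => ⟨α i, by simp [hk, mul_comm]⟩
  -- Both `Q(t)` and `⟨z, t⟩` are divisible by `S`, because `t` and `z` are proportional to the zero
  -- `z` modulo each `sᵢ`. Dividing the reflected vector by `S` cancels the `S` in its bound `2 S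
  -- √(k₀ k₁)`, so the size depends on the coefficients only.
  obtain ⟨P, hP⟩ := prod_dvd_of_coprime hs.cop
    fun i => dvd_diagForm hz (hki i) (hcopz i) (hzt i) (hzt i)
  obtain ⟨R, hR⟩ := prod_dvd_of_coprime hs.cop
    fun i => dvd_diagForm hz (hki i) (hcopz i) (hzz i) (hzt i)
  rw [← hS] at hP hR
  have hqt : S * (P * z 2 - 2 * R * t 2) = A * x ^ 2 + 2 * B * x * y + C * y ^ 2 := by
    have : S * (P * z 2 - 2 * R * t 2) = diagForm k t t * z 2 - 2 * diagForm k z t * t 2 := by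
      rw [hP, hR]; ring
    rw [this, hA, hB, hC]
    simp only [diagForm, ht]; ring
  refine ⟨fun i => P * z i - 2 * R * t i, ?_, ?_, ?_, ?_⟩
  · intro h
    simp only at h
    rw [h, mul_zero] at hqt
    omega
  · have := diagForm_reflection k z t hz
    rw [hP, hR] at this
    have h2 : S ^ 2 * diagForm k (fun i => P * z i - 2 * R * t i) (fun i => P * z i - 2 * R * t i)
        = 0 := by
      rw [← this]; simp only [diagForm]; ring
    exact (mul_eq_zero.1 h2).resolve_left (by positivity)
  · intro i
    have : minor z (fun i => P * z i - 2 * R * t i) i = -2 * R * minor z t i := by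
      simp only [minor]; ring
    rw [this]
    exact (hzt i).mul_left _
  · rw [← hqt, hdisc, mul_pow] at hq2
    have : S ^ 2 * (P * z 2 - 2 * R * t 2) ^ 2 ≤ S ^ 2 * (4 * (α 0 * α 1 * s 0 * s 1)) := by
      refine hq2.trans_eq ?_
      simp [hk]; ring
    exact le_of_mul_le_mul_left this (by positivity)

/-- The zero found in `exists_small_reflection`, divided by the content: this enlarges the moduli
of proportionality by factors `gᵢ`, which are compensated by a smaller size. -/
theorem exists_small_primitive_zero {α s z : Fin 3 → ℤ} (hs : Admissible α s)
    (hz : diagForm (α * s) z z = 0) (hp : IsPrimitive z) (h0 : 0 < α 0) (h1 : 0 < α 1)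
    (hpos : ∀ i, 0 < z i) :
    ∃ v g : Fin 3 → ℤ, v 2 ≠ 0 ∧ IsPrimitive v ∧ diagForm (α * s) v v = 0 ∧ (∀ i, 0 < g i) ∧
      (∀ i, g i ∣ s i) ∧ (∀ i, s i ∣ g i * minor z v i) ∧
      (g 0 * g 1 * g 2) ^ 2 * v 2 ^ 2 ≤ 4 * (α 0 * α 1 * s 0 * s 1) := by
  obtain ⟨v, hv2, hv, hzv, hle⟩ := exists_small_reflection hs hz hp h0 h1 hpos
  obtain ⟨G, v', hG, hvG, hprim⟩ : ∃ (G : ℤ) (v' : Fin 3 → ℤ), 0 < G ∧ (∀ i, v i = G * v' i) ∧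
      IsPrimitive v' := by
    set G : ℤ := ((Int.gcd ((Int.gcd (v 0) (v 1) : ℕ) : ℤ) (v 2) : ℕ) : ℤ) with hG
    have d2 : G ∣ v 2 := Int.gcd_dvd_right _ _
    have d01 : G ∣ (Int.gcd (v 0) (v 1) : ℤ) := Int.gcd_dvd_left _ _
    have d0 : G ∣ v 0 := d01.trans (Int.gcd_dvd_left _ _)
    have d1 : G ∣ v 1 := d01.trans (Int.gcd_dvd_right _ _)
    have hG0 : G ≠ 0 := by rintro h; rw [h] at d2; exact hv2 (zero_dvd_iff.1 d2)
    obtain ⟨a, ha⟩ := d0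
    obtain ⟨b, hb⟩ := d1
    obtain ⟨c, hc⟩ := d2
    have b1 := Int.gcd_eq_gcd_ab (Int.gcd (v 0) (v 1)) (v 2)
    have b2 := Int.gcd_eq_gcd_ab (v 0) (v 1)
    rw [← hG] at b1
    rw [b2] at b1
    refine ⟨G, ![a, b, c], lt_of_le_of_ne (by positivity) hG0.symm, ?_, ?_⟩
    · intro i; fin_cases i
      · exact ha
      · exact hb
      · exact hc
    · generalize Int.gcdA (v 0 * (v 0).gcdA (v 1) + v 1 * (v 0).gcdB (v 1)) (v 2) = x at b1
      generalize Int.gcdB (v 0 * (v 0).gcdA (v 1) + v 1 * (v 0).gcdB (v 1)) (v 2) = y at b1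
      refine ⟨![(v 0).gcdA (v 1) * x, (v 0).gcdB (v 1) * x, y], ?_⟩
      simp
      apply mul_left_cancel₀ hG0
      linear_combination (-((v 0).gcdA (v 1) * x)) * ha - ((v 0).gcdB (v 1) * x) * hb - y * hc - b1
  -- The `gᵢ` are pairwise coprime divisors of the content `G`, so removing `G` shrinks the zero by
  -- at least the factor `g₀ g₁ g₂`.
  set g : Fin 3 → ℤ := fun i => Int.gcd G (s i) with hg
  have hgpos : ∀ i, 0 < g i := fun i => by
    have := Int.gcd_pos_of_ne_zero_left (s i) hG.ne'
    simp only [hg]; exact_mod_cast this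
  have hgs : ∀ i, g i ∣ s i := fun i => Int.gcd_dvd_right _ _
  have hgG : g 0 * g 1 * g 2 ∣ G := prod_dvd_of_coprime
    (fun i j hij => ((hs.cop i j hij).of_isCoprime_of_dvd_left (hgs i)).of_isCoprime_of_dvd_right
      (hgs j)) fun i => Int.gcd_dvd_left _ _
  refine ⟨v', g, ?_, hprim, ?_, hgpos, hgs, ?_, ?_⟩
  · intro h; rw [hvG, h, mul_zero] at hv2; exact hv2 rfl
  · have : G ^ 2 * diagForm (α * s) v' v' = 0 := by
      rw [← hv]; simp only [diagForm, hvG]; ring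
    exact (mul_eq_zero.1 this).resolve_left (by positivity)
  · intro i
    have h2 : s i ∣ G * minor z v' i := by
      have := hzv i
      rwa [show minor z v i = G * minor z v' i by simp only [minor, hvG]; ring] at this
    have h3 : s i ∣ s i * minor z v' i := dvd_mul_right _ _
    simp only [hg]
    have := dvd_gcd h2 h3
    rw [← Int.coe_gcd, Int.gcd_mul_right] at this
    push_cast at this
    exact (this.trans (mul_dvd_mul_left _ (abs_dvd_self _)))
  · refine le_trans ?_ hle
    rw [hvG 2, mul_pow G]
    have : g 0 * g 1 * g 2 ≤ G := Int.le_of_dvd hG hgG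
    have h00 := hgpos 0
    have h11 := hgpos 1
    have h22 := hgpos 2
    have : (g 0 * g 1 * g 2) ^ 2 ≤ G ^ 2 := by gcongr
    exact mul_le_mul_of_nonneg_right this (sq_nonneg _)

/-! ### Spacing: points on one conic, conics through one point -/

theorem card_le_of_spaced {ι : Type*} (F : Finset ι) (f : ι → ℝ) {R δ : ℝ} (hδ : 0 < δ)
    (hR : 0 ≤ R) (h0 : ∀ x ∈ F, 0 ≤ f x) (h1 : ∀ x ∈ F, f x ≤ R)
    (hs : ∀ x ∈ F, ∀ y ∈ F, x ≠ y → δ ≤ |f x - f y|) : (F.card : ℝ) ≤ 1 + R / δ := by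
  classical
  have hmaps : ∀ x ∈ F, ⌊f x / δ⌋₊ ∈ Finset.range (⌊R / δ⌋₊ + 1) := fun x hx => by
    rw [Finset.mem_range, Nat.lt_succ_iff]
    exact Nat.floor_le_floor (by gcongr; exact h1 x hx)
  have hinj : Set.InjOn (fun x => ⌊f x / δ⌋₊) F := by
    intro x hx y hy hxy
    by_contra hne
    have h2 := hs x hx y hy hne
    simp only at hxy
    have a1 := Nat.floor_le (div_nonneg (h0 x hx) hδ.le)
    have a2 := Nat.floor_le (div_nonneg (h0 y hy) hδ.le)
    have b1 := Nat.lt_floor_add_one (f x / δ)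
    have b2 := Nat.lt_floor_add_one (f y / δ)
    rw [hxy] at a1 b1
    have h3 : |f x / δ - f y / δ| < 1 := by rw [abs_lt]; constructor <;> linarith
    rw [← sub_div, abs_div, abs_of_pos hδ, div_lt_one hδ] at h3
    linarith
  have := Finset.card_le_card_of_injOn _ hmaps hinj
  rw [Finset.card_range] at this
  have h4 : (F.card : ℝ) ≤ ⌊R / δ⌋₊ + 1 := by exact_mod_cast this
  have h5 := Nat.floor_le (div_nonneg hR hδ.le)
  linarith

theorem eq_of_proportional {z z' : Fin 3 → ℤ} (hz : IsPrimitive z) (hz' : IsPrimitive z')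
    (h0 : 0 < z 0) (h0' : 0 < z' 0) (h : ∀ i, z' i * z 0 = z' 0 * z i) : z = z' := by
  obtain ⟨u, hu⟩ := hz
  obtain ⟨u', hu'⟩ := hz'
  have d1 : z' 0 ∣ z 0 := ⟨u' 0 * z 0 + u' 1 * z 1 + u' 2 * z 2, by
    linear_combination (-z 0) * hu' + u' 0 * h 0 + u' 1 * h 1 + u' 2 * h 2⟩
  have d2 : z 0 ∣ z' 0 := ⟨u 0 * z' 0 + u 1 * z' 1 + u 2 * z' 2, by
    linear_combination (-z' 0) * hu - u 0 * h 0 - u 1 * h 1 - u 2 * h 2⟩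
  have e : z 0 = z' 0 := le_antisymm (Int.le_of_dvd h0' d2) (Int.le_of_dvd h0 d1)
  funext i
  have := h i
  rw [← e, mul_comm] at this
  exact (mul_left_cancel₀ h0.ne' this).symm

/-- Points on a conic that are pairwise orthogonal modulo `m` are well spaced. -/
theorem card_conic_points_le {α s : Fin 3 → ℤ} (hs : ∀ i, 0 < s i) (h0 : 0 < α 0) (h1 : 0 < α 1)
    (h2 : α 2 < 0) {Z₀ Z₂ : ℝ} (hZ₀ : 0 < Z₀) (hZ₂ : 0 < Z₂) {m : ℤ} (hm : 0 < m)
    (F : Finset (Fin 3 → ℤ))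
    (hF : ∀ z ∈ F, (∀ i, 0 < z i) ∧ diagForm (α * s) z z = 0 ∧ IsPrimitive z ∧
      (z 0 : ℝ) ≤ 2 * Z₀ ∧ Z₂ ≤ z 2 ∧ (z 2 : ℝ) ≤ 2 * Z₂)
    (hd : ∀ z ∈ F, ∀ z' ∈ F, m ∣ diagForm (α * s) z z') :
    (F.card : ℝ) ≤ 1 + 8 * √(α 0 * s 0) * Z₀ / √m := by
  have hs0 : (0 : ℝ) < s 0 := by exact_mod_cast hs 0
  have hs1 : (0 : ℝ) < s 1 := by exact_mod_cast hs 1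
  have hs2 : (0 : ℝ) < s 2 := by exact_mod_cast hs 2
  have h0' : (0 : ℝ) < α 0 := by exact_mod_cast h0
  have h1' : (0 : ℝ) < α 1 := by exact_mod_cast h1
  have h2' : (0 : ℝ) < -α 2 := by
    have : (α 2 : ℝ) < 0 := by exact_mod_cast h2
    linarith
  have hm' : (0 : ℝ) < m := by exact_mod_cast hm
  set A := √(α 0 * s 0 : ℝ) with hA
  set B := √(α 1 * s 1 : ℝ) with hB
  set C := √(-α 2 * s 2 : ℝ) with hC
  have hApos : 0 < A := Real.sqrt_pos.2 (by positivity)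
  have hBpos : 0 < B := Real.sqrt_pos.2 (by positivity)
  have hCpos : 0 < C := Real.sqrt_pos.2 (by positivity)
  have hA2 : A ^ 2 = α 0 * s 0 := Real.sq_sqrt (by positivity)
  have hB2 : B ^ 2 = α 1 * s 1 := Real.sq_sqrt (by positivity)
  have hC2 : C ^ 2 = -α 2 * s 2 := Real.sq_sqrt (by positivity)
  -- The rational parameter of the conic `(A z₀)² + (B z₁)² = (C z₂)²`, projected from a real point
  -- of it.
  set f : (Fin 3 → ℤ) → ℝ := fun z => A * z 0 / (B * z 1 + C * z 2) with hf
  have hzpos : ∀ z ∈ F, ∀ i, (0 : ℝ) < z i := fun z hz i => by exact_mod_cast (hF z hz).1 i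
  have hp : ∀ z ∈ F, 0 < B * z 1 + C * z 2 := fun z hz => by
    have := hzpos z hz 1
    have := hzpos z hz 2
    positivity
  have hiso : ∀ z ∈ F, (A * z 0) ^ 2 + (B * z 1) ^ 2 = (C * z 2) ^ 2 := fun z hz => by
    have := (hF z hz).2.1
    simp only [diagForm, Pi.mul_apply] at this
    have h : (α 0 * s 0 * z 0 * z 0 + α 1 * s 1 * z 1 * z 1 + α 2 * s 2 * z 2 * z 2 : ℝ) = 0 := by
      exact_mod_cast this
    rw [mul_pow, mul_pow, mul_pow, hA2, hB2, hC2]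
    linarith
  have hple : ∀ z ∈ F, B * z 1 + C * z 2 ≤ 4 * C * Z₂ := fun z hz => by
    have e1 := hzpos z hz 1
    have e2 := hzpos z hz 2
    have : B * z 1 ≤ C * z 2 := by
      apply (sq_le_sq₀ (by positivity) (by positivity)).1
      rw [← hiso z hz]; nlinarith [sq_nonneg (A * z 0)]
    have := (hF z hz).2.2.2.2.2
    nlinarith
  -- The squared distance of two parameters is `-2 ⟨z, z'⟩` over the product of the denominators.
  -- Distinct points have `⟨z, z'⟩ ≠ 0`, so divisibility by `m` makes it at least `m` in absolute
  -- value.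
  have key : ∀ z ∈ F, ∀ z' ∈ F, (f z - f z') ^ 2 * ((B * z 1 + C * z 2) * (B * z' 1 + C * z' 2))
      = -2 * (diagForm (α * s) z z' : ℤ) := by
    intro z hz z' hz'
    have e1 := hp z hz
    have e2 := hp z' hz'
    have i1 := hiso z hz
    have i2 := hiso z' hz'
    have : (diagForm (α * s) z z' : ℝ)
        = A ^ 2 * z 0 * z' 0 + B ^ 2 * z 1 * z' 1 - C ^ 2 * z 2 * z' 2 := by
      rw [hA2, hB2, hC2]; simp only [diagForm, Pi.mul_apply]; push_cast; ring
    rw [this]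
    simp only [hf]
    rw [div_sub_div _ _ e1.ne' e2.ne', div_pow, div_mul_eq_mul_div, div_eq_iff (by positivity)]
    linear_combination ((B * z 1 + C * z 2) * (B * z' 1 + C * z' 2) * (B * z' 1 + C * z' 2) ^ 2) * i1
      + ((B * z 1 + C * z 2) * (B * z' 1 + C * z' 2) * (B * z 1 + C * z 2) ^ 2) * i2
  have hinj : ∀ z ∈ F, ∀ z' ∈ F, f z = f z' → z = z' := by
    intro z hz z' hz' hff
    have e1 := hp z hz
    have e2 := hp z' hz'
    have i1 := hiso z hz
    have i2 := hiso z' hz'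
    have n0 := hzpos z hz 0
    have n0' := hzpos z' hz' 0
    simp only [hf] at hff
    rw [div_eq_div_iff e1.ne' e2.ne'] at hff
    have hq : A * z 0 * (C * z' 2 - B * z' 1) = A * z' 0 * (C * z 2 - B * z 1) := by
      have : (A * z 0 * (C * z' 2 - B * z' 1)) * ((B * z 1 + C * z 2) * (B * z' 1 + C * z' 2))
        = (A * z' 0 * (C * z 2 - B * z 1)) * ((B * z 1 + C * z 2) * (B * z' 1 + C * z' 2)) := by
        linear_combination (-(A * z 0) * (B * z 1 + C * z 2)) * i2
          + (A * z' 0) * (B * z' 1 + C * z' 2) * i1 - A * z 0 * A * z' 0 * hff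
      exact mul_right_cancel₀ (by positivity) this
    have r1 : (z' 1 * z 0 : ℝ) = z' 0 * z 1 := by
      have : (2 * A * B) * (z' 1 * z 0 : ℝ) = (2 * A * B) * (z' 0 * z 1) := by
        linear_combination hff - hq
      exact mul_left_cancel₀ (by positivity) this
    have r2 : (z' 2 * z 0 : ℝ) = z' 0 * z 2 := by
      have : (2 * A * C) * (z' 2 * z 0 : ℝ) = (2 * A * C) * (z' 0 * z 2) := by
        linear_combination hff + hq
      exact mul_left_cancel₀ (by positivity) this
    refine eq_of_proportional (hF z hz).2.2.1 (hF z' hz').2.2.1 ((hF z hz).1 0) ((hF z' hz').1 0) ?_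
    intro i
    fin_cases i
    · rfl
    · exact_mod_cast r1
    · exact_mod_cast r2
  have hmain := card_le_of_spaced F f (R := 2 * A * Z₀ / (C * Z₂)) (δ := √m / (4 * C * Z₂))
    (by have := Real.sqrt_pos.2 hm'; positivity) (by positivity)
    (fun z hz => by
      have e1 := hp z hz
      have e2 := hzpos z hz 0
      simp only [hf]; positivity)
    (fun z hz => by
      have e1 := hzpos z hz 1
      have e2 := hzpos z hz 0
      have e3 := (hF z hz).2.2.2.1
      have e4 := (hF z hz).2.2.2.2.1
      simp only [hf]
      apply div_le_div₀ (by positivity) (by nlinarith) (by positivity)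
      nlinarith [mul_pos hBpos e1])
    (fun z hz z' hz' hne => by
      have e1 := hp z hz
      have e2 := hp z' hz'
      have l1 := hple z hz
      have l2 := hple z' hz'
      have k1 := key z hz z' hz'
      have hne' : f z - f z' ≠ 0 := fun h => hne (hinj z hz z' hz' (sub_eq_zero.1 h))
      have hbpos : (0 : ℝ) < -2 * (diagForm (α * s) z z' : ℤ) := by rw [← k1]; positivity
      have hb : 0 < -diagForm (α * s) z z' := by
        have : (0 : ℝ) < -(diagForm (α * s) z z' : ℤ) := by linarith
        exact_mod_cast this
      have hmb : m ≤ -diagForm (α * s) z z' := Int.le_of_dvd hb ((dvd_neg).2 (hd z hz z' hz'))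
      have hmb' : (m : ℝ) ≤ -(diagForm (α * s) z z' : ℤ) := by exact_mod_cast hmb
      apply (sq_le_sq₀ (by positivity) (abs_nonneg _)).1
      rw [sq_abs, div_pow, Real.sq_sqrt hm'.le, div_le_iff₀ (by positivity)]
      have l3 : (B * z 1 + C * z 2) * (B * z' 1 + C * z' 2) ≤ (4 * C * Z₂) ^ 2 := by
        rw [sq]; gcongr
      nlinarith [mul_le_mul_of_nonneg_left l3 (sq_nonneg (f z - f z'))])
  refine hmain.trans_eq ?_
  have := Real.sqrt_pos.2 hm'
  field_simp
  ring

/-- The greatest common divisor of `v₀²` and `v₁²` is prime to `v₂` by primitivity and to `g` by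
assumption, so it can be cancelled. It divides the cube of `u₀ v₀ + u₁ v₁` since each cubic monomial
contains `v₀²` or `v₁²`. -/
theorem sq_dvd_of_primitive {v : Fin 3 → ℤ} (hv : IsPrimitive v) {g E : ℤ}
    (hg : IsCoprime g (v 0)) (h0 : v 2 ^ 2 * g ∣ v 0 ^ 2 * E) (h1 : v 2 ^ 2 * g ∣ v 1 ^ 2 * E) :
    v 2 ^ 2 * g ∣ E := by
  obtain ⟨u, hu⟩ := hv
  set y : ℤ := ((Int.gcd (v 0 ^ 2) (v 1 ^ 2) : ℕ) : ℤ) with hy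
  have d0 : y ∣ v 0 ^ 2 := Int.gcd_dvd_left _ _
  have d1 : y ∣ v 1 ^ 2 := Int.gcd_dvd_right _ _
  have hyE : v 2 ^ 2 * g ∣ y * E := by
    rw [hy, Int.gcd_eq_gcd_ab, add_mul]
    exact dvd_add ((h0.mul_right ((v 0 ^ 2).gcdA (v 1 ^ 2))).trans (by rw [mul_right_comm]))
      ((h1.mul_right ((v 0 ^ 2).gcdB (v 1 ^ 2))).trans (by rw [mul_right_comm]))
  have c1 : IsCoprime (v 2) (u 0 * v 0 + u 1 * v 1) := ⟨u 2, 1, by linarith⟩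
  have c2 : y ∣ (u 0 * v 0 + u 1 * v 1) ^ 3 := by
    rw [show (u 0 * v 0 + u 1 * v 1) ^ 3 = v 0 ^ 2 * (u 0 ^ 3 * v 0 + 3 * u 0 ^ 2 * u 1 * v 1)
      + v 1 ^ 2 * (3 * u 0 * u 1 ^ 2 * v 0 + u 1 ^ 3 * v 1) by ring]
    exact dvd_add (d0.mul_right _) (d1.mul_right _)
  have c3 : IsCoprime (v 2 ^ 2) y := (c1.pow (m := 2) (n := 3)).of_isCoprime_of_dvd_right c2
  have c4 : IsCoprime g y := (hg.pow_right (n := 2)).of_isCoprime_of_dvd_right d0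
  exact (c3.mul_left c4).dvd_of_dvd_mul_left hyE

/-- The number of conics with given divisibilities `gᵢ ∣ sᵢ` through a given point. -/
theorem card_coeffs_le {α v g : Fin 3 → ℤ} (h0 : 0 < α 0) (h1 : 0 < α 1) (h2 : α 2 < 0)
    (hv : IsPrimitive v) (hv2 : v 2 ≠ 0) (hg : ∀ i, 0 < g i) {M₀ M₁ : ℝ} (hM₀ : 0 < M₀)
    (hM₁ : 0 < M₁) (F : Finset (Fin 3 → ℤ))
    (hF : ∀ s ∈ F, Admissible α s ∧ diagForm (α * s) v v = 0 ∧ (∀ i, g i ∣ s i) ∧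
      M₀ ≤ s 0 ∧ (s 0 : ℝ) ≤ 2 * M₀ ∧ (s 1 : ℝ) ≤ 2 * M₁) :
    (F.card : ℝ) ≤ 1 + 8 * (α 0 * α 1) * (M₀ * M₁) / ((g 0 * g 1 * g 2) * v 2 ^ 2) := by
  have h0' : (0 : ℝ) < α 0 := by exact_mod_cast h0
  have h1' : (0 : ℝ) < α 1 := by exact_mod_cast h1
  have g0 : (0 : ℝ) < g 0 := by exact_mod_cast hg 0
  have g1 : (0 : ℝ) < g 1 := by exact_mod_cast hg 1
  have g2 : (0 : ℝ) < g 2 := by exact_mod_cast hg 2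
  have hv2' : (0 : ℝ) < (v 2 : ℝ) ^ 2 := by positivity
  have hspos : ∀ s ∈ F, ∀ i, (0 : ℝ) < s i := fun s hs i => by exact_mod_cast (hF s hs).1.pos i
  -- The vectors `(αᵢ sᵢ)` and `(αᵢ s'ᵢ)` are orthogonal to `(vᵢ²)`, so their cross product is
  -- proportional to it. This brings the factor `v₂²` into the last component, and `gᵢ ∣ sᵢ, s'ᵢ`
  -- brings in the rest.
  have hdvd : ∀ s ∈ F, ∀ s' ∈ F, g 0 * g 1 * g 2 * v 2 ^ 2 ∣ α 0 * α 1 * (s 0 * s' 1 - s 1 * s' 0) := by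
    intro s hs s' hs'
    obtain ⟨ha, hz, hgs, -⟩ := hF s hs
    obtain ⟨ha', hz', hgs', -⟩ := hF s' hs'
    simp only [diagForm, Pi.mul_apply] at hz hz'
    have cg : ∀ i j, i ≠ j → IsCoprime (g i) (v j) := fun i j hij =>
      (ha.isCoprime_coord (by simpa only [diagForm, Pi.mul_apply] using hz) hv hij).of_isCoprime_of_dvd_left (hgs i)
    have cgg : ∀ i j, i ≠ j → IsCoprime (g i) (g j) := fun i j hij =>
      ((ha.cop i j hij).of_isCoprime_of_dvd_left (hgs i)).of_isCoprime_of_dvd_right (hgs j)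
    obtain ⟨a, ha2⟩ := hgs 2
    obtain ⟨a', ha2'⟩ := hgs' 2
    have e0 : v 2 ^ 2 * g 2 ∣ v 0 ^ 2 * (α 0 * α 1 * (s 0 * s' 1 - s 1 * s' 0)) :=
      ⟨α 1 * α 2 * (a' * s 1 - a * s' 1), by
        rw [ha2] at hz; rw [ha2'] at hz'
        linear_combination (α 1 * s' 1) * hz - α 1 * s 1 * hz'⟩
    have e1 : v 2 ^ 2 * g 2 ∣ v 1 ^ 2 * (α 0 * α 1 * (s 0 * s' 1 - s 1 * s' 0)) :=
      ⟨α 0 * α 2 * (a * s' 0 - a' * s 0), by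
        rw [ha2] at hz; rw [ha2'] at hz'
        linear_combination (-α 0 * s' 0) * hz + α 0 * s 0 * hz'⟩
    have e2 := sq_dvd_of_primitive hv (cg 2 0 (by decide)) e0 e1
    have e3 : g 0 * g 1 ∣ α 0 * α 1 * (s 0 * s' 1 - s 1 * s' 0) := by
      refine Dvd.dvd.mul_left (dvd_sub (mul_dvd_mul (hgs 0) (hgs' 1)) ?_) _
      rw [mul_comm (s 1)]
      exact mul_dvd_mul (hgs' 0) (hgs 1)
    have e4 : IsCoprime (g 0 * g 1) (v 2 ^ 2 * g 2) :=
      IsCoprime.mul_left ((cg 0 2 (by decide)).pow_right.mul_right (cgg 0 2 (by decide)))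
        ((cg 1 2 (by decide)).pow_right.mul_right (cgg 1 2 (by decide)))
    rw [show g 0 * g 1 * g 2 * v 2 ^ 2 = g 0 * g 1 * (v 2 ^ 2 * g 2) by ring]
    exact e4.mul_dvd e3 e2
  have hmain := card_le_of_spaced F (fun s => (s 1 / s 0 : ℝ)) (R := 2 * M₁ / M₀)
    (δ := (g 0 * g 1 * g 2) * v 2 ^ 2 / (α 0 * α 1 * (4 * M₀ ^ 2)))
    (by positivity) (by positivity)
    (fun s hs => by
      have a0 := hspos s hs 0
      have a1 := hspos s hs 1
      positivity)
    (fun s hs => by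
      obtain ⟨-, -, -, b0, b1, b2⟩ := hF s hs
      have a1 := hspos s hs 1
      exact div_le_div₀ (by positivity) b2 hM₀ b0)
    (fun s hs s' hs' hne => by
      have a0 := hspos s hs 0
      have a0' := hspos s' hs' 0
      have hd := hdvd s hs s' hs'
      obtain ⟨ha, hz, -, -, b1, -⟩ := hF s hs
      obtain ⟨ha', hz', -, -, b1', -⟩ := hF s' hs'
      -- The ratio `s₁ / s₀` determines `s`: it is in lowest terms with positive entries, and the
      -- equation at `v` then gives `s₂`.
      have hD : s 0 * s' 1 - s 1 * s' 0 ≠ 0 := by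
        intro hD
        apply hne
        have d1 : s 0 ∣ s' 0 := (ha.cop 0 1 (by decide)).dvd_of_dvd_mul_left ⟨s' 1, by linarith⟩
        have d2 : s' 0 ∣ s 0 := (ha'.cop 0 1 (by decide)).dvd_of_dvd_mul_right ⟨s 1, by linarith⟩
        have q0 : s 0 = s' 0 := le_antisymm (Int.le_of_dvd (ha'.pos 0) d1)
          (Int.le_of_dvd (ha.pos 0) d2)
        have q1 : s 1 = s' 1 := by
          rw [← q0] at hD
          apply mul_left_cancel₀ (ha.pos 0).ne'
          linarith
        have q2 : s 2 = s' 2 := by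
          simp only [diagForm, Pi.mul_apply] at hz hz'
          rw [q0, q1] at hz
          have : α 2 * v 2 ^ 2 * s 2 = α 2 * v 2 ^ 2 * s' 2 := by linarith
          exact mul_left_cancel₀ (mul_ne_zero h2.ne (pow_ne_zero 2 hv2)) this
        funext i
        fin_cases i
        · exact q0
        · exact q1
        · exact q2
      have hle : g 0 * g 1 * g 2 * v 2 ^ 2 ≤ |α 0 * α 1 * (s 0 * s' 1 - s 1 * s' 0)| :=
        Int.le_of_dvd (abs_pos.2 (mul_ne_zero (mul_pos h0 h1).ne' hD)) ((dvd_abs _ _).2 hd)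
      rw [abs_mul, abs_of_pos (mul_pos h0 h1)] at hle
      have hle' : (g 0 * g 1 * g 2 * v 2 ^ 2 : ℝ) ≤ α 0 * α 1 * |(s 0 * s' 1 - s 1 * s' 0 : ℝ)| := by
        exact_mod_cast hle
      rw [div_sub_div _ _ a0.ne' a0'.ne', abs_div, abs_of_pos (mul_pos a0 a0'),
        div_le_div_iff₀ (by positivity) (by positivity)]
      have l3 : (s 0 * s' 0 : ℝ) ≤ 4 * M₀ ^ 2 := by
        calc (s 0 * s' 0 : ℝ) ≤ (2 * M₀) * (2 * M₀) := by gcongr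
          _ = _ := by ring
      calc (g 0 * g 1 * g 2 * v 2 ^ 2 : ℝ) * (s 0 * s' 0)
          ≤ (α 0 * α 1 * |(s 0 * s' 1 - s 1 * s' 0 : ℝ)|) * (4 * M₀ ^ 2) := by gcongr
        _ = |(s 1 * s' 0 - s 0 * s' 1 : ℝ)| * (α 0 * α 1 * (4 * M₀ ^ 2)) := by
          rw [abs_sub_comm]; ring)
  refine hmain.trans_eq ?_
  field_simp
  ring

/-! ### Counting pairs of a conic and a point -/

theorem card_le_sum_of_fiber_le {ι κ : Type*} [DecidableEq κ] (F : Finset ι) (f : ι → κ)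
    (c : κ → ℝ) (h : ∀ b ∈ F.image f, ((F.filter (f · = b)).card : ℝ) ≤ c b) :
    (F.card : ℝ) ≤ ∑ b ∈ F.image f, c b := by
  rw [Finset.card_eq_sum_card_image f F]
  push_cast
  exact Finset.sum_le_sum h

theorem card_le_mul_of_fiber_le {ι κ : Type*} [DecidableEq κ] (F : Finset ι) (f : ι → κ) {c N : ℝ}
    (h : ∀ b ∈ F.image f, ((F.filter (f · = b)).card : ℝ) ≤ c) (hc : 0 ≤ c)
    (hN : ((F.image f).card : ℝ) ≤ N) : (F.card : ℝ) ≤ N * c := by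
  refine (card_le_sum_of_fiber_le F f (fun _ => c) h).trans ?_
  rw [Finset.sum_const, nsmul_eq_mul]
  gcongr

theorem card_int_le (T : Finset ℤ) {Y : ℝ} (hY : 0 ≤ Y) (h : ∀ x ∈ T, x ≠ 0 ∧ |(x : ℝ)| ≤ Y) :
    (T.card : ℝ) ≤ 2 * Y := by
  have hsub : T ⊆ (Finset.Icc (-⌊Y⌋) ⌊Y⌋).erase 0 := fun x hx => by
    obtain ⟨h0, h1⟩ := h x hx
    rw [abs_le] at h1
    rw [Finset.mem_erase, Finset.mem_Icc]
    refine ⟨h0, ?_, Int.le_floor.2 h1.2⟩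
    have : -x ≤ ⌊Y⌋ := Int.le_floor.2 (by push_cast; linarith)
    linarith
  have hf : 0 ≤ ⌊Y⌋ := Int.floor_nonneg.2 hY
  have hc := Finset.card_le_card hsub
  rw [Finset.card_erase_of_mem (by simp [hf]), Int.card_Icc] at hc
  have h2 : (T.card : ℤ) ≤ 2 * ⌊Y⌋ := by omega
  have h3 : (T.card : ℝ) ≤ 2 * ⌊Y⌋ := by exact_mod_cast h2
  have := Int.floor_le Y
  linarith

/-- Pairs of a conic and a point on it, for points with a given last coordinate. -/
theorem card_pairs_slice_le {α g : Fin 3 → ℤ} {n : ℤ} {q : Fin 3 → ℝ} {Y₀ Y₁ : ℝ}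
    (h0 : 0 < α 0) (h1 : 0 < α 1) (h2 : α 2 < 0) (hn : n ≠ 0) (hg : ∀ i, 0 < g i)
    (hq : ∀ i, 0 < q i) (hY₀ : 0 ≤ Y₀) (hY₁ : 0 ≤ Y₁) (E : Finset ((Fin 3 → ℤ) × (Fin 3 → ℤ)))
    (hE : ∀ x ∈ E, Admissible α x.1 ∧ diagForm (α * x.1) x.2 x.2 = 0 ∧ IsPrimitive x.2 ∧
      (∀ i, g i ∣ x.1 i) ∧ (∀ i, q i ^ 2 ≤ x.1 i ∧ (x.1 i : ℝ) ≤ 2 * q i ^ 2) ∧ x.2 2 = n ∧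
      x.2 0 ≠ 0 ∧ x.2 1 ≠ 0 ∧ |(x.2 0 : ℝ)| ≤ Y₀ ∧ |(x.2 1 : ℝ)| ≤ Y₁) :
    (E.card : ℝ) ≤ 4 * (Y₀ * Y₁) *
      (1 + 8 * (α 0 * α 1) * (q 0 ^ 2 * q 1 ^ 2) / ((g 0 * g 1 * g 2) * n ^ 2)) := by
  classical
  have g0 : (0 : ℝ) < g 0 := by exact_mod_cast hg 0
  have g1 : (0 : ℝ) < g 1 := by exact_mod_cast hg 1
  have g2 : (0 : ℝ) < g 2 := by exact_mod_cast hg 2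
  have h0' : (0 : ℝ) < α 0 := by exact_mod_cast h0
  have h1' : (0 : ℝ) < α 1 := by exact_mod_cast h1
  apply card_le_mul_of_fiber_le E Prod.snd
  · intro v hv
    obtain ⟨x, hx, rfl⟩ := Finset.mem_image.1 hv
    have hx' := hE x hx
    have hinj : Set.InjOn Prod.fst (↑(E.filter fun y => y.2 = x.2) : Set ((Fin 3 → ℤ) × (Fin 3 → ℤ))) := by
      intro y hy y' hy' hyy
      rw [Finset.mem_coe, Finset.mem_filter] at hy hy'
      exact Prod.ext hyy (hy.2.trans hy'.2.symm)
    rw [← Finset.card_image_of_injOn hinj]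
    have := card_coeffs_le (α := α) (v := x.2) (g := g) (M₀ := q 0 ^ 2) (M₁ := q 1 ^ 2) h0 h1 h2
      hx'.2.2.1 (by rw [hx'.2.2.2.2.2.1]; exact hn) hg (pow_pos (hq 0) 2) (pow_pos (hq 1) 2)
      ((E.filter (·.2 = x.2)).image Prod.fst) (by
        intro s hs
        obtain ⟨y, hy, rfl⟩ := Finset.mem_image.1 hs
        rw [Finset.mem_filter] at hy
        have hy' := hE y hy.1
        rw [hy.2] at hy'
        exact ⟨hy'.1, hy'.2.1, hy'.2.2.2.1, (hy'.2.2.2.2.1 0).1, (hy'.2.2.2.2.1 0).2,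
          (hy'.2.2.2.2.1 1).2⟩)
    rwa [hx'.2.2.2.2.2.1] at this
  · positivity
  · set T := E.image Prod.snd with hT
    have hT' : ∀ v ∈ T, v 2 = n ∧ v 0 ≠ 0 ∧ v 1 ≠ 0 ∧ |(v 0 : ℝ)| ≤ Y₀ ∧ |(v 1 : ℝ)| ≤ Y₁ := by
      intro v hv
      obtain ⟨x, hx, rfl⟩ := Finset.mem_image.1 hv
      exact (hE x hx).2.2.2.2.2
    have hle : T.card ≤ ((T.image (· 0)) ×ˢ (T.image (· 1))).card := by
      apply Finset.card_le_card_of_injOn (fun v => (v 0, v 1))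
      · intro v hv
        rw [Finset.mem_coe, Finset.mem_product]
        exact ⟨Finset.mem_image_of_mem _ hv, Finset.mem_image_of_mem _ hv⟩
      · intro v hv v' hv' h
        simp only [Prod.mk.injEq] at h
        funext i
        fin_cases i
        · exact h.1
        · exact h.2
        · exact (hT' v hv).1.trans (hT' v' hv').1.symm
    rw [Finset.card_product] at hle
    have c0 := card_int_le (T.image (· 0)) hY₀ (by
      intro a ha
      obtain ⟨v, hv, rfl⟩ := Finset.mem_image.1 ha
      exact ⟨(hT' v hv).2.1, (hT' v hv).2.2.2.1⟩)
    have c1 := card_int_le (T.image (· 1)) hY₁ (by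
      intro a ha
      obtain ⟨v, hv, rfl⟩ := Finset.mem_image.1 ha
      exact ⟨(hT' v hv).2.2.1, (hT' v hv).2.2.2.2⟩)
    calc (T.card : ℝ) ≤ ((T.image (· 0)).card : ℝ) * (T.image (· 1)).card := by exact_mod_cast hle
      _ ≤ (2 * Y₀) * (2 * Y₁) := by gcongr
      _ = 4 * (Y₀ * Y₁) := by ring

/-- Coefficients of a form of signature `(2, 1)`, bounded by `K`. -/
structure CoeffBound (α : Fin 3 → ℤ) (K : ℝ) : Prop where
  pos0 : 0 < α 0
  pos1 : 0 < α 1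
  neg2 : α 2 < 0
  two_le : 2 ≤ K
  le0 : (α 0 : ℝ) ≤ K
  le1 : (α 1 : ℝ) ≤ K
  le2 : -(α 2 : ℝ) ≤ K

/-- In signature `(2, 1)` each positive term is at most the negative one; `2 ≤ K` absorbs the dyadic
factor 2. -/
theorem abs_coord_le {α s v : Fin 3 → ℤ} {K : ℝ} {q : Fin 3 → ℝ} (hK : CoeffBound α K)
    (hq : ∀ i, 0 < q i) (hs : ∀ i, q i ^ 2 ≤ s i ∧ (s i : ℝ) ≤ 2 * q i ^ 2)
    (hv : diagForm (α * s) v v = 0) :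
    |(v 0 : ℝ)| ≤ K * (q 2 / q 0) * |(v 2 : ℝ)| ∧ |(v 1 : ℝ)| ≤ K * (q 2 / q 1) * |(v 2 : ℝ)| := by
  have a0 : (1 : ℝ) ≤ α 0 := by exact_mod_cast hK.pos0
  have a1 : (1 : ℝ) ≤ α 1 := by exact_mod_cast hK.pos1
  have k2 := hK.two_le
  have q0 := hq 0
  have q1 := hq 1
  have q2 := hq 2
  have s0 : 0 < (s 0 : ℝ) := (pow_pos q0 2).trans_le (hs 0).1
  have s1 : 0 < (s 1 : ℝ) := (pow_pos q1 2).trans_le (hs 1).1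
  have s2 : 0 < (s 2 : ℝ) := (pow_pos q2 2).trans_le (hs 2).1
  have hv' : (α 0 * s 0 * v 0 ^ 2 + α 1 * s 1 * v 1 ^ 2 : ℝ) = -α 2 * s 2 * v 2 ^ 2 := by
    simp only [diagForm, Pi.mul_apply] at hv
    have : (α 0 * s 0 * v 0 * v 0 + α 1 * s 1 * v 1 * v 1 + α 2 * s 2 * v 2 * v 2 : ℝ) = 0 := by
      exact_mod_cast hv
    linarith
  have hr : (-α 2 * s 2 * v 2 ^ 2 : ℝ) ≤ K ^ 2 * q 2 ^ 2 * v 2 ^ 2 := by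
    have : (-α 2 * s 2 : ℝ) ≤ K * (2 * q 2 ^ 2) :=
      mul_le_mul hK.le2 (hs 2).2 s2.le (by linarith)
    have : (-α 2 * s 2 : ℝ) ≤ K ^ 2 * q 2 ^ 2 := by
      nlinarith [mul_le_mul_of_nonneg_right k2 (mul_nonneg (by linarith : (0 : ℝ) ≤ K) (sq_nonneg (q 2)))]
    gcongr
  have n0 : (0 : ℝ) ≤ α 0 * s 0 * v 0 ^ 2 := by positivity
  have n1 : (0 : ℝ) ≤ α 1 * s 1 * v 1 ^ 2 := by positivity
  have key : ∀ (x r : ℝ), 0 < r → r ^ 2 * x ^ 2 ≤ K ^ 2 * q 2 ^ 2 * v 2 ^ 2 →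
      |x| ≤ K * (q 2 / r) * |(v 2 : ℝ)| := by
    intro x r hr h
    apply (sq_le_sq₀ (abs_nonneg _) (by positivity)).1
    rw [mul_pow, mul_pow, div_pow, sq_abs, sq_abs, mul_div_assoc', div_mul_eq_mul_div,
      le_div_iff₀ (by positivity)]
    linarith
  refine ⟨key _ _ q0 ?_, key _ _ q1 ?_⟩
  · have : q 0 ^ 2 * v 0 ^ 2 ≤ α 0 * s 0 * (v 0 : ℝ) ^ 2 := by
      have := (hs 0).1
      have : q 0 ^ 2 ≤ α 0 * s 0 := by nlinarith
      gcongr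
    linarith
  · have : q 1 ^ 2 * v 1 ^ 2 ≤ α 1 * s 1 * (v 1 : ℝ) ^ 2 := by
      have := (hs 1).1
      have : q 1 ^ 2 ≤ α 1 * s 1 := by nlinarith
      gcongr
    linarith

theorem CoeffBound.mul_le {α : Fin 3 → ℤ} {K : ℝ} (hK : CoeffBound α K) :
    (α 0 * α 1 : ℝ) ≤ K ^ 2 := by
  have a1 : (0 : ℝ) < α 1 := by exact_mod_cast hK.pos1
  have := hK.two_le
  rw [sq]
  exact mul_le_mul hK.le0 hK.le1 a1.le (by linarith)

/-- Small points on conics with given divisibilities. -/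
theorem card_small_pairs_le {α g : Fin 3 → ℤ} {K : ℝ} {q : Fin 3 → ℝ} (hK : CoeffBound α K)
    (hg : ∀ i, 0 < g i) (hq : ∀ i, 0 < q i) (E : Finset ((Fin 3 → ℤ) × (Fin 3 → ℤ)))
    (hE : ∀ x ∈ E, Admissible α x.1 ∧ diagForm (α * x.1) x.2 x.2 = 0 ∧ IsPrimitive x.2 ∧
      (∀ i, g i ∣ x.1 i) ∧ (∀ i, q i ^ 2 ≤ x.1 i ∧ (x.1 i : ℝ) ≤ 2 * q i ^ 2) ∧
      (∀ i, x.2 i ≠ 0) ∧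
      (g 0 * g 1 * g 2) ^ 2 * x.2 2 ^ 2 ≤ 4 * (α 0 * α 1 * x.1 0 * x.1 1)) :
    (E.card : ℝ) ≤ 768 * K ^ 5 * (q 0 * q 1 * q 2) ^ 2 / (g 0 * g 1 * g 2 : ℝ) ^ 2 := by
  classical
  have q0 := hq 0
  have q1 := hq 1
  have q2 := hq 2
  have k2 := hK.two_le
  have h0' : (0 : ℝ) < α 0 := by exact_mod_cast hK.pos0
  have h1' : (0 : ℝ) < α 1 := by exact_mod_cast hK.pos1
  have hG1 : (1 : ℝ) ≤ (g 0 * g 1 * g 2 : ℝ) := by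
    have : 0 < g 0 * g 1 * g 2 := mul_pos (mul_pos (hg 0) (hg 1)) (hg 2)
    exact_mod_cast this
  set G : ℝ := (g 0 * g 1 * g 2 : ℝ) with hG
  set V := 4 * K * (q 0 * q 1) / G with hV
  have hVpos : 0 < V := by positivity
  have hv2 : ∀ x ∈ E, |(x.2 2 : ℝ)| ≤ V := by
    intro x hx
    obtain ⟨-, -, -, -, hs, -, hle⟩ := hE x hx
    have hle' : G ^ 2 * (x.2 2 : ℝ) ^ 2 ≤ 4 * (α 0 * α 1 * x.1 0 * x.1 1) := by
      rw [hG]; exact_mod_cast hle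
    have s0 : 0 < (x.1 0 : ℝ) := (pow_pos q0 2).trans_le (hs 0).1
    have s1 : 0 < (x.1 1 : ℝ) := (pow_pos q1 2).trans_le (hs 1).1
    apply (sq_le_sq₀ (abs_nonneg _) hVpos.le).1
    rw [hV, div_pow, le_div_iff₀ (by positivity), sq_abs]
    have : (α 0 * α 1 : ℝ) * (x.1 0 * x.1 1) ≤ K ^ 2 * ((2 * q 0 ^ 2) * (2 * q 1 ^ 2)) :=
      mul_le_mul hK.mul_le (mul_le_mul (hs 0).2 (hs 1).2 s1.le (by positivity)) (by positivity)
        (by positivity)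
    nlinarith
  set c := 8 * K ^ 2 * (q 0 ^ 2 * q 1 ^ 2) / G with hc
  have hcpos : 0 ≤ c := by positivity
  -- The slice `v₂ = n` contributes a multiple of `n² (1 + c / n²) = n² + c`, at most `V² + c`, and
  -- there are at most `2 V` slices.
  have hmain : (E.card : ℝ) ≤ (2 * V) * (4 * (K * (q 2 / q 0) * (K * (q 2 / q 1))) * (V ^ 2 + c)) := by
    apply card_le_mul_of_fiber_le E (fun x => x.2 2)
    · intro n hn
      obtain ⟨x, hx, rfl⟩ := Finset.mem_image.1 hn
      have hn0 := (hE x hx).2.2.2.2.2.1 2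
      have hnV := hv2 x hx
      generalize x.2 2 = n at hn0 hnV ⊢
      have hn0' : (n : ℝ) ≠ 0 := by exact_mod_cast hn0
      have := card_pairs_slice_le (α := α) (g := g) (n := n) (q := q)
        (Y₀ := K * (q 2 / q 0) * |(n : ℝ)|) (Y₁ := K * (q 2 / q 1) * |(n : ℝ)|)
        hK.pos0 hK.pos1 hK.neg2 hn0 hg hq (by positivity) (by positivity)
        (E.filter (fun x => x.2 2 = n)) (by
          intro y hy
          rw [Finset.mem_filter] at hy
          obtain ⟨b1, b2, b3, b4, b5, b6, -⟩ := hE y hy.1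
          have b7 := abs_coord_le hK hq b5 b2
          rw [hy.2] at b7
          exact ⟨b1, b2, b3, b4, b5, hy.2, b6 0, b6 1, b7.1, b7.2⟩)
      refine this.trans ?_
      rw [← hG]
      have e1 : 4 * (K * (q 2 / q 0) * |(n : ℝ)| * (K * (q 2 / q 1) * |(n : ℝ)|))
          * (1 + 8 * (α 0 * α 1) * (q 0 ^ 2 * q 1 ^ 2) / (G * n ^ 2))
          = 4 * (K * (q 2 / q 0) * (K * (q 2 / q 1))) *
            (|(n : ℝ)| ^ 2 + 8 * (α 0 * α 1) * (q 0 ^ 2 * q 1 ^ 2) / G) := by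
        rw [← sq_abs (n : ℝ)]
        have : |(n : ℝ)| ≠ 0 := abs_ne_zero.2 hn0'
        field_simp
      rw [e1, hc]
      have := hK.mul_le
      gcongr
    · positivity
    · apply card_int_le _ hVpos.le
      intro n hn
      obtain ⟨x, hx, rfl⟩ := Finset.mem_image.1 hn
      exact ⟨(hE x hx).2.2.2.2.2.1 2, hv2 x hx⟩
  refine hmain.trans ?_
  have e2 : (2 * V) * (4 * (K * (q 2 / q 0) * (K * (q 2 / q 1))) * (V ^ 2 + c))
      = K ^ 5 * (q 0 * q 1 * q 2) ^ 2 * (512 / G ^ 3 + 256 / G ^ 2) := by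
    rw [hV, hc]; field_simp; ring
  rw [e2]
  have e3 : 512 / G ^ 3 ≤ 512 / G ^ 2 := by
    apply div_le_div_of_nonneg_left (by norm_num) (by positivity)
    exact pow_le_pow_right₀ hG1 (by norm_num)
  have e4 : 512 / G ^ 3 + 256 / G ^ 2 ≤ 768 / G ^ 2 := by
    calc _ ≤ 512 / G ^ 2 + 256 / G ^ 2 := by gcongr
      _ = _ := by ring
  calc K ^ 5 * (q 0 * q 1 * q 2) ^ 2 * (512 / G ^ 3 + 256 / G ^ 2)
      ≤ K ^ 5 * (q 0 * q 1 * q 2) ^ 2 * (768 / G ^ 2) := by gcongr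
    _ = _ := by ring

/-- A pair `(s, z)` consisting of the coefficients of a conic and a positive point on it, with `s`
in a dyadic box of side lengths `qᵢ²` and `z₀`, `z₂` in dyadic intervals. -/
structure InBox (α : Fin 3 → ℤ) (q : Fin 3 → ℝ) (Z₀ Z₂ : ℝ) (s z : Fin 3 → ℤ) : Prop where
  adm : Admissible α s
  zero : diagForm (α * s) z z = 0
  prim : IsPrimitive z
  pos : ∀ i, 0 < z i
  mem : ∀ i, q i ^ 2 ≤ s i ∧ (s i : ℝ) ≤ 2 * q i ^ 2
  mem0 : Z₀ ≤ z 0 ∧ (z 0 : ℝ) ≤ 2 * Z₀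
  mem2 : Z₂ ≤ z 2 ∧ (z 2 : ℝ) ≤ 2 * Z₂

/-- The count that fixes `z` first: slices of constant `z₂`, without divisibility conditions on `s`.
The size of `z₁` need not be prescribed, as the conic bounds it by a multiple of `Z₂ q₂ / q₁`. -/
theorem card_box_le_of_points {α : Fin 3 → ℤ} {K : ℝ} {q : Fin 3 → ℝ} {Z₀ Z₂ : ℝ}
    (hK : CoeffBound α K) (hq : ∀ i, 0 < q i) (hZ₀ : 0 < Z₀) (hZ₂ : 0 < Z₂)
    (E : Finset ((Fin 3 → ℤ) × (Fin 3 → ℤ))) (hE : ∀ x ∈ E, InBox α q Z₀ Z₂ x.1 x.2) :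
    (E.card : ℝ) ≤ 512 * K ^ 3 *
      (Z₀ * Z₂ ^ 2 * (q 2 / q 1) + q 0 ^ 2 * q 1 * q 2 * Z₀) := by
  classical
  have q0 := hq 0
  have q1 := hq 1
  have q2 := hq 2
  have k2 := hK.two_le
  have h0' : (0 : ℝ) < α 0 := by exact_mod_cast hK.pos0
  have h1' : (0 : ℝ) < α 1 := by exact_mod_cast hK.pos1
  have hmain : (E.card : ℝ) ≤ (2 * (2 * Z₂)) * (4 * (2 * Z₀ * (K * (q 2 / q 1) * (2 * Z₂))) *
      (1 + 8 * K ^ 2 * (q 0 ^ 2 * q 1 ^ 2) / Z₂ ^ 2)) := by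
    apply card_le_mul_of_fiber_le E (fun x => x.2 2)
    · intro n hn
      obtain ⟨x, hx, rfl⟩ := Finset.mem_image.1 hn
      have hn0 := (hE x hx).pos 2
      have hnV := (hE x hx).mem2
      generalize x.2 2 = n at hn0 hnV ⊢
      have hn0' : (0 : ℝ) < n := by exact_mod_cast hn0
      have := card_pairs_slice_le (α := α) (g := fun _ => 1) (n := n) (q := q)
        (Y₀ := 2 * Z₀) (Y₁ := K * (q 2 / q 1) * (2 * Z₂))
        hK.pos0 hK.pos1 hK.neg2 hn0.ne' (by simp) hq (by positivity) (by positivity)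
        (E.filter (fun x => x.2 2 = n)) (by
          intro y hy
          rw [Finset.mem_filter] at hy
          have b := hE y hy.1
          have b7 := (abs_coord_le hK hq b.mem b.zero).2
          rw [hy.2, abs_of_pos hn0'] at b7
          refine ⟨b.adm, b.zero, b.prim, by simp, b.mem, hy.2, (b.pos 0).ne', (b.pos 1).ne', ?_,
            b7.trans ?_⟩
          · rw [abs_of_pos (by exact_mod_cast b.pos 0)]; exact b.mem0.2
          · exact mul_le_mul_of_nonneg_left hnV.2 (by positivity))
      refine this.trans ?_
      have e1 : 8 * (α 0 * α 1) * (q 0 ^ 2 * q 1 ^ 2) / (((1 : ℤ) * (1 : ℤ) * (1 : ℤ) : ℝ) * (n : ℝ) ^ 2)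
          ≤ 8 * K ^ 2 * (q 0 ^ 2 * q 1 ^ 2) / Z₂ ^ 2 := by
        have := hK.mul_le
        have := hnV.1
        simp only [Int.cast_one, one_mul]
        gcongr
      gcongr
    · positivity
    · apply card_int_le _ (by positivity)
      intro n hn
      obtain ⟨x, hx, rfl⟩ := Finset.mem_image.1 hn
      have h := (hE x hx).pos 2
      refine ⟨h.ne', ?_⟩
      rw [abs_of_pos (by exact_mod_cast h)]
      exact (hE x hx).mem2.2
  refine hmain.trans ?_
  have e2 : (2 * (2 * Z₂)) * (4 * (2 * Z₀ * (K * (q 2 / q 1) * (2 * Z₂))) *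
      (1 + 8 * K ^ 2 * (q 0 ^ 2 * q 1 ^ 2) / Z₂ ^ 2))
      = 64 * K * (Z₀ * Z₂ ^ 2 * (q 2 / q 1)) + 512 * K ^ 3 * (q 0 ^ 2 * q 1 * q 2 * Z₀) := by
    field_simp; ring
  rw [e2, mul_add]
  have : 64 * K ≤ 512 * K ^ 3 := by nlinarith [sq_nonneg K, pow_pos (by linarith : 0 < K) 3]
  gcongr

/-! ### Nondegenerate conics: counting through small zeros -/

/-- Dominated by the cube of `∑ |n| ^ (-3/2)`. This sums over the content factors `g`: with `G = g₀
g₁ g₂`, the saving `G⁻²` for pairs `(s, v)` outweighs the loss `√G` in the spacing of points. -/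
theorem exists_sum_rpow_bound : ∃ κ : ℝ, 0 < κ ∧ ∀ T : Finset (Fin 3 → ℤ), (∀ g ∈ T, ∀ i, 0 < g i) →
    ∑ g ∈ T, (1 / ((g 0 * g 1 * g 2) * √(g 0 * g 1 * g 2)) : ℝ) ≤ κ := by
  classical
  have hsum := Real.summable_abs_int_rpow (b := 3 / 2) (by norm_num)
  set f : ℤ → ℝ := fun n => |(n : ℝ)| ^ (-(3 / 2) : ℝ) with hf
  have hf0 : ∀ n, 0 ≤ f n := fun n => by simp only [hf]; positivity
  refine ⟨(∑' n, f n + 1) ^ 3, by have : 0 ≤ ∑' n, f n := tsum_nonneg hf0; positivity, fun T hT => ?_⟩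
  have hone : ∀ n : ℤ, 0 < n → f n = 1 / (n * √n) := by
    intro n hn
    have hn' : (0 : ℝ) < n := by exact_mod_cast hn
    simp only [hf]
    rw [abs_of_pos hn', Real.rpow_neg hn'.le, one_div, Real.sqrt_eq_rpow]
    congr 1
    nth_rewrite 2 [← Real.rpow_one (n : ℝ)]
    rw [← Real.rpow_add hn']
    norm_num
  have hterm : ∀ g ∈ T, (1 / ((g 0 * g 1 * g 2) * √(g 0 * g 1 * g 2)) : ℝ) = ∏ i, f (g i) := by
    intro g hg
    have h0 : (0 : ℝ) < g 0 := by exact_mod_cast hT g hg 0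
    have h1 : (0 : ℝ) < g 1 := by exact_mod_cast hT g hg 1
    rw [Fin.prod_univ_three, hone _ (hT g hg 0), hone _ (hT g hg 1), hone _ (hT g hg 2),
      Real.sqrt_mul (by positivity), Real.sqrt_mul h0.le]
    field_simp
  rw [Finset.sum_congr rfl hterm]
  set U : Finset ℤ := T.biUnion fun g => Finset.univ.image g with hU
  have hsub : T ⊆ Fintype.piFinset fun _ : Fin 3 => U := by
    intro g hg
    rw [Fintype.mem_piFinset]
    intro i
    exact Finset.mem_biUnion.2 ⟨g, hg, Finset.mem_image_of_mem _ (Finset.mem_univ i)⟩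
  calc ∑ g ∈ T, ∏ i, f (g i) ≤ ∑ g ∈ Fintype.piFinset fun _ : Fin 3 => U, ∏ i, f (g i) :=
        Finset.sum_le_sum_of_subset_of_nonneg hsub
          fun g _ _ => Finset.prod_nonneg fun i _ => hf0 _
    _ = ∏ _i : Fin 3, ∑ n ∈ U, f n := (Finset.prod_univ_sum _ _).symm
    _ = (∑ n ∈ U, f n) ^ 3 := by simp
    _ ≤ (∑' n, f n + 1) ^ 3 := by
        have h1 : ∑ n ∈ U, f n ≤ ∑' n, f n := hsum.sum_le_tsum _ fun n _ => hf0 n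
        have h2 : 0 ≤ ∑ n ∈ U, f n := Finset.sum_nonneg fun n _ => hf0 n
        gcongr
        linarith

theorem eq_one_of_isCoprime_zero {a : ℤ} (ha : 0 < a) (h : IsCoprime a 0) : a = 1 :=
  (Int.isUnit_iff.1 (isCoprime_zero_right.1 h)).resolve_right (by omega)

/-- If `vᵢ = 0`, the other two `sⱼ` are coprime to `0`, hence equal to 1. Nonzero coordinates are
what the count of small zeros needs. -/
theorem Admissible.coord_ne_zero {α s v : Fin 3 → ℤ} (hs : Admissible α s)
    (hv : diagForm (α * s) v v = 0) (hp : IsPrimitive v)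
    (hnd : ∀ i j, i ≠ j → ¬ (s i = 1 ∧ s j = 1)) (i : Fin 3) : v i ≠ 0 := by
  intro h0
  have key : ∀ j, j ≠ i → s j = 1 := fun j hj => by
    have := hs.isCoprime_coord hv hp hj
    rw [h0] at this
    exact eq_one_of_isCoprime_zero (hs.pos j) this
  exact hnd (i + 1) (i + 2) (by fin_cases i <;> decide)
    ⟨key _ (by fin_cases i <;> decide), key _ (by fin_cases i <;> decide)⟩

/-- Points of a box on one conic that are pairwise orthogonal modulo `m`. -/
theorem card_box_conic_le {α s : Fin 3 → ℤ} {K : ℝ} {q : Fin 3 → ℝ} {Z₀ Z₂ : ℝ}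
    (hK : CoeffBound α K) (hq : ∀ i, 0 < q i) (hZ₀ : 0 < Z₀) (hZ₂ : 0 < Z₂) {m : ℤ} {G : ℝ}
    (hG : 0 < G) (hm : 0 < m) (hmG : (q 0 * q 1 * q 2) ^ 2 ≤ m * G)
    (E : Finset ((Fin 3 → ℤ) × (Fin 3 → ℤ))) (hE : ∀ x ∈ E, InBox α q Z₀ Z₂ x.1 x.2)
    (hEs : ∀ x ∈ E, x.1 = s)
    (hd : ∀ x ∈ E, ∀ y ∈ E, m ∣ diagForm (α * s) x.2 y.2) :
    (E.card : ℝ) ≤ 1 + 8 * K * Z₀ * √G / (q 1 * q 2) := by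
  classical
  have q0 := hq 0
  have q1 := hq 1
  have q2 := hq 2
  have k2 := hK.two_le
  rcases E.eq_empty_or_nonempty with rfl | ⟨x₀, hx₀⟩
  · simp; positivity
  have hs : InBox α q Z₀ Z₂ s x₀.2 := by rw [← hEs x₀ hx₀]; exact hE x₀ hx₀
  have hinj : Set.InjOn Prod.snd (E : Set ((Fin 3 → ℤ) × (Fin 3 → ℤ))) := by
    intro y hy y' hy' hyy
    exact Prod.ext ((hEs y hy).trans (hEs y' hy').symm) hyy
  rw [← Finset.card_image_of_injOn hinj]
  refine (card_conic_points_le (α := α) (s := s) hs.adm.pos hK.pos0 hK.pos1 hK.neg2 hZ₀ hZ₂ hm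
    (E.image Prod.snd) ?_ ?_).trans ?_
  · intro z hz
    obtain ⟨y, hy, rfl⟩ := Finset.mem_image.1 hz
    have h := hE y hy
    rw [hEs y hy] at h
    exact ⟨h.pos, h.zero, h.prim, h.mem0.2, h.mem2.1, h.mem2.2⟩
  · intro z hz z' hz'
    obtain ⟨y, hy, rfl⟩ := Finset.mem_image.1 hz
    obtain ⟨y', hy', rfl⟩ := Finset.mem_image.1 hz'
    exact hd y hy y' hy'
  · have hm' : (0 : ℝ) < m := by exact_mod_cast hm
    have e1 : √(α 0 * s 0 : ℝ) ≤ K * q 0 := by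
      apply Real.sqrt_le_iff.2 ⟨by positivity, ?_⟩
      have s0 : (0 : ℝ) ≤ s 0 := by exact_mod_cast (hs.adm.pos 0).le
      have : (α 0 * s 0 : ℝ) ≤ K * (2 * q 0 ^ 2) :=
        mul_le_mul hK.le0 (hs.mem 0).2 s0 (by linarith)
      nlinarith [mul_le_mul_of_nonneg_right k2 (mul_nonneg (by linarith : (0 : ℝ) ≤ K) (sq_nonneg (q 0)))]
    have e2 : q 0 * q 1 * q 2 ≤ √m * √G := by
      rw [← Real.sqrt_mul hm'.le]
      exact Real.le_sqrt_of_sq_le hmG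
    have hsm := Real.sqrt_pos.2 hm'
    have hsG := Real.sqrt_pos.2 hG
    suffices h : 8 * √(α 0 * s 0 : ℝ) * Z₀ / √m ≤ 8 * K * Z₀ * √G / (q 1 * q 2) by linarith
    rw [div_le_div_iff₀ hsm (by positivity)]
    calc 8 * √(α 0 * s 0 : ℝ) * Z₀ * (q 1 * q 2) ≤ 8 * (K * q 0) * Z₀ * (q 1 * q 2) := by gcongr
      _ = 8 * K * Z₀ * (q 0 * q 1 * q 2) := by ring
      _ ≤ 8 * K * Z₀ * (√m * √G) := by gcongr
      _ = _ := by ring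

theorem minor_neg_swap (x y : Fin 3 → ℤ) (i : Fin 3) : minor y x i = -minor x y i := by
  simp only [minor]; ring

/-- The points of a box on nondegenerate conics, via `exists_small_primitive_zero`. -/
theorem exists_card_box_le_of_conics : ∃ κ : ℝ, 0 < κ ∧ ∀ {α : Fin 3 → ℤ} {K : ℝ} {q : Fin 3 → ℝ}
    {Z₀ Z₂ : ℝ}, CoeffBound α K → (∀ i, 0 < q i) → 0 < Z₀ → 0 < Z₂ →
    ∀ E : Finset ((Fin 3 → ℤ) × (Fin 3 → ℤ)), (∀ x ∈ E, InBox α q Z₀ Z₂ x.1 x.2) →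
    (∀ x ∈ E, ∀ i j, i ≠ j → ¬ (x.1 i = 1 ∧ x.1 j = 1)) →
    (E.card : ℝ) ≤ κ * K ^ 6 * ((q 0 * q 1 * q 2) ^ 2 + q 0 ^ 2 * q 1 * q 2 * Z₀) := by
  classical
  obtain ⟨κ, hκ, hκsum⟩ := exists_sum_rpow_bound
  refine ⟨6144 * κ, by positivity, ?_⟩
  intro α K q Z₀ Z₂ hK hq hZ₀ hZ₂ E hE hnd
  have q0 := hq 0
  have q1 := hq 1
  have q2 := hq 2
  have k2 := hK.two_le
  have hex : ∀ x : (Fin 3 → ℤ) × (Fin 3 → ℤ), ∃ w : (Fin 3 → ℤ) × (Fin 3 → ℤ), x ∈ E →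
      w.1 2 ≠ 0 ∧ IsPrimitive w.1 ∧ diagForm (α * x.1) w.1 w.1 = 0 ∧ (∀ i, 0 < w.2 i) ∧
      (∀ i, w.2 i ∣ x.1 i) ∧ (∀ i, x.1 i ∣ w.2 i * minor x.2 w.1 i) ∧
      (w.2 0 * w.2 1 * w.2 2) ^ 2 * w.1 2 ^ 2 ≤ 4 * (α 0 * α 1 * x.1 0 * x.1 1) := by
    intro x
    by_cases hx : x ∈ E
    · obtain ⟨v, g, h⟩ := exists_small_primitive_zero (hE x hx).adm (hE x hx).zero (hE x hx).prim
        hK.pos0 hK.pos1 (hE x hx).pos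
      exact ⟨(v, g), fun _ => h⟩
    · exact ⟨0, fun h => absurd h hx⟩
  choose w hw using hex
  set c : ℝ := 768 * K ^ 5 * ((q 0 * q 1 * q 2) ^ 2 * (8 * K) + 8 * K * (q 0 ^ 2 * q 1 * q 2 * Z₀))
    with hc
  have hstep : (E.card : ℝ) ≤ ∑ g ∈ E.image fun x => (w x).2,
      c * (1 / ((g 0 * g 1 * g 2) * √(g 0 * g 1 * g 2)) : ℝ) := by
    apply card_le_sum_of_fiber_le E (fun x => (w x).2)
    intro g hg
    obtain ⟨x₀, hx₀, rfl⟩ := Finset.mem_image.1 hg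
    have hgpos := (hw x₀ hx₀).2.2.2.1
    generalize (w x₀).2 = g at hgpos
    have hGint : 0 < g 0 * g 1 * g 2 := mul_pos (mul_pos (hgpos 0) (hgpos 1)) (hgpos 2)
    have hG1 : (1 : ℝ) ≤ (g 0 * g 1 * g 2 : ℝ) := by exact_mod_cast hGint
    set G : ℝ := (g 0 * g 1 * g 2 : ℝ) with hG
    have hsG1 : 1 ≤ √G := Real.one_le_sqrt.2 hG1
    have hsG2 : √G * √G = G := Real.mul_self_sqrt (by linarith)
    set F := E.filter fun x => (w x).2 = g with hF
    have hF' : ∀ x ∈ F, x ∈ E ∧ (w x).2 = g := fun x hx => Finset.mem_filter.1 hx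
    have hcard := card_le_mul_of_fiber_le F (fun x => (x.1, (w x).1))
      (c := 1 + 8 * K * Z₀ * √G / (q 1 * q 2))
      (N := 768 * K ^ 5 * (q 0 * q 1 * q 2) ^ 2 / G ^ 2) ?_ (by positivity) ?_
    · refine hcard.trans ?_
      have e1 : 768 * K ^ 5 * (q 0 * q 1 * q 2) ^ 2 / G ^ 2 * (1 + 8 * K * Z₀ * √G / (q 1 * q 2))
          ≤ 768 * K ^ 5 * (q 0 * q 1 * q 2) ^ 2 / G ^ 2
            * (8 * K * √G + 8 * K * Z₀ * √G / (q 1 * q 2)) := by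
        gcongr
        nlinarith
      refine e1.trans_eq ?_
      rw [hc]
      have : G ^ 2 = G * (√G * √G) := by rw [hsG2, sq]
      rw [this]
      field_simp
    · intro b hb
      obtain ⟨x₁, hx₁, rfl⟩ := Finset.mem_image.1 hb
      set s := x₁.1 with hs
      set v := (w x₁).1 with hv
      have hx₁E := (hF' x₁ hx₁).1
      have hw₁ := hw x₁ hx₁E
      rw [(hF' x₁ hx₁).2] at hw₁
      obtain ⟨hv2, hvp, hvz, -, hgs, -, -⟩ := hw₁
      have hadm := (hE x₁ hx₁E).adm
      -- With `σᵢ = sᵢ / gᵢ`, every point attached to `(s, v)` is proportional to `v` modulo `σᵢ`.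
      -- Two such points are therefore orthogonal modulo `σ₀ σ₁ σ₂ = s₀ s₁ s₂ / G`.
      choose σ hσ using hgs
      have hσpos : ∀ i, 0 < σ i := fun i =>
        pos_of_mul_pos_right (by rw [← hσ]; exact hadm.pos i) (hgpos i).le
      have hσs : ∀ i, σ i ∣ s i := fun i => by rw [hs, hσ]; exact dvd_mul_left _ _
      refine card_box_conic_le (s := s) hK hq hZ₀ hZ₂ (m := σ 0 * σ 1 * σ 2) (G := G)
        (by linarith) (mul_pos (mul_pos (hσpos 0) (hσpos 1)) (hσpos 2)) ?_ _ ?_ ?_ ?_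
      · have : ((σ 0 * σ 1 * σ 2 : ℤ) : ℝ) * G = s 0 * s 1 * s 2 := by
          rw [hs, hσ 0, hσ 1, hσ 2, hG]; push_cast; ring
        rw [this, mul_pow, mul_pow]
        have hmem := (hE x₁ hx₁E).mem
        have s0 : (0 : ℝ) ≤ s 0 := by exact_mod_cast (hadm.pos 0).le
        have s1 : (0 : ℝ) ≤ s 1 := by exact_mod_cast (hadm.pos 1).le
        exact mul_le_mul (mul_le_mul (hmem 0).1 (hmem 1).1 (by positivity) s0) (hmem 2).1
          (by positivity) (by positivity)
      · intro y hy
        exact hE y (hF' y (Finset.mem_filter.1 hy).1).1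
      · intro y hy
        exact (Prod.mk.inj (Finset.mem_filter.1 hy).2).1
      · have hmin : ∀ y ∈ F.filter (fun x => (x.1, (w x).1) = (s, v)), ∀ i, σ i ∣ minor v y.2 i := by
          intro y hy i
          rw [Finset.mem_filter] at hy
          have hyw := hw y (hF' y hy.1).1
          rw [(hF' y hy.1).2, (Prod.mk.inj hy.2).1, (Prod.mk.inj hy.2).2] at hyw
          have := hyw.2.2.2.2.2.1 i
          rw [hs, hσ i] at this
          rw [minor_neg_swap y.2 v]
          exact (dvd_neg).2 (Int.dvd_of_mul_dvd_mul_left (hgpos i).ne' this)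
        intro y hy y' hy'
        refine prod_dvd_of_coprime (fun i j hij => ((hadm.cop i j hij).of_isCoprime_of_dvd_left
          (hσs i)).of_isCoprime_of_dvd_right (hσs j)) fun i => ?_
        exact dvd_diagForm hvz ((hσs i).mul_left _)
          ((hadm.isCoprime_coord hvz hvp (by fin_cases i <;> decide)).of_isCoprime_of_dvd_left (hσs i))
          (hmin y hy i) (hmin y' hy' i)
    · apply card_small_pairs_le (α := α) hK hgpos hq
      intro p hp
      obtain ⟨x, hx, rfl⟩ := Finset.mem_image.1 hp
      have hxE := (hF' x hx).1
      have hwx := hw x hxE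
      rw [(hF' x hx).2] at hwx
      obtain ⟨-, hvp, hvz, -, hgs, -, hle⟩ := hwx
      have hadm := (hE x hxE).adm
      exact ⟨hadm, hvz, hvp, hgs, (hE x hxE).mem, hadm.coord_ne_zero hvz hvp (hnd x hxE), hle⟩
  refine hstep.trans ?_
  rw [← Finset.mul_sum]
  have hcpos : 0 ≤ c := by positivity
  refine (mul_le_mul_of_nonneg_left (hκsum _ ?_) hcpos).trans_eq ?_
  · intro g hg
    obtain ⟨x₀, hx₀, rfl⟩ := Finset.mem_image.1 hg
    exact (hw x₀ hx₀).2.2.2.1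
  · rw [hc]; ring

/-! ### Degenerate conics: divisor classes -/

/-- The zeros of a conic modulo a squarefree coefficient fall into classes according to the common
divisor with a minor formed with a fixed zero. -/
theorem dvd_diagForm_of_gcd_eq {α s r x y : Fin 3 → ℤ} (hs : Admissible α s)
    (hr : diagForm (α * s) r r = 0) (hp : IsPrimitive r) (hx : diagForm (α * s) x x = 0)
    (hy : diagForm (α * s) y y = 0) {i : Fin 3}
    (hxy : Int.gcd (s i) (minor r x i) = Int.gcd (s i) (minor r y i)) :
    s i ∣ diagForm (α * s) x y := by
  set k := α * s with hk
  have n1 : i ≠ i + 1 := by fin_cases i <;> decide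
  have n2 : i + 2 ≠ i + 1 := by fin_cases i <;> decide
  have n3 : i ≠ i + 2 := by fin_cases i <;> decide
  -- Modulo `sᵢ` the form loses its `i`-th term, and what is left factors, up to a unit, into the
  -- linear forms `minor r · i` and `minor r' · i`. A zero has one part `g` of `sᵢ` dividing the
  -- first value and the complementary part `h` dividing the second.
  set r' : Fin 3 → ℤ := Function.update r (i + 1) (-r (i + 1)) with hr'
  have u0 : r' i = r i := Function.update_of_ne n1 _ _
  have u1 : r' (i + 1) = -r (i + 1) := Function.update_self _ _ _
  have u2 : r' (i + 2) = r (i + 2) := Function.update_of_ne n2 _ _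
  have hr'z : diagForm k r' r' = 0 := by
    rw [diagForm_rotate _ _ _ i] at hr ⊢
    rw [u0, u1, u2]; linarith
  have hsi := hs.pos i
  have hcop : IsCoprime (s i) (r (i + 2)) := hs.isCoprime_coord hr hp n3
  have hki : s i ∣ k i := ⟨α i, by simp [hk, mul_comm]⟩
  have hck : IsCoprime (s i) (k (i + 1)) := by
    simp only [hk, Pi.mul_apply]; exact (hs.copα i _).mul_right (hs.cop i _ n1)
  set g : ℤ := ((Int.gcd (s i) (minor r x i) : ℕ) : ℤ) with hg
  have hg0 : g ≠ 0 := by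
    have := Int.gcd_pos_of_ne_zero_left (minor r x i) hsi.ne'
    simp only [hg]; exact_mod_cast this.ne'
  have hgs : g ∣ s i := Int.gcd_dvd_left _ _
  have hgx : g ∣ minor r x i := Int.gcd_dvd_right _ _
  have hgy : g ∣ minor r y i := by rw [hg, hxy]; exact Int.gcd_dvd_right _ _
  obtain ⟨h, hh⟩ := hgs
  have key : ∀ t : Fin 3 → ℤ, diagForm k t t = 0 → (Int.gcd (s i) (minor r t i) : ℤ) = g →
      h ∣ minor r' t i := by
    intro t ht hgt
    obtain ⟨c, hc⟩ : g ∣ minor r t i := hgt ▸ Int.gcd_dvd_right _ _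
    have hhc : IsCoprime h c := by
      rw [Int.isCoprime_iff_gcd_eq_one]
      rw [hh, hc, Int.gcd_mul_left] at hgt
      push_cast at hgt
      have hgpos : 0 < g := lt_of_le_of_ne (by positivity) hg0.symm
      rw [abs_of_pos hgpos] at hgt
      exact_mod_cast mul_left_cancel₀ hg0 (hgt.trans (mul_one g).symm)
    have hprod : s i ∣ k (i + 1) * (minor r t i * minor r' t i) := by
      obtain ⟨a, ha⟩ := hki
      refine ⟨a * (r i ^ 2 * t (i + 2) ^ 2 - t i ^ 2 * r (i + 2) ^ 2), ?_⟩
      rw [diagForm_rotate _ _ _ i] at hr ht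
      simp only [minor]
      rw [u1, u2]
      linear_combination r (i + 2) ^ 2 * ht - t (i + 2) ^ 2 * hr
        + (r i ^ 2 * t (i + 2) ^ 2 - t i ^ 2 * r (i + 2) ^ 2) * ha
    have := hck.dvd_of_dvd_mul_left hprod
    rw [hh, hc, mul_assoc] at this
    exact hhc.dvd_of_dvd_mul_left (Int.dvd_of_mul_dvd_mul_left hg0 this)
  have hhs : h ∣ s i := ⟨g, by rw [hh, mul_comm]⟩
  have hgs : g ∣ s i := ⟨h, hh⟩
  have d1 : g ∣ diagForm k x y :=
    dvd_diagForm hr (hgs.trans hki) (hcop.of_isCoprime_of_dvd_left hgs) hgx hgy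
  have d2 : h ∣ diagForm k x y :=
    dvd_diagForm hr'z (hhs.trans hki) (by rw [u2]; exact hcop.of_isCoprime_of_dvd_left hhs)
      (key x hx rfl) (key y hy (by rw [hg, hxy]))
  have hgh : IsCoprime g h := by
    have := hs.sqf i
    rw [hh, squarefree_mul_iff] at this
    exact isRelPrime_iff_isCoprime.1 this.1
  rw [hh]
  exact hgh.mul_dvd d1 d2

/-- Each divisor `g` has at most `N / g` multiples up to `N`, and the harmonic sum gives the
logarithm. -/
theorem card_divisor_pairs_le (T : Finset (ℕ × ℕ)) {N : ℕ}
    (h : ∀ p ∈ T, 0 < p.1 ∧ p.1 ≤ N ∧ p.2 ∣ p.1) : (T.card : ℝ) ≤ N * (1 + Real.log N) := by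
  classical
  have h1 : (T.card : ℝ) ≤ ∑ g ∈ T.image Prod.snd, (N : ℝ) * (g : ℝ)⁻¹ := by
    apply card_le_sum_of_fiber_le T Prod.snd
    intro g hg
    have hle : (T.filter (·.2 = g)).card ≤ ((Finset.Ioc 0 N).filter (g ∣ ·)).card := by
      apply Finset.card_le_card_of_injOn Prod.fst
      · intro p hp
        rw [Finset.mem_coe, Finset.mem_filter] at hp
        rw [Finset.mem_coe, Finset.mem_filter, Finset.mem_Ioc, ← hp.2]
        have := h p hp.1
        exact ⟨⟨this.1, this.2.1⟩, this.2.2⟩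
      · intro p hp p' hp' hpp
        rw [Finset.mem_coe, Finset.mem_filter] at hp hp'
        exact Prod.ext hpp (hp.2.trans hp'.2.symm)
    rw [Nat.Ioc_filter_dvd_card_eq_div] at hle
    calc ((T.filter (·.2 = g)).card : ℝ) ≤ (N / g : ℕ) := by exact_mod_cast hle
      _ ≤ (N : ℝ) / g := Nat.cast_div_le
      _ = _ := div_eq_mul_inv _ _
  refine h1.trans ?_
  rw [← Finset.mul_sum]
  have h2 : ∑ g ∈ T.image Prod.snd, (g : ℝ)⁻¹ ≤ ∑ g ∈ Finset.Icc 1 N, (g : ℝ)⁻¹ := by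
    apply Finset.sum_le_sum_of_subset_of_nonneg
    · intro g hg
      obtain ⟨p, hp, rfl⟩ := Finset.mem_image.1 hg
      obtain ⟨a, b, c⟩ := h p hp
      exact Finset.mem_Icc.2 ⟨Nat.pos_of_dvd_of_pos c a, (Nat.le_of_dvd a c).trans b⟩
    · intros; positivity
  have h3 := harmonic_le_one_add_log N
  rw [harmonic_eq_sum_Icc] at h3
  push_cast at h3
  gcongr
  exact h2.trans h3

/-- The points of a box on the conics all but one of whose coefficients are trivial. -/
theorem card_box_le_of_degenerate {α : Fin 3 → ℤ} {K : ℝ} {q : Fin 3 → ℝ} {Z₀ Z₂ : ℝ}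
    (hK : CoeffBound α K) (hq : ∀ i, 0 < q i) (hZ₀ : 0 < Z₀) (hZ₂ : 0 < Z₂) (k : Fin 3)
    (E : Finset ((Fin 3 → ℤ) × (Fin 3 → ℤ))) (hE : ∀ x ∈ E, InBox α q Z₀ Z₂ x.1 x.2)
    (hdeg : ∀ x ∈ E, ∀ i, i ≠ k → x.1 i = 1) {N : ℕ} (hN : 2 * q k ^ 2 ≤ N) :
    (E.card : ℝ) ≤ N * (1 + Real.log N) * (1 + 8 * K * Z₀ / (q 1 * q 2)) := by
  classical
  have q1 := hq 1
  have q2 := hq 2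
  have k2 := hK.two_le
  -- A reference point on each conic, depending only on `s`. A class is then labelled by `s k` and
  -- one of its divisors, and inside a class points are orthogonal modulo the full product `s₀ s₁
  -- s₂`.
  set r : (Fin 3 → ℤ) → (Fin 3 → ℤ) := fun s => Classical.epsilon fun z => (s, z) ∈ E with hr
  have hrE : ∀ x ∈ E, (x.1, r x.1) ∈ E := fun x hx =>
    Classical.epsilon_spec (p := fun z => (x.1, z) ∈ E) ⟨x.2, hx⟩
  set f : (Fin 3 → ℤ) × (Fin 3 → ℤ) → ℕ × ℕ :=
    fun x => ((x.1 k).toNat, Int.gcd (x.1 k) (minor (r x.1) x.2 k)) with hf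
  apply card_le_mul_of_fiber_le E f
  · intro b hb
    obtain ⟨x₀, hx₀, rfl⟩ := Finset.mem_image.1 hb
    have hx₀' := hE x₀ hx₀
    have hsame : ∀ x ∈ E.filter (fun x => f x = f x₀), x.1 = x₀.1 := by
      intro x hx
      rw [Finset.mem_filter] at hx
      have h1 := (Prod.mk.inj hx.2).1
      have p1 := (hE x hx.1).adm.pos k
      have p2 := hx₀'.adm.pos k
      funext i
      by_cases hi : i = k
      · rw [hi]; omega
      · rw [hdeg x hx.1 i hi, hdeg x₀ hx₀ i hi]
    have := card_box_conic_le (s := x₀.1) hK hq hZ₀ hZ₂ (m := x₀.1 0 * x₀.1 1 * x₀.1 2) (G := 1)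
      one_pos (mul_pos (mul_pos (hx₀'.adm.pos 0) (hx₀'.adm.pos 1)) (hx₀'.adm.pos 2)) ?_
      (E.filter fun x => f x = f x₀) (fun x hx => hE x (Finset.mem_filter.1 hx).1) hsame ?_
    · simpa using this
    · have s0 : (0 : ℝ) ≤ x₀.1 0 := by exact_mod_cast (hx₀'.adm.pos 0).le
      have s1 : (0 : ℝ) ≤ x₀.1 1 := by exact_mod_cast (hx₀'.adm.pos 1).le
      have hmem := hx₀'.mem
      push_cast
      rw [mul_one, mul_pow, mul_pow]
      exact mul_le_mul (mul_le_mul (hmem 0).1 (hmem 1).1 (by positivity) s0) (hmem 2).1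
        (by positivity) (by positivity)
    · intro x hx y hy
      refine prod_dvd_of_coprime hx₀'.adm.cop fun i => ?_
      by_cases hi : i = k
      · rw [hi]
        have hxs := hsame x hx
        have hys := hsame y hy
        rw [Finset.mem_filter] at hx hy
        have e1 := (Prod.mk.inj hx.2).2
        have e2 := (Prod.mk.inj hy.2).2
        have zx := (hE x hx.1).zero
        have zy := (hE y hy.1).zero
        rw [hxs] at e1 zx
        rw [hys] at e2 zy
        have hrz := hE _ (hrE x₀ hx₀)
        exact dvd_diagForm_of_gcd_eq hx₀'.adm hrz.zero hrz.prim zx zy (e1.trans e2.symm)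
      · rw [hdeg x₀ hx₀ i hi]; exact one_dvd _
  · positivity
  · apply card_divisor_pairs_le
    intro p hp
    obtain ⟨x, hx, rfl⟩ := Finset.mem_image.1 hp
    have hpos := (hE x hx).adm.pos k
    refine ⟨by simp only [hf]; omega, ?_, ?_⟩
    · have h1 : (x.1 k : ℝ) ≤ N := ((hE x hx).mem k).2.trans hN
      have h2 : x.1 k ≤ N := by exact_mod_cast h1
      simp only [hf]; omega
    · have h1 : (Int.gcd (x.1 k) (minor (r x.1) x.2 k) : ℤ) ∣ x.1 k := Int.gcd_dvd_left _ _
      have h2 : ((x.1 k).toNat : ℤ) = x.1 k := Int.toNat_of_nonneg hpos.le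
      rw [← h2] at h1
      simp only [hf]
      rw [← Int.natCast_dvd_natCast]
      rw [h2] at h1 ⊢
      exact h1

/-! ### Dyadic boxes: comparing the two counts -/

/-- The ratio of the scale on which the exponents of dyadic boxes are measured. -/
noncomputable def sixthRoot : ℝ := (2 : ℝ) ^ (1 / 6 : ℝ)

theorem sixthRoot_pow : sixthRoot ^ 6 = 2 := by
  rw [sixthRoot, ← Real.rpow_natCast, ← Real.rpow_mul (by norm_num)]; norm_num

theorem one_lt_sixthRoot : 1 < sixthRoot := Real.one_lt_rpow (by norm_num) (by norm_num)

theorem sixthRoot_pos : 0 < sixthRoot := one_pos.trans one_lt_sixthRoot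

theorem sixthRoot_ne_zero : sixthRoot ≠ 0 := sixthRoot_pos.ne'

theorem sixthRoot_pow_mul (n : ℕ) : sixthRoot ^ (6 * n) = 2 ^ n := by
  rw [pow_mul, sixthRoot_pow]

/-- Square roots of the dyadic side lengths `2 ^ aᵢ`. -/
noncomputable def boxSide (a : Fin 3 → ℕ) (i : Fin 3) : ℝ := sixthRoot ^ (3 * a i)

theorem boxSide_pos (a : Fin 3 → ℕ) (i : Fin 3) : 0 < boxSide a i := pow_pos sixthRoot_pos _

theorem boxSide_sq (a : Fin 3 → ℕ) (i : Fin 3) : boxSide a i ^ 2 = 2 ^ a i := by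
  rw [boxSide, ← pow_mul, ← sixthRoot_pow_mul]; congr 1; ring

/-- The cube root of the size of `(s₀ s₁ s₂)² z₀ z₁ z₂` in a dyadic box. -/
noncomputable def boxSize (a : Fin 3 → ℕ) (b c : ℕ) : ℝ :=
  sixthRoot ^ (4 * a 0 + 3 * a 1 + 5 * a 2 + 2 * b + 4 * c)

theorem boxSize_pos (a : Fin 3 → ℕ) (b c : ℕ) : 0 < boxSize a b c := pow_pos sixthRoot_pos _

/-- Three times this is the exponent, to base `sixthRoot`, of the ratio of `z₀ z₁ z₂` to `s₀ s₁ s₂`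
in the box, with `z₁` of size `2 ^ c * (boxSide a 2 / boxSide a 1)`. -/
def boxBalance (a : Fin 3 → ℕ) (b c : ℕ) : ℤ := 2 * b + 4 * c - 2 * a 0 - 3 * a 1 - a 2

/-- The exponent, to base 2, of the ratio of `s₀ z₀²` to `s₂ z₂²` in the box. -/
def boxSkew (a : Fin 3 → ℕ) (b c : ℕ) : ℤ := a 0 + 2 * b - a 2 - 2 * c

/-- The multiplicity with which the boxes containing degenerate conics are counted. -/
def boxWeight (a : Fin 3 → ℕ) : ℝ :=
  1 + ∑ k, if ∀ i, i ≠ k → a i = 0 then (a k + 1 : ℝ) else 0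

theorem one_le_boxWeight (a : Fin 3 → ℕ) : 1 ≤ boxWeight a := by
  have : 0 ≤ ∑ k, if ∀ i, i ≠ k → a i = 0 then (a k + 1 : ℝ) else 0 :=
    Finset.sum_nonneg fun k _ => by split_ifs <;> positivity
  rw [boxWeight]; linarith

theorem le_boxWeight {a : Fin 3 → ℕ} {k : Fin 3} (h : ∀ i, i ≠ k → a i = 0) :
    (a k + 1 : ℝ) ≤ boxWeight a := by
  have : (if ∀ i, i ≠ k → a i = 0 then (a k + 1 : ℝ) else 0)
      ≤ ∑ k, if ∀ i, i ≠ k → a i = 0 then (a k + 1 : ℝ) else 0 :=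
    Finset.single_le_sum (f := fun k => if ∀ i, i ≠ k → a i = 0 then (a k + 1 : ℝ) else 0)
      (fun k _ => by split_ifs <;> positivity) (Finset.mem_univ k)
  rw [if_pos h] at this
  rw [boxWeight]; linarith

/-- Relative to `boxSize`, the main term of the count by points grows with the balance, while that
of the count by conics (`conics_term_eq`) decays with it. The smaller of the two thus decays on both
sides of zero. The other term, common to both counts, depends on the skew only. -/
theorem points_term_eq (a : Fin 3 → ℕ) (b c : ℕ) :
    (2 : ℝ) ^ b * (2 ^ c) ^ 2 * (boxSide a 2 / boxSide a 1)
      = boxSize a b c * sixthRoot ^ (2 * boxBalance a b c) := by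
  have h := sixthRoot_ne_zero
  simp only [boxSize, boxBalance, boxSide, ← sixthRoot_pow_mul, ← pow_mul]
  simp only [← zpow_natCast, ← zpow_sub₀ h, ← zpow_add₀ h]
  congr 1; push_cast; ring

theorem skew_term_eq (a : Fin 3 → ℕ) (b c : ℕ) :
    boxSide a 0 ^ 2 * boxSide a 1 * boxSide a 2 * 2 ^ b
      = boxSize a b c * sixthRoot ^ (2 * boxSkew a b c) := by
  have h := sixthRoot_ne_zero
  simp only [boxSize, boxSkew, boxSide, ← sixthRoot_pow_mul, ← pow_mul]
  simp only [← zpow_natCast, ← zpow_add₀ h]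
  congr 1; push_cast; ring

theorem conics_term_eq (a : Fin 3 → ℕ) (b c : ℕ) :
    (boxSide a 0 * boxSide a 1 * boxSide a 2) ^ 2
      = boxSize a b c * sixthRoot ^ (-boxBalance a b c) := by
  have h := sixthRoot_ne_zero
  simp only [boxSize, boxBalance, boxSide, mul_pow, ← pow_mul]
  simp only [← zpow_natCast, ← zpow_add₀ h]
  congr 1; push_cast; ring

theorem boxSize_cube (a : Fin 3 → ℕ) (b c : ℕ) :
    boxSize a b c ^ 3 = (boxSide a 0 * boxSide a 1 * boxSide a 2) ^ 4 * 2 ^ b * (2 ^ c) ^ 2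
      * (boxSide a 2 / boxSide a 1) := by
  have h := sixthRoot_ne_zero
  simp only [boxSize, boxSide, mul_pow, ← sixthRoot_pow_mul, ← pow_mul]
  simp only [← zpow_natCast, ← zpow_add₀ h, ← zpow_sub₀ h]
  congr 1; push_cast; ring

/-- On a nonempty box the skew is bounded above, because `α₀ s₀ z₀² ≤ -α₂ s₂ z₂²` on the conic. So
growth for positive skew can be traded for decay at the cost of a constant. -/
theorem skew_bound {α : Fin 3 → ℤ} {K : ℝ} (hK : CoeffBound α K) {a : Fin 3 → ℕ} {b c : ℕ}
    {s z : Fin 3 → ℤ} (h : InBox α (boxSide a) (2 ^ b) (2 ^ c) s z) :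
    sixthRoot ^ (2 * boxSkew a b c) ≤ 8 * K * sixthRoot ^ (-|boxSkew a b c|) := by
  have k2 := hK.two_le
  have hθ := one_lt_sixthRoot
  rcases le_total (boxSkew a b c) 0 with h0 | h0
  · rw [abs_of_nonpos h0, neg_neg]
    have h1 : sixthRoot ^ (2 * boxSkew a b c) ≤ sixthRoot ^ (boxSkew a b c) :=
      zpow_le_zpow_right₀ hθ.le (by linarith)
    have h2 : 0 < sixthRoot ^ (boxSkew a b c) := zpow_pos sixthRoot_pos _
    nlinarith
  · rw [abs_of_nonneg h0]
    have key : sixthRoot ^ (6 * boxSkew a b c) ≤ 8 * K := by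
      have e : sixthRoot ^ (6 * boxSkew a b c) * (2 ^ a 2 * (2 ^ c) ^ 2) = 2 ^ a 0 * (2 ^ b) ^ 2 := by
        have h := sixthRoot_ne_zero
        simp only [boxSkew, ← sixthRoot_pow_mul, ← pow_mul]
        simp only [← zpow_natCast, ← zpow_add₀ h]
        congr 1; push_cast; ring
      have hz0 : (0 : ℝ) < 2 ^ b := by positivity
      have hz2 : (0 : ℝ) < 2 ^ c := by positivity
      have hz := h.zero
      simp only [diagForm, Pi.mul_apply] at hz
      have hz' : (α 0 * s 0 * z 0 * z 0 + α 1 * s 1 * z 1 * z 1 + α 2 * s 2 * z 2 * z 2 : ℝ) = 0 := by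
        exact_mod_cast hz
      have a0 : (1 : ℝ) ≤ α 0 := by exact_mod_cast hK.pos0
      have a1 : (1 : ℝ) ≤ α 1 := by exact_mod_cast hK.pos1
      have s1 : (0 : ℝ) < s 1 := by exact_mod_cast h.adm.pos 1
      have s2 : (0 : ℝ) < s 2 := by exact_mod_cast h.adm.pos 2
      have zz2 : (0 : ℝ) < z 2 := by exact_mod_cast h.pos 2
      have n1 : (0 : ℝ) ≤ α 1 * s 1 * z 1 * z 1 := by
        rw [mul_assoc]; exact mul_nonneg (by positivity) (mul_self_nonneg _)
      have m0 := h.mem 0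
      have m2 := h.mem 2
      rw [boxSide_sq] at m0 m2
      have l1 : (2 ^ a 0 * (2 ^ b) ^ 2 : ℝ) ≤ α 0 * s 0 * z 0 ^ 2 := by
        have : (2 ^ a 0 : ℝ) ≤ α 0 * s 0 := by nlinarith [m0.1]
        have := h.mem0.1
        have : (0 : ℝ) ≤ α 0 * s 0 := (by positivity : (0 : ℝ) ≤ 2 ^ a 0).trans ‹_›
        gcongr
      have l2 : (-α 2 * s 2 * z 2 ^ 2 : ℝ) ≤ K * (2 * 2 ^ a 2) * (2 * 2 ^ c) ^ 2 := by
        have u1 := hK.le2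
        have u2 := m2.2
        have u3 := h.mem2.2
        gcongr
      have l3 : sixthRoot ^ (6 * boxSkew a b c) * (2 ^ a 2 * (2 ^ c) ^ 2)
          ≤ 8 * K * (2 ^ a 2 * (2 ^ c) ^ 2) := by
        rw [e]; nlinarith
      exact le_of_mul_le_mul_right l3 (by positivity)
    calc sixthRoot ^ (2 * boxSkew a b c)
        = sixthRoot ^ (3 * boxSkew a b c) * sixthRoot ^ (-boxSkew a b c) := by
          rw [← zpow_add₀ sixthRoot_ne_zero]; congr 1; ring
      _ ≤ sixthRoot ^ (6 * boxSkew a b c) * sixthRoot ^ (-boxSkew a b c) := by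
          have : 0 < sixthRoot ^ (-boxSkew a b c) := zpow_pos sixthRoot_pos _
          gcongr 1
          exact zpow_le_zpow_right₀ hθ.le (by linarith)
      _ ≤ _ := by
          have : 0 < sixthRoot ^ (-boxSkew a b c) := zpow_pos sixthRoot_pos _
          gcongr

/-- A nonempty family forces `a i = 0` for `i ≠ k`. The logarithm from the divisor sum is then at
most `2 (a k + 1)`, which `boxWeight` absorbs. -/
theorem card_degenerate_dyadic_le {α : Fin 3 → ℤ} {K : ℝ} (hK : CoeffBound α K) (a : Fin 3 → ℕ)
    (b c : ℕ) (k : Fin 3) (E : Finset ((Fin 3 → ℤ) × (Fin 3 → ℤ)))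
    (hE : ∀ x ∈ E, InBox α (boxSide a) (2 ^ b) (2 ^ c) x.1 x.2)
    (hdeg : ∀ x ∈ E, ∀ i, i ≠ k → x.1 i = 1) :
    (E.card : ℝ) ≤ 32 * K * boxWeight a * ((boxSide a 0 * boxSide a 1 * boxSide a 2) ^ 2
      + boxSide a 0 ^ 2 * boxSide a 1 * boxSide a 2 * 2 ^ b) := by
  have k2 := hK.two_le
  have hw := one_le_boxWeight a
  have q0 := boxSide_pos a 0
  have q1 := boxSide_pos a 1
  have q2 := boxSide_pos a 2
  rcases E.eq_empty_or_nonempty with rfl | ⟨x₀, hx₀⟩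
  · simp; positivity
  have ha : ∀ i, i ≠ k → a i = 0 := fun i hi => by
    have h1 := ((hE x₀ hx₀).mem i).1
    rw [hdeg x₀ hx₀ i hi, boxSide_sq] at h1
    by_contra h
    have : (1 : ℝ) < 2 ^ a i := one_lt_pow₀ (by norm_num) h
    push_cast at h1
    linarith
  have hside : ∀ i, i ≠ k → boxSide a i = 1 := fun i hi => by simp [boxSide, ha i hi]
  have hprod : (boxSide a 0 * boxSide a 1 * boxSide a 2) ^ 2 = boxSide a k ^ 2 := by
    have : ∏ i, boxSide a i = boxSide a k :=
      Finset.prod_eq_single k (fun i _ hi => hside i hi) (by simp)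
    rw [Fin.prod_univ_three] at this
    rw [this]
  have hmain := card_box_le_of_degenerate hK (boxSide_pos a) (Z₀ := 2 ^ b) (Z₂ := 2 ^ c)
    (by positivity) (by positivity) k E hE hdeg (N := 2 ^ (a k + 1))
    (by rw [boxSide_sq]; push_cast; rw [pow_succ']; )
  refine hmain.trans ?_
  have hlog : 1 + Real.log ((2 ^ (a k + 1) : ℕ) : ℝ) ≤ 2 * (a k + 1) := by
    push_cast
    rw [Real.log_pow]
    have := Real.log_two_lt_d9
    have h2 : (0 : ℝ) ≤ a k := by positivity
    push_cast
    nlinarith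
  have hN : ((2 ^ (a k + 1) : ℕ) : ℝ) = 2 * (boxSide a 0 * boxSide a 1 * boxSide a 2) ^ 2 := by
    rw [hprod, boxSide_sq]; push_cast; rw [pow_succ']
  have hlog0 : 0 ≤ 1 + Real.log ((2 ^ (a k + 1) : ℕ) : ℝ) :=
    add_nonneg zero_le_one (Real.log_natCast_nonneg _)
  calc ((2 ^ (a k + 1) : ℕ) : ℝ) * (1 + Real.log ((2 ^ (a k + 1) : ℕ) : ℝ))
        * (1 + 8 * K * 2 ^ b / (boxSide a 1 * boxSide a 2))
      ≤ ((2 ^ (a k + 1) : ℕ) : ℝ) * (2 * boxWeight a)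
        * (8 * K + 8 * K * 2 ^ b / (boxSide a 1 * boxSide a 2)) := by
        have := le_boxWeight ha
        gcongr
        · linarith
        · linarith
    _ = _ := by
        rw [hN]; field_simp; ring

/-- The number of points in a dyadic box, relative to the size of the box. -/
theorem exists_card_dyadic_le {α : Fin 3 → ℤ} {K : ℝ} (hK : CoeffBound α K) :
    ∃ C : ℝ, 0 < C ∧ ∀ (a : Fin 3 → ℕ) (b c : ℕ) (E : Finset ((Fin 3 → ℤ) × (Fin 3 → ℤ))),
    (∀ x ∈ E, InBox α (boxSide a) (2 ^ b) (2 ^ c) x.1 x.2) →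
    (E.card : ℝ) ≤ C * boxSize a b c * (boxWeight a *
      (sixthRoot ^ (-|boxBalance a b c|) + sixthRoot ^ (-|boxSkew a b c|))) := by
  classical
  obtain ⟨κ, hκ, hκE⟩ := exists_card_box_le_of_conics
  have k2 := hK.two_le
  set C₁ := 512 * K ^ 3 + κ * K ^ 6 + 96 * K with hC₁
  have hC₁pos : 0 < C₁ := by positivity
  refine ⟨C₁ * (8 * K), by positivity, ?_⟩
  intro a b c E hE
  have hw := one_le_boxWeight a
  have hD := boxSize_pos a b c
  rcases E.eq_empty_or_nonempty with rfl | ⟨x₀, hx₀⟩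
  · have := zpow_pos sixthRoot_pos (-|boxBalance a b c|)
    have := zpow_pos sixthRoot_pos (-|boxSkew a b c|)
    rw [Finset.card_empty, Nat.cast_zero]
    exact mul_nonneg (mul_nonneg (by positivity) hD.le)
      (mul_nonneg (by linarith) (by positivity))
  have hskew := skew_bound hK (hE x₀ hx₀)
  have hpos1 := zpow_pos sixthRoot_pos (-|boxBalance a b c|)
  have hpos2 := zpow_pos sixthRoot_pos (2 * boxSkew a b c)
  have hpos3 := zpow_pos sixthRoot_pos (-|boxSkew a b c|)
  have hq := boxSide_pos a
  have hZ : ∀ n : ℕ, (0 : ℝ) < 2 ^ n := fun n => by positivity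
  have suff : (E.card : ℝ) ≤ C₁ * boxWeight a * (boxSize a b c * sixthRoot ^ (-|boxBalance a b c|)
      + boxSize a b c * sixthRoot ^ (2 * boxSkew a b c)) := by
    -- Negative balance means small points, counted by points; otherwise the count goes by conics,
    -- split into the nondegenerate ones and three degenerate families.
    rcases le_total (boxBalance a b c) 0 with h0 | h0
    · have h1 := card_box_le_of_points hK hq (hZ b) (hZ c) E hE
      rw [points_term_eq, skew_term_eq a b c] at h1
      have h2 : sixthRoot ^ (2 * boxBalance a b c) ≤ sixthRoot ^ (-|boxBalance a b c|) :=
        zpow_le_zpow_right₀ one_lt_sixthRoot.le (by rw [abs_of_nonpos h0]; linarith)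
      have h3 : 512 * K ^ 3 ≤ C₁ * boxWeight a := by
        have : 512 * K ^ 3 ≤ C₁ := by
          have : 0 ≤ κ * K ^ 6 + 96 * K := by positivity
          linarith
        nlinarith
      refine h1.trans ?_
      have := zpow_pos sixthRoot_pos (2 * boxBalance a b c)
      gcongr
    · set P : Fin 3 → (Fin 3 → ℤ) × (Fin 3 → ℤ) → Prop := fun k x => ∀ i, i ≠ k → x.1 i = 1 with hP
      set N := E.filter fun x => ∀ i j, i ≠ j → ¬ (x.1 i = 1 ∧ x.1 j = 1) with hN
      set X := boxSize a b c * sixthRoot ^ (-boxBalance a b c)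
        + boxSize a b c * sixthRoot ^ (2 * boxSkew a b c) with hX
      have hcover : E ⊆ N ∪ Finset.univ.biUnion fun k => E.filter (P k) := by
        intro x hx
        by_cases h : ∀ i j, i ≠ j → ¬ (x.1 i = 1 ∧ x.1 j = 1)
        · exact Finset.mem_union_left _ (Finset.mem_filter.2 ⟨hx, h⟩)
        · push Not at h
          obtain ⟨i, j, hij, hi, hj⟩ := h
          obtain ⟨k, hk⟩ : ∃ k : Fin 3, ∀ l, l ≠ k → l = i ∨ l = j :=
            (by decide : ∀ i j : Fin 3, i ≠ j → ∃ k : Fin 3, ∀ l, l ≠ k → l = i ∨ l = j) i j hij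
          refine Finset.mem_union_right _ (Finset.mem_biUnion.2 ⟨k, Finset.mem_univ _,
            Finset.mem_filter.2 ⟨hx, fun l hl => ?_⟩⟩)
          rcases hk l hl with rfl | rfl
          · exact hi
          · exact hj
      have hcard : E.card ≤ N.card + ∑ k, (E.filter (P k)).card :=
        (Finset.card_le_card hcover).trans ((Finset.card_union_le _ _).trans
          (Nat.add_le_add_left Finset.card_biUnion_le _))
      have hcard' : (E.card : ℝ) ≤ N.card + ∑ k, ((E.filter (P k)).card : ℝ) := by
        exact_mod_cast hcard
      have h1 : (N.card : ℝ) ≤ κ * K ^ 6 * X := by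
        have := hκE hK hq (hZ b) (hZ c) N (fun x hx => hE x (Finset.mem_filter.1 hx).1)
          (fun x hx => (Finset.mem_filter.1 hx).2)
        rwa [conics_term_eq a b c, skew_term_eq a b c] at this
      have h2 : ∀ k, ((E.filter (P k)).card : ℝ) ≤ 32 * K * boxWeight a * X := by
        intro k
        have := card_degenerate_dyadic_le hK a b c k (E.filter (P k))
          (fun x hx => hE x (Finset.mem_filter.1 hx).1) (fun x hx => (Finset.mem_filter.1 hx).2)
        rwa [conics_term_eq a b c, skew_term_eq a b c] at this
      have h3 : ∑ k, ((E.filter (P k)).card : ℝ) ≤ 3 * (32 * K * boxWeight a * X) := by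
        refine (Finset.sum_le_sum fun k _ => h2 k).trans ?_
        simp
      rw [abs_of_nonneg h0]
      have hXpos : 0 ≤ X := by
        have := zpow_pos sixthRoot_pos (-boxBalance a b c)
        positivity
      have h4 : κ * K ^ 6 * X ≤ κ * K ^ 6 * boxWeight a * X := by
        have : κ * K ^ 6 ≤ κ * K ^ 6 * boxWeight a := le_mul_of_one_le_right (by positivity) hw
        gcongr
      have h5 : 0 ≤ 512 * K ^ 3 * boxWeight a * X := by positivity
      rw [hC₁]
      nlinarith
  refine suff.trans ?_
  calc C₁ * boxWeight a * (boxSize a b c * sixthRoot ^ (-|boxBalance a b c|)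
        + boxSize a b c * sixthRoot ^ (2 * boxSkew a b c))
      ≤ C₁ * boxWeight a * (boxSize a b c * (8 * K * sixthRoot ^ (-|boxBalance a b c|))
        + boxSize a b c * (8 * K * sixthRoot ^ (-|boxSkew a b c|))) := by
        gcongr
        nlinarith
    _ = _ := by ring

theorem exists_sum_sixthRoot_le : ∃ κ : ℝ, 0 < κ ∧ ∀ (L : ℕ) (m : ℤ),
    ∑ b ∈ Finset.range L, sixthRoot ^ (-|2 * (b : ℤ) + m|) ≤ κ := by
  set f : ℤ → ℝ := fun n => sixthRoot ^ (-|n|) with hf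
  have hf0 : ∀ n, 0 ≤ f n := fun n => (zpow_pos sixthRoot_pos _).le
  have hgeom : Summable fun n : ℕ => (sixthRoot⁻¹) ^ n :=
    summable_geometric_of_lt_one (inv_pos.2 sixthRoot_pos).le (inv_lt_one_of_one_lt₀ one_lt_sixthRoot)
  have hnat : ∀ n : ℕ, f n = (sixthRoot⁻¹) ^ n := fun n => by
    simp only [hf, Nat.abs_cast, zpow_neg, zpow_natCast, inv_pow]
  have hneg : ∀ n : ℕ, f (-(n : ℤ)) = (sixthRoot⁻¹) ^ n := fun n => by
    simp only [hf, abs_neg, Nat.abs_cast, zpow_neg, zpow_natCast, inv_pow]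
  have hsum : Summable f := Summable.of_nat_of_neg (by simpa only [hnat] using hgeom)
    (by simpa only [hneg] using hgeom)
  refine ⟨∑' n, f n + 1, by have : 0 ≤ ∑' n, f n := tsum_nonneg hf0; positivity, fun L m => ?_⟩
  have hinj : Set.InjOn (fun b : ℕ => 2 * (b : ℤ) + m) (Finset.range L : Set ℕ) := by
    intro b _ b' _ h
    simp only at h
    omega
  have h1 := Finset.sum_image (f := f) hinj
  have h2 : ∑ n ∈ (Finset.range L).image (fun b : ℕ => 2 * (b : ℤ) + m), f n ≤ ∑' n, f n :=
    hsum.sum_le_tsum _ fun n _ => hf0 n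
  rw [h1] at h2
  exact h2.trans (by linarith)

/-- For each `k` at most `L` boxes carry extra weight, of at most `L` each, so the degenerate conics
add only `3 L²`. -/
theorem sum_boxWeight_le (L : ℕ) :
    ∑ a ∈ Fintype.piFinset fun _ : Fin 3 => Finset.range L, boxWeight a ≤ 4 * (L : ℝ) ^ 3 := by
  classical
  set A := Fintype.piFinset fun _ : Fin 3 => Finset.range L with hA
  have hcard : (A.card : ℝ) = (L : ℝ) ^ 3 := by
    rw [hA, Fintype.card_piFinset]; simp
  have hmem : ∀ a ∈ A, ∀ i, a i < L := fun a ha i =>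
    Finset.mem_range.1 (Fintype.mem_piFinset.1 ha i)
  have hk : ∀ k : Fin 3, ∑ a ∈ A, (if ∀ i, i ≠ k → a i = 0 then (a k + 1 : ℝ) else 0) ≤ (L : ℝ) * L := by
    intro k
    rw [← Finset.sum_filter]
    have h1 : ∀ a ∈ A.filter (fun a => ∀ i, i ≠ k → a i = 0), (a k + 1 : ℝ) ≤ L := by
      intro a ha
      have := hmem a (Finset.mem_filter.1 ha).1 k
      exact_mod_cast this
    have h2 := Finset.sum_le_card_nsmul _ _ _ h1
    have h3 : (A.filter (fun a => ∀ i, i ≠ k → a i = 0)).card ≤ L := by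
      rw [← Finset.card_range L]
      apply Finset.card_le_card_of_injOn (fun a => a k)
      · intro a ha
        rw [Finset.mem_coe, Finset.mem_filter] at ha
        exact Finset.mem_coe.2 (Finset.mem_range.2 (hmem a ha.1 k))
      · intro a ha a' ha' h
        rw [Finset.mem_coe, Finset.mem_filter] at ha ha'
        funext i
        by_cases hi : i = k
        · rw [hi]; exact h
        · rw [ha.2 i hi, ha'.2 i hi]
    rw [nsmul_eq_mul] at h2
    refine h2.trans ?_
    gcongr
  have hsum : ∑ a ∈ A, boxWeight a ≤ (L : ℝ) ^ 3 + 3 * ((L : ℝ) * L) := by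
    simp only [boxWeight, Finset.sum_add_distrib]
    rw [Finset.sum_comm]
    have := Finset.sum_le_sum fun k (_ : k ∈ (Finset.univ : Finset (Fin 3))) => hk k
    simp only [Finset.sum_const, Finset.card_univ, Fintype.card_fin, nsmul_eq_mul] at this ⊢
    push_cast at this
    rw [hcard]
    linarith
  refine hsum.trans ?_
  rcases Nat.eq_zero_or_pos L with rfl | hL
  · simp
  · have : (1 : ℝ) ≤ L := by exact_mod_cast hL
    nlinarith [mul_le_mul_of_nonneg_left this (mul_self_nonneg (L : ℝ))]

/-- Both the balance and the skew contain `b` with coefficient 2. For fixed `a` and `c` the sum over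
`b` is therefore bounded by geometric series, which saves one of five factors `L`. -/
theorem exists_sum_boxes_le : ∃ κ : ℝ, 0 < κ ∧ ∀ L : ℕ,
    ∑ x ∈ (Fintype.piFinset fun _ : Fin 3 => Finset.range L) ×ˢ
      (Finset.range L ×ˢ Finset.range L), boxWeight x.1 *
        (sixthRoot ^ (-|boxBalance x.1 x.2.1 x.2.2|) + sixthRoot ^ (-|boxSkew x.1 x.2.1 x.2.2|))
      ≤ κ * (L : ℝ) ^ 4 := by
  obtain ⟨κ, hκ, hsum⟩ := exists_sum_sixthRoot_le
  refine ⟨8 * κ, by positivity, fun L => ?_⟩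
  rw [Finset.sum_product]
  have h1 : ∀ a : Fin 3 → ℕ, ∑ y ∈ Finset.range L ×ˢ Finset.range L, boxWeight a *
      (sixthRoot ^ (-|boxBalance a y.1 y.2|) + sixthRoot ^ (-|boxSkew a y.1 y.2|))
      ≤ boxWeight a * (L * (2 * κ)) := by
    intro a
    rw [← Finset.mul_sum, Finset.sum_product_right]
    have hw := one_le_boxWeight a
    apply mul_le_mul_of_nonneg_left _ (by linarith)
    have h2 : ∀ c ∈ Finset.range L, ∑ b ∈ Finset.range L,
        (sixthRoot ^ (-|boxBalance a b c|) + sixthRoot ^ (-|boxSkew a b c|)) ≤ 2 * κ := by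
      intro c _
      rw [Finset.sum_add_distrib]
      have e1 := hsum L (4 * c - 2 * a 0 - 3 * a 1 - a 2)
      have e2 := hsum L (a 0 - a 2 - 2 * c)
      have f1 : ∀ b : ℕ, boxBalance a b c = 2 * (b : ℤ) + (4 * c - 2 * a 0 - 3 * a 1 - a 2) :=
        fun b => by simp only [boxBalance]; ring
      have f2 : ∀ b : ℕ, boxSkew a b c = 2 * (b : ℤ) + (a 0 - a 2 - 2 * c) :=
        fun b => by simp only [boxSkew]; ring
      simp only [f1, f2]
      linarith
    have := Finset.sum_le_card_nsmul _ _ _ h2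
    rwa [nsmul_eq_mul, Finset.card_range] at this
  refine (Finset.sum_le_sum fun a _ => h1 a).trans ?_
  rw [← Finset.sum_mul]
  have := sum_boxWeight_le L
  calc _ ≤ 4 * (L : ℝ) ^ 3 * (L * (2 * κ)) := by gcongr
    _ = _ := by ring

/-! ### Counting torsor points -/

/-- A point on the torsor: a positive point `z` on the conic `∑ αᵢ sᵢ zᵢ² = 0` together with a
positive integer `w`. -/
structure TorsorPoint (α s z : Fin 3 → ℤ) (w : ℤ) : Prop where
  wpos : 0 < w
  adm : Admissible α s
  zero : diagForm (α * s) z z = 0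
  prim : IsPrimitive z
  pos : ∀ i, 0 < z i
  le : α 0 * s 0 * z 0 ^ 2 ≤ α 1 * s 1 * z 1 ^ 2

theorem two_pow_log_le {n : ℤ} (hn : 0 < n) :
    (2 : ℝ) ^ Nat.log 2 n.toNat ≤ n ∧ (n : ℝ) ≤ 2 * 2 ^ Nat.log 2 n.toNat := by
  have hn' : ((n.toNat : ℕ) : ℝ) = n := by exact_mod_cast Int.toNat_of_nonneg hn.le
  rw [← hn']
  constructor
  · exact_mod_cast Nat.pow_log_le_self 2 (by omega)
  · rw [← pow_succ']
    exact_mod_cast (Nat.lt_pow_succ_log_self (by norm_num) n.toNat).le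

theorem log_toNat_lt {n : ℤ} (hn : 0 < n) {L : ℕ} (h : n < 2 ^ L) : Nat.log 2 n.toNat < L := by
  apply Nat.log_lt_of_lt_pow (by omega)
  zify
  rwa [Int.toNat_of_nonneg hn.le]

theorem exists_card_torsorPoints_le {α : Fin 3 → ℤ} {K : ℝ} (hK : CoeffBound α K) :
    ∃ C : ℝ, 0 < C ∧ ∀ (B : ℝ) (L : ℕ), 0 < B → B ^ 3 < 2 ^ L →
    ∀ T : Finset (ℤ × (Fin 3 → ℤ) × (Fin 3 → ℤ)),
    (∀ x ∈ T, TorsorPoint α x.2.1 x.2.2 x.1 ∧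
      (((x.2.1 0 * x.2.1 1 * x.2.1 2) ^ 2 * x.1 ^ 3 * (x.2.2 0 * x.2.2 1 * x.2.2 2) : ℤ) : ℝ)
        ≤ B ^ 3) →
    (T.card : ℝ) ≤ C * (B * (L : ℝ) ^ 4) := by
  classical
  obtain ⟨C₁, hC₁, hbox⟩ := exists_card_dyadic_le hK
  obtain ⟨κ, hκ, hsum⟩ := exists_sum_boxes_le
  have k2 := hK.two_le
  refine ⟨C₁ * (4 * K) * κ, by positivity, ?_⟩
  intro B L hB hBL T hT
  set f : ℤ × (Fin 3 → ℤ) × (Fin 3 → ℤ) → (Fin 3 → ℕ) × (ℕ × ℕ) := fun x =>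
    (fun i => Nat.log 2 (x.2.1 i).toNat,
      (Nat.log 2 (x.2.2 0).toNat, Nat.log 2 (x.2.2 2).toNat)) with hf
  have hfib : (T.card : ℝ) ≤ ∑ y ∈ T.image f, C₁ * (4 * K) * B * (boxWeight y.1 *
        (sixthRoot ^ (-|boxBalance y.1 y.2.1 y.2.2|) + sixthRoot ^ (-|boxSkew y.1 y.2.1 y.2.2|))) := by
    apply card_le_sum_of_fiber_le T f
    rintro ⟨a, b, c⟩ -
    simp only
    set F := T.filter (fun x => f x = (a, b, c)) with hF
    have hF' : ∀ x ∈ F, InBox α (boxSide a) (2 ^ b) (2 ^ c) x.2.1 x.2.2 := by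
      intro x hx
      rw [hF, Finset.mem_filter] at hx
      obtain ⟨t, -⟩ := hT x hx.1
      have e := hx.2
      simp only [hf, Prod.mk.injEq] at e
      obtain ⟨ea, eb, ec⟩ := e
      refine ⟨t.adm, t.zero, t.prim, t.pos, fun i => ?_, ?_, ?_⟩
      · rw [boxSide_sq, ← ea]; exact two_pow_log_le (t.adm.pos i)
      · rw [← eb]; exact two_pow_log_le (t.pos 0)
      · rw [← ec]; exact two_pow_log_le (t.pos 2)
    have hD := boxSize_pos a b c
    have hq1 := boxSide_pos a 1
    have hq2 := boxSide_pos a 2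
    -- For given `(s, z)` the height condition forces `w ≤ 2 K B / D` with `D = boxSize a b c`. This
    -- cancels the factor `D` in the number of pairs, so a box contributes `B` times its weight and
    -- decay.
    have hcard := card_le_mul_of_fiber_le F Prod.snd (c := 2 * (2 * K * B / boxSize a b c))
      (N := C₁ * boxSize a b c * (boxWeight a *
        (sixthRoot ^ (-|boxBalance a b c|) + sixthRoot ^ (-|boxSkew a b c|)))) ?_ (by positivity) ?_
    · refine hcard.trans_eq ?_
      field_simp
      ring
    · intro p _
      have hinj : Set.InjOn Prod.fst (↑(F.filter fun x => x.2 = p) :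
          Set (ℤ × (Fin 3 → ℤ) × (Fin 3 → ℤ))) := by
        intro x hx y hy h
        rw [Finset.mem_coe, Finset.mem_filter] at hx hy
        exact Prod.ext h (hx.2.trans hy.2.symm)
      rw [← Finset.card_image_of_injOn hinj]
      apply card_int_le _ (by positivity)
      intro w hw
      obtain ⟨x, hx, rfl⟩ := Finset.mem_image.1 hw
      have hxF := (Finset.mem_filter.1 hx).1
      have hxb := hF' x hxF
      obtain ⟨t, hle⟩ := hT x (Finset.mem_filter.1 hxF).1
      refine ⟨t.wpos.ne', ?_⟩
      have hw0 : (0 : ℝ) < x.1 := by exact_mod_cast t.wpos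
      rw [abs_of_pos hw0, le_div_iff₀ hD]
      apply le_of_pow_le_pow_left₀ (n := 3) (by norm_num) (by positivity)
      push_cast at hle
      generalize x.2.1 = s at *
      generalize x.2.2 = z at *
      have s0 : (0 : ℝ) < s 0 := by exact_mod_cast t.adm.pos 0
      have s1 : (0 : ℝ) < s 1 := by exact_mod_cast t.adm.pos 1
      have s2 : (0 : ℝ) < s 2 := by exact_mod_cast t.adm.pos 2
      have z0 : (0 : ℝ) < z 0 := by exact_mod_cast t.pos 0
      have z1 : (0 : ℝ) < z 1 := by exact_mod_cast t.pos 1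
      have z2 : (0 : ℝ) < z 2 := by exact_mod_cast t.pos 2
      have a1 : (0 : ℝ) < α 1 := by exact_mod_cast hK.pos1
      have a2 : (1 : ℝ) ≤ -α 2 := by
        have : 1 ≤ -α 2 := by have := hK.neg2; omega
        exact_mod_cast this
      -- The ordering `α₀ s₀ z₀² ≤ α₁ s₁ z₁²` makes the `z₁` term at least half of the negative
      -- term. This bounds `z₁` from below, although it has no dyadic parameter of its own.
      have hz1 : boxSide a 2 / boxSide a 1 * 2 ^ c ≤ 2 * K * z 1 := by
        apply (sq_le_sq₀ (by positivity) (by positivity)).1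
        rw [mul_pow, div_pow, div_mul_eq_mul_div, div_le_iff₀ (by positivity)]
        have e1 : (-α 2 * s 2 * z 2 ^ 2 : ℝ) ≤ 2 * (α 1 * s 1 * z 1 ^ 2) := by
          have hz := t.zero
          have hl := t.le
          simp only [diagForm, Pi.mul_apply] at hz
          have : -α 2 * s 2 * z 2 ^ 2 ≤ 2 * (α 1 * s 1 * z 1 ^ 2) := by linarith
          exact_mod_cast this
        have e2 : boxSide a 2 ^ 2 * (2 ^ c) ^ 2 ≤ (-α 2 * s 2 * z 2 ^ 2 : ℝ) := by
          have u1 := (hxb.mem 2).1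
          have u2 := hxb.mem2.1
          have u3 : boxSide a 2 ^ 2 ≤ -α 2 * s 2 := by nlinarith
          have : (0 : ℝ) ≤ -α 2 * s 2 := (sq_nonneg _).trans u3
          gcongr
        have e3 : (α 1 * s 1 * z 1 ^ 2 : ℝ) ≤ K * (2 * boxSide a 1 ^ 2) * z 1 ^ 2 := by
          have u1 := (hxb.mem 1).2
          have u2 := hK.le1
          gcongr
        have e4 : 4 * K * (boxSide a 1 ^ 2 * z 1 ^ 2) ≤ 4 * K ^ 2 * (boxSide a 1 ^ 2 * z 1 ^ 2) := by
          gcongr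
          nlinarith
        nlinarith
      have hq : (boxSide a 0 * boxSide a 1 * boxSide a 2) ^ 2 ≤ (s 0 * s 1 * s 2 : ℝ) := by
        rw [mul_pow, mul_pow]
        have u0 := (hxb.mem 0).1
        have u1 := (hxb.mem 1).1
        have u2 := (hxb.mem 2).1
        gcongr
      have hsize : boxSize a b c ^ 3 ≤ 2 * K * ((s 0 * s 1 * s 2 : ℝ) ^ 2 * (z 0 * z 1 * z 2)) := by
        rw [boxSize_cube]
        have u0 := hxb.mem0.1
        have u2 := hxb.mem2.1
        calc (boxSide a 0 * boxSide a 1 * boxSide a 2) ^ 4 * 2 ^ b * (2 ^ c) ^ 2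
              * (boxSide a 2 / boxSide a 1)
            = ((boxSide a 0 * boxSide a 1 * boxSide a 2) ^ 2) ^ 2 * 2 ^ b * (2 ^ c)
              * (boxSide a 2 / boxSide a 1 * 2 ^ c) := by ring
          _ ≤ (s 0 * s 1 * s 2 : ℝ) ^ 2 * z 0 * z 2 * (2 * K * z 1) := by gcongr
          _ = _ := by ring
      calc (x.1 * boxSize a b c : ℝ) ^ 3 = x.1 ^ 3 * boxSize a b c ^ 3 := by ring
        _ ≤ x.1 ^ 3 * (2 * K * ((s 0 * s 1 * s 2 : ℝ) ^ 2 * (z 0 * z 1 * z 2))) := by gcongr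
        _ = 2 * K * ((s 0 * s 1 * s 2 : ℝ) ^ 2 * x.1 ^ 3 * (z 0 * z 1 * z 2)) := by ring
        _ ≤ 2 * K * B ^ 3 := by gcongr
        _ ≤ (2 * K) ^ 3 * B ^ 3 := by
          gcongr
          nlinarith [sq_nonneg (2 * K), mul_nonneg (sq_nonneg (2 * K)) (by linarith : (0 : ℝ) ≤ K)]
        _ = (2 * K * B) ^ 3 := by ring
    · apply hbox a b c
      intro p hp
      obtain ⟨x, hx, rfl⟩ := Finset.mem_image.1 hp
      exact hF' x hx
  have hsub : T.image f ⊆ (Fintype.piFinset fun _ : Fin 3 => Finset.range L) ×ˢ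
      (Finset.range L ×ˢ Finset.range L) := by
    intro y hy
    obtain ⟨x, hx, rfl⟩ := Finset.mem_image.1 hy
    obtain ⟨t, hle⟩ := hT x hx
    have hlt := hle.trans_lt hBL
    set n := (x.2.1 0 * x.2.1 1 * x.2.1 2) ^ 2 * x.1 ^ 3 * (x.2.2 0 * x.2.2 1 * x.2.2 2) with hn
    have hn2 : n < 2 ^ L := by exact_mod_cast hlt
    have s0 := t.adm.pos 0
    have s1 := t.adm.pos 1
    have s2 := t.adm.pos 2
    have z0 := t.pos 0
    have z1 := t.pos 1
    have z2 := t.pos 2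
    have w0 := t.wpos
    have hnpos : 0 < n := by positivity
    have hsd : ∀ i, x.2.1 i ∣ n := by
      intro i
      have : x.2.1 i ∣ x.2.1 0 * x.2.1 1 * x.2.1 2 := by
        rw [← Fin.prod_univ_three]; exact Finset.dvd_prod_of_mem _ (Finset.mem_univ i)
      rw [hn, sq, mul_assoc, mul_assoc]
      exact this.mul_right _
    have hzd : ∀ i, x.2.2 i ∣ n := by
      intro i
      have : x.2.2 i ∣ x.2.2 0 * x.2.2 1 * x.2.2 2 := by
        rw [← Fin.prod_univ_three]; exact Finset.dvd_prod_of_mem _ (Finset.mem_univ i)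
      exact this.mul_left _
    have hs : ∀ i, x.2.1 i < 2 ^ L := fun i => (Int.le_of_dvd hnpos (hsd i)).trans_lt hn2
    have hz : ∀ i, x.2.2 i < 2 ^ L := fun i => (Int.le_of_dvd hnpos (hzd i)).trans_lt hn2
    simp only [hf, Finset.mem_product, Fintype.mem_piFinset, Finset.mem_range]
    exact ⟨fun i => log_toNat_lt (t.adm.pos i) (hs i), log_toNat_lt z0 (hz 0),
      log_toNat_lt z2 (hz 2)⟩
  refine hfib.trans ?_
  rw [← Finset.mul_sum]
  have hmono := Finset.sum_le_sum_of_subset_of_nonneg (f := fun y : (Fin 3 → ℕ) × (ℕ × ℕ) =>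
    boxWeight y.1 * (sixthRoot ^ (-|boxBalance y.1 y.2.1 y.2.2|)
      + sixthRoot ^ (-|boxSkew y.1 y.2.1 y.2.2|))) hsub (fun y _ _ => by
      have := one_le_boxWeight y.1
      have := zpow_pos sixthRoot_pos (-|boxBalance y.1 y.2.1 y.2.2|)
      have := zpow_pos sixthRoot_pos (-|boxSkew y.1 y.2.1 y.2.2|)
      positivity)
  calc _ ≤ C₁ * (4 * K) * B * (κ * (L : ℝ) ^ 4) := by
        gcongr
        exact hmono.trans (hsum L)
    _ = _ := by ring

/-! ### Descent to finitely many torsors -/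

/-- Split the squarefree part `a` of `|x|` as `r s` with `r = gcd(a, A)`; squarefreeness makes `s`
prime to `A`. The sign of `x` goes into `ρ`. -/
theorem exists_squarefree_decomposition {x A : ℤ} (hx : x ≠ 0) (hA : A ≠ 0) :
    ∃ ρ s z : ℤ, x = ρ * s * z ^ 2 ∧ ρ ∣ A ∧ 0 < s ∧ 0 < z ∧ Squarefree (ρ * s) ∧ IsCoprime s A := by
  obtain ⟨a, b, ha, hb, hab, hsq⟩ := Nat.sq_mul_squarefree_of_pos (Int.natAbs_pos.2 hx)
  have hrs : (Int.gcd a A : ℤ) ∣ a := Int.gcd_dvd_left _ _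
  have hr : (Int.gcd a A : ℤ) ≠ 0 := by
    have := Int.gcd_pos_of_ne_zero_right (a : ℤ) hA
    exact_mod_cast this.ne'
  obtain ⟨s, hs⟩ := hrs
  set r : ℤ := ((Int.gcd a A : ℕ) : ℤ) with hrdef
  have hrpos : 0 < r := lt_of_le_of_ne (by positivity) hr.symm
  have hspos : 0 < s := by
    have : 0 < r * s := by rw [← hs]; exact_mod_cast ha
    exact pos_of_mul_pos_right this hrpos.le
  have hsqZ : Squarefree (r * s) := by rw [← hs]; exact Int.squarefree_natCast.2 hsq
  have hcop : IsCoprime s A := by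
    refine isCoprime_of_prime_dvd (fun h => hA h.2) fun p hp hps hpA => ?_
    have h1 : p ∣ (a : ℤ) := by rw [hs]; exact hps.mul_left r
    have h2 : p ∣ r := Int.dvd_coe_gcd h1 hpA
    exact hp.not_isUnit (hsqZ p (mul_dvd_mul h2 hps))
  have habs : |x| = r * s * (b : ℤ) ^ 2 := by
    rw [← hs, Int.abs_eq_natAbs, ← hab]; push_cast; ring
  have hrA : r ∣ A := Int.gcd_dvd_right _ _
  rcases abs_choice x with h | h
  · exact ⟨r, s, b, by rw [← habs, h], hrA, hspos, by exact_mod_cast hb, hsqZ, hcop⟩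
  · refine ⟨-r, s, b, by linarith, (neg_dvd).2 hrA, hspos, by exact_mod_cast hb, ?_, hcop⟩
    rw [neg_mul]
    exact hsqZ.squarefree_of_dvd ((neg_dvd).2 dvd_rfl)

/-- By primitivity the common divisor of two coordinates is prime to the third, so the linear
relation makes it divide the third coefficient. The three common divisors are pairwise coprime,
hence can be removed together. -/
theorem exists_pairwise_coprime_reduction {x₀ x₁ x₂ a₀ a₁ a₂ u₀ u₁ u₂ : ℤ} (h₀ : x₀ ≠ 0)
    (h₁ : x₁ ≠ 0) (hu : u₀ * x₀ + u₁ * x₁ + u₂ * x₂ = 1)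
    (h : a₀ * x₀ + a₁ * x₁ + a₂ * x₂ = 0) :
    ∃ g₀ g₁ g₂ b₀ b₁ b₂ y₀ y₁ y₂ : ℤ, a₀ = g₀ * b₀ ∧ a₁ = g₁ * b₁ ∧ a₂ = g₂ * b₂ ∧
      x₀ = g₁ * g₂ * y₀ ∧ x₁ = g₂ * g₀ * y₁ ∧ x₂ = g₀ * g₁ * y₂ ∧
      IsCoprime y₀ y₁ ∧ IsCoprime y₁ y₂ ∧ IsCoprime y₂ y₀ ∧ b₀ * y₀ + b₁ * y₁ + b₂ * y₂ = 0 := by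
  have key : ∀ {x y z a b c u v w : ℤ}, x ≠ 0 → u * x + v * y + w * z = 1 →
      a * x + b * y + c * z = 0 → ((Int.gcd x y : ℕ) : ℤ) ∣ c ∧ (Int.gcd x y : ℤ) ≠ 0 ∧
        IsCoprime (x / Int.gcd x y) (y / Int.gcd x y) ∧ IsCoprime ((Int.gcd x y : ℕ) : ℤ) z := by
    intro x y z a b c u v w hx hu h
    have d1 : ((Int.gcd x y : ℕ) : ℤ) ∣ x := Int.gcd_dvd_left _ _
    have d2 : ((Int.gcd x y : ℕ) : ℤ) ∣ y := Int.gcd_dvd_right _ _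
    have hpos := Int.gcd_pos_of_ne_zero_left y hx
    have hc : IsCoprime ((Int.gcd x y : ℕ) : ℤ) z := by
      obtain ⟨p, hp⟩ := d1
      obtain ⟨q, hq⟩ := d2
      exact ⟨u * p + v * q, w, by linear_combination hu - u * hp - v * hq⟩
    refine ⟨?_, by exact_mod_cast hpos.ne', ?_, hc⟩
    · apply hc.dvd_of_dvd_mul_right
      rw [show c * z = -(a * x + b * y) by linarith]
      exact (dvd_neg).2 (dvd_add (d1.mul_left a) (d2.mul_left b))
    · rw [Int.isCoprime_iff_gcd_eq_one]
      exact Int.gcd_div_gcd_div_gcd hpos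
  obtain ⟨⟨b₂, hb₂⟩, n₂, c₂, e₂⟩ := key h₀ hu h
  obtain ⟨⟨b₀, hb₀⟩, n₀, c₀, e₀⟩ := key (z := x₀) (w := u₀) (a := a₁) (b := a₂) (c := a₀) h₁
    (show u₁ * x₁ + u₂ * x₂ + u₀ * x₀ = 1 by linarith) (by linarith)
  obtain ⟨⟨b₁, hb₁⟩, n₁, c₁, e₁⟩ := key (y := x₂) (z := x₁) (v := u₂) (w := u₁) (a := a₀) (b := a₂)
    (c := a₁) h₀ (show u₀ * x₀ + u₂ * x₂ + u₁ * x₁ = 1 by linarith) (by linarith)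
  have d₂₀ : ((Int.gcd x₀ x₁ : ℕ) : ℤ) ∣ x₀ := Int.gcd_dvd_left _ _
  have d₂₁ : ((Int.gcd x₀ x₁ : ℕ) : ℤ) ∣ x₁ := Int.gcd_dvd_right _ _
  have d₀₁ : ((Int.gcd x₁ x₂ : ℕ) : ℤ) ∣ x₁ := Int.gcd_dvd_left _ _
  have d₀₂ : ((Int.gcd x₁ x₂ : ℕ) : ℤ) ∣ x₂ := Int.gcd_dvd_right _ _
  have d₁₀ : ((Int.gcd x₀ x₂ : ℕ) : ℤ) ∣ x₀ := Int.gcd_dvd_left _ _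
  have d₁₂ : ((Int.gcd x₀ x₂ : ℕ) : ℤ) ∣ x₂ := Int.gcd_dvd_right _ _
  generalize ((Int.gcd x₀ x₁ : ℕ) : ℤ) = g₂ at *
  generalize ((Int.gcd x₁ x₂ : ℕ) : ℤ) = g₀ at *
  generalize ((Int.gcd x₀ x₂ : ℕ) : ℤ) = g₁ at *
  obtain ⟨y₀, hy₀⟩ := (e₂.of_isCoprime_of_dvd_right d₁₂).symm.mul_dvd d₁₀ d₂₀
  obtain ⟨y₁, hy₁⟩ := (e₂.of_isCoprime_of_dvd_right d₀₂).mul_dvd d₂₁ d₀₁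
  obtain ⟨y₂, hy₂⟩ := (e₀.of_isCoprime_of_dvd_right d₁₀).mul_dvd d₀₂ d₁₂
  refine ⟨g₀, g₁, g₂, b₀, b₁, b₂, y₀, y₁, y₂, hb₀, hb₁, hb₂, hy₀, hy₁, hy₂, ?_, ?_, ?_, ?_⟩
  · refine (c₂.of_isCoprime_of_dvd_left ?_).of_isCoprime_of_dvd_right ?_
    · exact ⟨g₁, by rw [hy₀, show g₁ * g₂ * y₀ = g₂ * (y₀ * g₁) by ring, Int.mul_ediv_cancel_left _ n₂]⟩
    · exact ⟨g₀, by rw [hy₁, show g₂ * g₀ * y₁ = g₂ * (y₁ * g₀) by ring, Int.mul_ediv_cancel_left _ n₂]⟩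
  · refine (c₀.of_isCoprime_of_dvd_left ?_).of_isCoprime_of_dvd_right ?_
    · exact ⟨g₂, by rw [hy₁, show g₂ * g₀ * y₁ = g₀ * (y₁ * g₂) by ring, Int.mul_ediv_cancel_left _ n₀]⟩
    · exact ⟨g₁, by rw [hy₂, show g₀ * g₁ * y₂ = g₀ * (y₂ * g₁) by ring, Int.mul_ediv_cancel_left _ n₀]⟩
  · refine (c₁.symm.of_isCoprime_of_dvd_left ?_).of_isCoprime_of_dvd_right ?_
    · exact ⟨g₀, by rw [hy₂, show g₀ * g₁ * y₂ = g₁ * (y₂ * g₀) by ring, Int.mul_ediv_cancel_left _ n₁]⟩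
    · exact ⟨g₂, by rw [hy₀, show g₁ * g₂ * y₀ = g₁ * (y₀ * g₂) by ring, Int.mul_ediv_cancel_left _ n₁]⟩
  · apply mul_left_cancel₀ (mul_ne_zero (mul_ne_zero n₀ n₁) n₂)
    rw [hb₀, hb₁, hb₂, hy₀, hy₁, hy₂] at h
    linear_combination h

theorem exists_primitive_multiple {x₀ x₁ x₂ : ℤ} (h : x₀ ≠ 0) :
    ∃ d y₀ y₁ y₂ u₀ u₁ u₂ : ℤ, 0 < d ∧ x₀ = d * y₀ ∧ x₁ = d * y₁ ∧ x₂ = d * y₂ ∧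
      u₀ * y₀ + u₁ * y₁ + u₂ * y₂ = 1 := by
  set g : ℤ := ((Int.gcd x₀ x₁ : ℕ) : ℤ) with hg
  set d : ℤ := ((Int.gcd g x₂ : ℕ) : ℤ) with hd
  have dg : d ∣ g := Int.gcd_dvd_left _ _
  obtain ⟨y₀, h₀⟩ : d ∣ x₀ := dg.trans (Int.gcd_dvd_left _ _)
  obtain ⟨y₁, h₁⟩ : d ∣ x₁ := dg.trans (Int.gcd_dvd_right _ _)
  obtain ⟨y₂, h₂⟩ : d ∣ x₂ := Int.gcd_dvd_right _ _
  have hd0 : d ≠ 0 := by rintro e; rw [e, zero_mul] at h₀; exact h h₀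
  have b₁ : g = x₀ * x₀.gcdA x₁ + x₁ * x₀.gcdB x₁ := Int.gcd_eq_gcd_ab _ _
  have b₂ : d = g * g.gcdA x₂ + x₂ * g.gcdB x₂ := Int.gcd_eq_gcd_ab _ _
  generalize g.gcdA x₂ = p at *
  generalize g.gcdB x₂ = q at *
  refine ⟨d, y₀, y₁, y₂, x₀.gcdA x₁ * p, x₀.gcdB x₁ * p, q,
    lt_of_le_of_ne (by positivity) hd0.symm, h₀, h₁, h₂, ?_⟩
  apply mul_left_cancel₀ hd0
  linear_combination (-(x₀.gcdA x₁ * p)) * h₀ - (x₀.gcdB x₁ * p) * h₁ - q * h₂ - b₂ - p * b₁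

theorem exists_torsor_coordinates {a X : Fin 3 → ℤ} {y : ℤ} (ha : ∀ i, a i ≠ 0) (hX : ∀ i, X i ≠ 0)
    (hlin : a 0 * X 0 + a 1 * X 1 + a 2 * X 2 = 0) (hy : X 0 * X 1 * X 2 = y ^ 2) :
    ∃ (l α s z : Fin 3 → ℤ) (w : ℤ), (∀ i, |l i| ≤ |a 0 * a 1 * a 2| ^ 6) ∧
      (∀ i, |α i| ≤ |a 0 * a 1 * a 2| ^ 6) ∧ (∀ i, α i ≠ 0) ∧ 0 < w ∧ Admissible α s ∧
      diagForm (α * s) z z = 0 ∧ IsPrimitive z ∧ (∀ i, 0 < z i) ∧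
      ∀ i, X i = l i * (s 0 * s 1 * s 2) * w ^ 2 * s i * z i ^ 2 := by
  set A := a 0 * a 1 * a 2 with hAdef
  have hA : A ≠ 0 := mul_ne_zero (mul_ne_zero (ha 0) (ha 1)) (ha 2)
  obtain ⟨d, x₀, x₁, x₂, u₀, u₁, u₂, hd, e₀, e₁, e₂, hu⟩ :=
    exists_primitive_multiple (x₀ := X 0) (x₁ := X 1) (x₂ := X 2) (hX 0)
  have n₀ : x₀ ≠ 0 := by rintro rfl; exact hX 0 (by rw [e₀, mul_zero])
  have n₁ : x₁ ≠ 0 := by rintro rfl; exact hX 1 (by rw [e₁, mul_zero])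
  have n₂ : x₂ ≠ 0 := by rintro rfl; exact hX 2 (by rw [e₂, mul_zero])
  have hlin' : a 0 * x₀ + a 1 * x₁ + a 2 * x₂ = 0 := by
    apply mul_left_cancel₀ hd.ne'
    rw [e₀, e₁, e₂] at hlin
    linear_combination hlin
  obtain ⟨g₀, g₁, g₂, b₀, b₁, b₂, y₀, y₁, y₂, ha₀, ha₁, ha₂, f₀, f₁, f₂, c₀₁, c₁₂, c₂₀, hby⟩ :=
    exists_pairwise_coprime_reduction n₀ n₁ hu hlin'
  have m₀ : y₀ ≠ 0 := by rintro rfl; exact n₀ (by rw [f₀, mul_zero])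
  have m₁ : y₁ ≠ 0 := by rintro rfl; exact n₁ (by rw [f₁, mul_zero])
  have m₂ : y₂ ≠ 0 := by rintro rfl; exact n₂ (by rw [f₂, mul_zero])
  obtain ⟨ρ₀, s₀, z₀, k₀, r₀, sp₀, zp₀, q₀, t₀⟩ := exists_squarefree_decomposition m₀ hA
  obtain ⟨ρ₁, s₁, z₁, k₁, r₁, sp₁, zp₁, q₁, t₁⟩ := exists_squarefree_decomposition m₁ hA
  obtain ⟨ρ₂, s₂, z₂, k₂, r₂, sp₂, zp₂, q₂, t₂⟩ := exists_squarefree_decomposition m₂ hA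
  have hg₀ : g₀ ∣ A := (Dvd.intro _ ha₀.symm).trans ⟨a 1 * a 2, by rw [hAdef]; ring⟩
  have hg₁ : g₁ ∣ A := (Dvd.intro _ ha₁.symm).trans ⟨a 0 * a 2, by rw [hAdef]; ring⟩
  have hg₂ : g₂ ∣ A := (Dvd.intro _ ha₂.symm).trans ⟨a 0 * a 1, by rw [hAdef]; ring⟩
  have hb₀ : b₀ ∣ A := (Dvd.intro_left _ ha₀.symm).trans ⟨a 1 * a 2, by rw [hAdef]; ring⟩
  have hb₁ : b₁ ∣ A := (Dvd.intro_left _ ha₁.symm).trans ⟨a 0 * a 2, by rw [hAdef]; ring⟩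
  have hb₂ : b₂ ∣ A := (Dvd.intro_left _ ha₂.symm).trans ⟨a 0 * a 1, by rw [hAdef]; ring⟩
  have sd₀ : s₀ ∣ y₀ := ⟨ρ₀ * z₀ ^ 2, by rw [k₀]; ring⟩
  have sd₁ : s₁ ∣ y₁ := ⟨ρ₁ * z₁ ^ 2, by rw [k₁]; ring⟩
  have sd₂ : s₂ ∣ y₂ := ⟨ρ₂ * z₂ ^ 2, by rw [k₂]; ring⟩
  have S₀₁ : IsCoprime s₀ s₁ := (c₀₁.of_isCoprime_of_dvd_left sd₀).of_isCoprime_of_dvd_right sd₁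
  have S₁₂ : IsCoprime s₁ s₂ := (c₁₂.of_isCoprime_of_dvd_left sd₁).of_isCoprime_of_dvd_right sd₂
  have S₂₀ : IsCoprime s₂ s₀ := (c₂₀.of_isCoprime_of_dvd_left sd₂).of_isCoprime_of_dvd_right sd₀
  have Q₀ : ρ₀ * s₀ ∣ y₀ := ⟨z₀ ^ 2, k₀⟩
  have Q₁ : ρ₁ * s₁ ∣ y₁ := ⟨z₁ ^ 2, k₁⟩
  have Q₂ : ρ₂ * s₂ ∣ y₂ := ⟨z₂ ^ 2, k₂⟩
  have C₀₁ : IsCoprime (ρ₀ * s₀) (ρ₁ * s₁) :=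
    (c₀₁.of_isCoprime_of_dvd_left Q₀).of_isCoprime_of_dvd_right Q₁
  have C₁₂ : IsCoprime (ρ₁ * s₁) (ρ₂ * s₂) :=
    (c₁₂.of_isCoprime_of_dvd_left Q₁).of_isCoprime_of_dvd_right Q₂
  have C₀₂ : IsCoprime (ρ₀ * s₀) (ρ₂ * s₂) :=
    ((c₂₀.of_isCoprime_of_dvd_left Q₂).of_isCoprime_of_dvd_right Q₀).symm
  -- After removing squares, `d R` is a square with `R` squarefree, which forces `d = R w²`. This is
  -- the source of the factor `(s₀ s₁ s₂) w²` common to the three `Xᵢ`.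
  set R := ρ₀ * s₀ * (ρ₁ * s₁) * (ρ₂ * s₂) with hR
  have hRsq : Squarefree R := by
    rw [hR, squarefree_mul_iff, squarefree_mul_iff]
    exact ⟨(C₀₂.mul_left C₁₂).isRelPrime, ⟨C₀₁.isRelPrime, q₀, q₁⟩, q₂⟩
  have hR0 : R ≠ 0 := hRsq.ne_zero
  have hgne : g₀ * g₁ * g₂ ≠ 0 := by
    refine mul_ne_zero (mul_ne_zero ?_ ?_) ?_
    · rintro rfl; exact ha 0 (by rw [ha₀, zero_mul])
    · rintro rfl; exact ha 1 (by rw [ha₁, zero_mul])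
    · rintro rfl; exact ha 2 (by rw [ha₂, zero_mul])
  have hprod : (d * (g₀ * g₁ * g₂) * (z₀ * z₁ * z₂)) ^ 2 * (d * R) = y ^ 2 := by
    rw [← hy, e₀, e₁, e₂, f₀, f₁, f₂, k₀, k₁, k₂, hR]; ring
  obtain ⟨t, ht⟩ : d * (g₀ * g₁ * g₂) * (z₀ * z₁ * z₂) ∣ y :=
    (Int.pow_dvd_pow_iff two_ne_zero).1 ⟨_, hprod.symm⟩
  have hne : (d * (g₀ * g₁ * g₂) * (z₀ * z₁ * z₂)) ^ 2 ≠ 0 :=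
    pow_ne_zero 2 (mul_ne_zero (mul_ne_zero hd.ne' hgne) (by positivity))
  have hdR : d * R = t ^ 2 := by
    apply mul_left_cancel₀ hne
    rw [hprod, ht]; ring
  obtain ⟨w, hw⟩ : R ∣ t := (hRsq.dvd_pow_iff_dvd two_ne_zero).1 ⟨d, by rw [← hdR]; ring⟩
  have hdw : d = R * w ^ 2 := by
    apply mul_right_cancel₀ hR0
    rw [hdR, hw]; ring
  have hw0 : w ≠ 0 := by rintro rfl; exact hd.ne' (by rw [hdw]; ring)
  have hdl : ∀ {n : ℤ}, n ∣ A → |n| ≤ |A| := fun hn =>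
    Int.le_of_dvd (abs_pos.2 hA) ((abs_dvd_abs _ _).2 hn)
  -- Each `lᵢ` is a product of six divisors of `A`; for the `αᵢ` the product is padded with ones.
  have hbl : ∀ {p q r u v w : ℤ}, p ∣ A → q ∣ A → r ∣ A → u ∣ A → v ∣ A → w ∣ A →
      |p * q * r * u * v * w| ≤ |A| ^ 6 := by
    intro p q r u v w hp hq hr hu hv hw
    have := hdl hp
    have := hdl hq
    have := hdl hr
    have := hdl hu
    have := hdl hv
    have := hdl hw
    rw [abs_mul, abs_mul, abs_mul, abs_mul, abs_mul]
    calc |p| * |q| * |r| * |u| * |v| * |w| ≤ |A| * |A| * |A| * |A| * |A| * |A| := by gcongr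
      _ = |A| ^ 6 := by ring
  have hone : (1 : ℤ) ∣ A := one_dvd _
  refine ⟨![ρ₀ * ρ₁ * ρ₂ * g₁ * g₂ * ρ₀, ρ₀ * ρ₁ * ρ₂ * g₂ * g₀ * ρ₁, ρ₀ * ρ₁ * ρ₂ * g₀ * g₁ * ρ₂],
    ![b₀ * ρ₀, b₁ * ρ₁, b₂ * ρ₂], ![s₀, s₁, s₂], ![z₀, z₁, z₂], |w|, ?_, ?_, ?_, abs_pos.2 hw0,
    ⟨?_, ?_, ?_, ?_⟩, ?_, ?_, ?_, ?_⟩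
  · simp only [Fin.forall_fin_succ, Fin.forall_fin_zero]
    exact ⟨hbl r₀ r₁ r₂ hg₁ hg₂ r₀, hbl r₀ r₁ r₂ hg₂ hg₀ r₁, hbl r₀ r₁ r₂ hg₀ hg₁ r₂, trivial⟩
  · simp only [Fin.forall_fin_succ, Fin.forall_fin_zero]
    refine ⟨?_, ?_, ?_, trivial⟩
    · simpa using hbl hb₀ r₀ hone hone hone hone
    · simpa using hbl hb₁ r₁ hone hone hone hone
    · simpa using hbl hb₂ r₂ hone hone hone hone
  · simp only [Fin.forall_fin_succ, Fin.forall_fin_zero]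
    refine ⟨?_, ?_, ?_, trivial⟩
    · exact mul_ne_zero (right_ne_zero_of_mul (ha₀ ▸ ha 0)) (ne_zero_of_dvd_ne_zero hA r₀)
    · exact mul_ne_zero (right_ne_zero_of_mul (ha₁ ▸ ha 1)) (ne_zero_of_dvd_ne_zero hA r₁)
    · exact mul_ne_zero (right_ne_zero_of_mul (ha₂ ▸ ha 2)) (ne_zero_of_dvd_ne_zero hA r₂)
  · simp only [Fin.forall_fin_succ, Fin.forall_fin_zero]
    exact ⟨sp₀, sp₁, sp₂, trivial⟩
  · simp only [Fin.forall_fin_succ, Fin.forall_fin_zero]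
    exact ⟨(squarefree_mul_iff.1 q₀).2.2, (squarefree_mul_iff.1 q₁).2.2,
      (squarefree_mul_iff.1 q₂).2.2, trivial⟩
  · intro i j hij
    fin_cases i <;> fin_cases j
    · exact absurd rfl hij
    · exact S₀₁
    · exact S₂₀.symm
    · exact S₀₁.symm
    · exact absurd rfl hij
    · exact S₁₂
    · exact S₂₀
    · exact S₁₂.symm
    · exact absurd rfl hij
  · have hall : ∀ {s : ℤ}, IsCoprime s A → ∀ j, IsCoprime s (![b₀ * ρ₀, b₁ * ρ₁, b₂ * ρ₂] j) := by
      intro s hs j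
      fin_cases j
      · exact (hs.of_isCoprime_of_dvd_right hb₀).mul_right (hs.of_isCoprime_of_dvd_right r₀)
      · exact (hs.of_isCoprime_of_dvd_right hb₁).mul_right (hs.of_isCoprime_of_dvd_right r₁)
      · exact (hs.of_isCoprime_of_dvd_right hb₂).mul_right (hs.of_isCoprime_of_dvd_right r₂)
    simp only [Fin.forall_fin_succ (n := 2), Fin.forall_fin_succ (n := 1),
      Fin.forall_fin_succ (n := 0), Fin.forall_fin_zero] at hall ⊢
    exact ⟨hall t₀, hall t₁, hall t₂, trivial⟩
  · simp [diagForm]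
    rw [k₀, k₁, k₂] at hby
    linear_combination hby
  · have zc : IsCoprime z₀ z₁ := (c₀₁.of_isCoprime_of_dvd_left ⟨ρ₀ * s₀ * z₀, by rw [k₀]; ring⟩).of_isCoprime_of_dvd_right
      ⟨ρ₁ * s₁ * z₁, by rw [k₁]; ring⟩
    obtain ⟨u, v, huv⟩ := zc
    exact ⟨![u, v, 0], by simpa using huv⟩
  · simp only [Fin.forall_fin_succ, Fin.forall_fin_zero]
    exact ⟨zp₀, zp₁, zp₂, trivial⟩
  · have hd' : d = ρ₀ * ρ₁ * ρ₂ * (s₀ * s₁ * s₂) * w ^ 2 := by rw [hdw, hR]; ring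
    simp only [Fin.forall_fin_succ, Fin.forall_fin_zero]
    refine ⟨?_, ?_, ?_, trivial⟩
    · simp [e₀, f₀, k₀]; rw [hd']; ring
    · simp [e₁, f₁, k₁]; rw [hd']; ring
    · simp [e₂, f₂, k₂]; rw [hd']; ring

theorem diagForm_self_eq_sum (k z : Fin 3 → ℤ) : diagForm k z z = ∑ i, k i * z i ^ 2 := by
  rw [Fin.sum_univ_three, diagForm]; ring

/-- A vanishing sum with positive `sᵢ zᵢ²` excludes equal signs, so exactly one coefficient has the
odd sign. -/
theorem exists_signature {α s z : Fin 3 → ℤ} (hα : ∀ i, α i ≠ 0) (hs : ∀ i, 0 < s i)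
    (hz : ∀ i, 0 < z i) (h : diagForm (α * s) z z = 0) :
    ∃ (k : Fin 3) (ε : ℤ), (ε = 1 ∨ ε = -1) ∧ ε * α k < 0 ∧ ∀ i, i ≠ k → 0 < ε * α i := by
  simp only [diagForm, Pi.mul_apply] at h
  have p : ∀ i, 0 < s i * z i * z i := fun i => mul_pos (mul_pos (hs i) (hz i)) (hz i)
  have h' : α 0 * (s 0 * z 0 * z 0) + α 1 * (s 1 * z 1 * z 1) + α 2 * (s 2 * z 2 * z 2) = 0 := by
    linarith
  have p0 := p 0
  have p1 := p 1
  have p2 := p 2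
  simp only [Fin.forall_fin_succ, Fin.forall_fin_zero, Fin.exists_fin_succ]
  rcases lt_or_gt_of_ne (hα 0) with h0 | h0 <;> rcases lt_or_gt_of_ne (hα 1) with h1 | h1 <;>
    rcases lt_or_gt_of_ne (hα 2) with h2 | h2
  · nlinarith [mul_pos_of_neg_of_neg h0 (neg_lt_zero.2 p0),
      mul_pos_of_neg_of_neg h1 (neg_lt_zero.2 p1), mul_pos_of_neg_of_neg h2 (neg_lt_zero.2 p2)]
  · refine Or.inr (Or.inr (Or.inl ⟨-1, Or.inr rfl, ?_⟩)); simp; omega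
  · refine Or.inr (Or.inl ⟨-1, Or.inr rfl, ?_⟩); simp; omega
  · refine Or.inl ⟨1, Or.inl rfl, ?_⟩; simp; omega
  · refine Or.inl ⟨-1, Or.inr rfl, ?_⟩; simp; omega
  · refine Or.inr (Or.inl ⟨1, Or.inl rfl, ?_⟩); simp; omega
  · refine Or.inr (Or.inr (Or.inl ⟨1, Or.inl rfl, ?_⟩)); simp; omega
  · nlinarith [mul_pos h0 p0, mul_pos h1 p1, mul_pos h2 p2]

theorem exists_ordered_perm (k : Fin 3) (t : Fin 3 → ℤ) :
    ∃ π : Equiv.Perm (Fin 3), π 2 = k ∧ t (π 0) ≤ t (π 1) := by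
  obtain ⟨π, hπ⟩ : ∃ π : Equiv.Perm (Fin 3), π 2 = k := ⟨Equiv.swap 2 k, by simp⟩
  rcases le_total (t (π 0)) (t (π 1)) with h | h
  · exact ⟨π, hπ, h⟩
  · refine ⟨(Equiv.swap 0 1).trans π, ?_, ?_⟩
    · simp [Equiv.swap_apply_of_ne_of_ne (show (2 : Fin 3) ≠ 0 by decide)
        (show (2 : Fin 3) ≠ 1 by decide), hπ]
    · simpa using h

/-- Every solution of `a₀ X₀ + a₁ X₁ + a₂ X₂ = 0`, `X₀ X₁ X₂ = y²` is parametrised, up to a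
permutation, by a point on one of finitely many torsors. -/
theorem exists_torsorPoint {a X : Fin 3 → ℤ} {y : ℤ} (ha : ∀ i, a i ≠ 0) (hy0 : y ≠ 0)
    (hlin : a 0 * X 0 + a 1 * X 1 + a 2 * X 2 = 0) (hy : X 0 * X 1 * X 2 = y ^ 2) :
    ∃ (π : Equiv.Perm (Fin 3)) (l α s z : Fin 3 → ℤ) (w : ℤ),
      (∀ i, |l i| ≤ |a 0 * a 1 * a 2| ^ 6) ∧ (∀ i, |α i| ≤ |a 0 * a 1 * a 2| ^ 6) ∧
      (0 < α 0 ∧ 0 < α 1 ∧ α 2 < 0) ∧ TorsorPoint α s z w ∧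
      (s 0 * s 1 * s 2) ^ 2 * w ^ 3 * (z 0 * z 1 * z 2) ≤ |y| ∧
      ∀ i, X (π i) = l i * (s 0 * s 1 * s 2) * w ^ 2 * s i * z i ^ 2 := by
  have hX : ∀ i, X i ≠ 0 := by
    have h : ∏ i, X i ≠ 0 := by rw [Fin.prod_univ_three, hy]; exact pow_ne_zero 2 hy0
    exact fun i => Finset.prod_ne_zero_iff.1 h i (Finset.mem_univ i)
  obtain ⟨l, α, s, z, w, hl, hα, hα0, hw, hs, hz, hp, hzpos, hXl⟩ :=
    exists_torsor_coordinates ha hX hlin hy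
  obtain ⟨k, ε, hε, hk, hik⟩ := exists_signature hα0 hs.pos hzpos hz
  -- The permutation puts the odd sign last and the larger of the two positive terms second, as
  -- `CoeffBound` and `TorsorPoint` require.
  obtain ⟨π, hπ2, hπ⟩ := exists_ordered_perm k fun i => ε * α i * s i * z i ^ 2
  have hε2 : |ε| = 1 := by rcases hε with rfl | rfl <;> simp
  have hprod : ∀ f : Fin 3 → ℤ, f (π 0) * f (π 1) * f (π 2) = f 0 * f 1 * f 2 := fun f => by
    rw [← Fin.prod_univ_three, ← Fin.prod_univ_three (fun i => f (π i)), Equiv.prod_comp π f]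
  have hne : ∀ i, i ≠ 2 → π i ≠ k := fun i hi h => hi (π.injective (h.trans hπ2.symm))
  refine ⟨π, fun i => l (π i), fun i => ε * α (π i), fun i => s (π i), fun i => z (π i), w,
    fun i => hl _, fun i => ?_, ⟨hik _ (hne 0 (by decide)), hik _ (hne 1 (by decide)), ?_⟩,
    ⟨hw, ⟨fun i => hs.pos _, fun i => hs.sqf _, fun i j hij => hs.cop _ _ (π.injective.ne hij),
      fun i j => ?_⟩, ?_, ?_, fun i => hzpos _, hπ⟩, ?_, fun i => ?_⟩
  · rw [abs_mul, hε2, one_mul]; exact hα _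
  · simp only [hπ2]; exact hk
  · have : IsUnit ε := Int.isUnit_iff.2 hε
    exact (isCoprime_mul_unit_left_right this _ _).2 (hs.copα _ _)
  · rw [diagForm_self_eq_sum]
    rw [diagForm_self_eq_sum] at hz
    have := Equiv.sum_comp π fun i => (α * s) i * z i ^ 2
    rw [hz] at this
    simp only [Pi.mul_apply] at this ⊢
    calc ∑ i, ε * α (π i) * s (π i) * z (π i) ^ 2
        = ε * ∑ i, α (π i) * s (π i) * z (π i) ^ 2 := by
          rw [Finset.mul_sum]; exact Finset.sum_congr rfl fun i _ => by ring
      _ = 0 := by rw [this, mul_zero]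
  · obtain ⟨u, hu⟩ := hp
    refine ⟨fun i => u (π i), ?_⟩
    rw [← hu, ← Fin.sum_univ_three fun i => u (π i) * z (π i),
      ← Fin.sum_univ_three fun i => u i * z i]
    exact Equiv.sum_comp π fun i => u i * z i
  · rw [hprod s, hprod z]
    apply le_of_sq_le_sq _ (abs_nonneg y)
    rw [sq_abs, ← hy, hXl 0, hXl 1, hXl 2]
    have s0 := hs.pos 0
    have s1 := hs.pos 1
    have s2 := hs.pos 2
    have z0 := hzpos 0
    have z1 := hzpos 1
    have z2 := hzpos 2
    set m := ((s 0 * s 1 * s 2) ^ 2 * w ^ 3 * (z 0 * z 1 * z 2)) ^ 2 with hm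
    have hmpos : 0 < m := by positivity
    have e : l 0 * (s 0 * s 1 * s 2) * w ^ 2 * s 0 * z 0 ^ 2 *
        (l 1 * (s 0 * s 1 * s 2) * w ^ 2 * s 1 * z 1 ^ 2) *
        (l 2 * (s 0 * s 1 * s 2) * w ^ 2 * s 2 * z 2 ^ 2) = l 0 * l 1 * l 2 * m := by
      rw [hm]; ring
    rw [e]
    -- Here `y² = l₀ l₁ l₂ m` with `m > 0` and `y ≠ 0`, so the integer `l₀ l₁ l₂` is at least 1 and
    -- `m ≤ y²`.
    have hl1 : 0 < l 0 * l 1 * l 2 := by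
      have : 0 < l 0 * l 1 * l 2 * m := by
        rw [← e, ← hXl 0, ← hXl 1, ← hXl 2, hy]; positivity
      exact pos_of_mul_pos_left this hmpos.le
    nlinarith
  · rw [hprod s]; exact hXl _

/-- The bound holds since `3 / log 2 < 4.4` and the rounding error 1 is at most `1.6 log B` for `B ≥
2`. -/
theorem exists_dyadic_bound {B : ℝ} (hB : 2 ≤ B) :
    ∃ L : ℕ, B ^ 3 < 2 ^ L ∧ (L : ℝ) ≤ 6 * Real.log B := by
  have hl2 := Real.log_two_gt_d9
  have hlB : Real.log 2 ≤ Real.log B := Real.log_le_log (by norm_num) hB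
  have hlog2 : 0 < Real.log 2 := by linarith
  refine ⟨⌊3 * Real.log B / Real.log 2⌋₊ + 1, ?_, ?_⟩
  · have h := Nat.lt_floor_add_one (3 * Real.log B / Real.log 2)
    rw [div_lt_iff₀ hlog2] at h
    rw [← Real.log_lt_log_iff (by positivity) (by positivity), Real.log_pow, Real.log_pow]
    push_cast
    exact h
  · have h := Nat.floor_le (a := 3 * Real.log B / Real.log 2)
      (div_nonneg (by linarith) hlog2.le)
    have h2 : 3 * Real.log B / Real.log 2 ≤ 4.4 * Real.log B := by
      rw [div_le_iff₀ hlog2]; nlinarith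
    push_cast
    nlinarith

/-- The number of solutions of `a₀ X₀ + a₁ X₁ + a₂ X₂ = 0`, `X₀ X₁ X₂ = y²` with
`0 < |y| ≤ B³`. -/
theorem exists_card_solutions_le {a : Fin 3 → ℤ} (ha : ∀ i, a i ≠ 0) :
    ∃ C : ℝ, 0 < C ∧ ∀ B : ℝ, 2 ≤ B → ∀ T : Finset ((Fin 3 → ℤ) × ℤ),
    (∀ x ∈ T, x.2 ≠ 0 ∧ a 0 * x.1 0 + a 1 * x.1 1 + a 2 * x.1 2 = 0 ∧
      x.1 0 * x.1 1 * x.1 2 = x.2 ^ 2 ∧ |(x.2 : ℝ)| ≤ B ^ 3) →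
    (T.card : ℝ) ≤ C * (B * Real.log B ^ 4) := by
  classical
  set N : ℤ := |a 0 * a 1 * a 2| ^ 6 with hN
  have hCα : ∀ α : Fin 3 → ℤ, ∃ C : ℝ, 0 < C ∧ (0 < α 0 ∧ 0 < α 1 ∧ α 2 < 0 →
      ∀ (B : ℝ) (L : ℕ), 0 < B → B ^ 3 < 2 ^ L →
      ∀ T : Finset (ℤ × (Fin 3 → ℤ) × (Fin 3 → ℤ)),
      (∀ x ∈ T, TorsorPoint α x.2.1 x.2.2 x.1 ∧
        (((x.2.1 0 * x.2.1 1 * x.2.1 2) ^ 2 * x.1 ^ 3 * (x.2.2 0 * x.2.2 1 * x.2.2 2) : ℤ) : ℝ)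
          ≤ B ^ 3) → (T.card : ℝ) ≤ C * (B * (L : ℝ) ^ 4)) := by
    intro α
    by_cases h : 0 < α 0 ∧ 0 < α 1 ∧ α 2 < 0
    · have hK : CoeffBound α (2 + α 0 + α 1 - α 2) := by
        have h0 : (0 : ℝ) < α 0 := by exact_mod_cast h.1
        have h1 : (0 : ℝ) < α 1 := by exact_mod_cast h.2.1
        have h2 : (α 2 : ℝ) < 0 := by exact_mod_cast h.2.2
        exact ⟨h.1, h.2.1, h.2.2, by linarith, by linarith, by linarith, by linarith⟩
      obtain ⟨C, hC, hle⟩ := exists_card_torsorPoints_le hK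
      exact ⟨C, hC, fun _ => hle⟩
    · exact ⟨1, one_pos, fun h' => absurd h' h⟩
  choose Cα hCpos hCle using hCα
  -- The discrete data of a solution: permutation, `l`, `α` and the sign of `y`. The sign is
  -- recorded because `X` determines only `y²`.
  set codes : Finset (Equiv.Perm (Fin 3) × (Fin 3 → ℤ) × (Fin 3 → ℤ) × ℤ) :=
    Finset.univ ×ˢ (Fintype.piFinset fun _ => Finset.Icc (-N) N) ×ˢ
      (Fintype.piFinset fun _ => Finset.Icc (-N) N) ×ˢ Finset.Icc (-1) 1 with hcodes
  -- `6 ^ 4` comes from `L ≤ 6 log B`; the summand 1 only ensures positivity.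
  refine ⟨(∑ c ∈ codes, Cα c.2.2.1) * 6 ^ 4 + 1, ?_, ?_⟩
  · have : 0 ≤ ∑ c ∈ codes, Cα c.2.2.1 := Finset.sum_nonneg fun c _ => (hCpos _).le
    positivity
  intro B hB T hT
  obtain ⟨L, hBL, hL⟩ := exists_dyadic_bound hB
  have hex : ∀ x : (Fin 3 → ℤ) × ℤ, ∃ (c : Equiv.Perm (Fin 3) × (Fin 3 → ℤ) × (Fin 3 → ℤ))
      (p : ℤ × (Fin 3 → ℤ) × (Fin 3 → ℤ)), x ∈ T →
      (∀ i, |c.2.1 i| ≤ N) ∧ (∀ i, |c.2.2 i| ≤ N) ∧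
      (0 < c.2.2 0 ∧ 0 < c.2.2 1 ∧ c.2.2 2 < 0) ∧ TorsorPoint c.2.2 p.2.1 p.2.2 p.1 ∧
      (p.2.1 0 * p.2.1 1 * p.2.1 2) ^ 2 * p.1 ^ 3 * (p.2.2 0 * p.2.2 1 * p.2.2 2) ≤ |x.2| ∧
      ∀ i, x.1 (c.1 i) = c.2.1 i * (p.2.1 0 * p.2.1 1 * p.2.1 2) * p.1 ^ 2 * p.2.1 i
        * p.2.2 i ^ 2 := by
    intro x
    by_cases hx : x ∈ T
    · obtain ⟨h1, h2, h3, -⟩ := hT x hx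
      obtain ⟨π, l, α, s, z, w, h⟩ := exists_torsorPoint ha h1 h2 h3
      exact ⟨(π, l, α), (w, s, z), fun _ => h⟩
    · exact ⟨(1, 0, 0), (0, 0, 0), fun h => absurd h hx⟩
  choose c p hcp using hex
  set f : (Fin 3 → ℤ) × ℤ → Equiv.Perm (Fin 3) × (Fin 3 → ℤ) × (Fin 3 → ℤ) × ℤ :=
    fun x => ((c x).1, (c x).2.1, (c x).2.2, x.2.sign) with hf
  have hstep : (T.card : ℝ) ≤ ∑ k ∈ T.image f, Cα k.2.2.1 * (B * (L : ℝ) ^ 4) := by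
    apply card_le_sum_of_fiber_le T f
    intro k hk
    obtain ⟨x₀, hx₀, rfl⟩ := Finset.mem_image.1 hk
    have hinj : Set.InjOn p (↑(T.filter fun x => f x = f x₀) : Set ((Fin 3 → ℤ) × ℤ)) := by
      intro x hx x' hx' hpp
      rw [Finset.mem_coe, Finset.mem_filter] at hx hx'
      have hff : f x = f x' := hx.2.trans hx'.2.symm
      simp only [hf, Prod.mk.injEq] at hff
      obtain ⟨f1, f2, -, f4⟩ := hff
      have e := (hcp x hx.1).2.2.2.2.2
      have e' := (hcp x' hx'.1).2.2.2.2.2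
      have hX : x.1 = x'.1 := by
        funext i
        have := e ((c x).1.symm i)
        have h' := e' ((c x).1.symm i)
        rw [← f1, ← f2, ← hpp, Equiv.apply_symm_apply] at h'
        rw [Equiv.apply_symm_apply] at this
        rw [this, h']
      have hy : x.2 = x'.2 := by
        have h1 := (hT x hx.1).2.2.1
        have h2 := (hT x' hx'.1).2.2.1
        rw [hX, h2] at h1
        rw [← Int.sign_mul_abs x.2, ← Int.sign_mul_abs x'.2, f4, (sq_eq_sq_iff_abs_eq_abs _ _).1 h1]
      exact Prod.ext hX hy
    rw [← Finset.card_image_of_injOn hinj]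
    apply hCle _ (hcp x₀ hx₀).2.2.1 B L (by linarith) hBL
    intro q hq
    obtain ⟨x, hx, rfl⟩ := Finset.mem_image.1 hq
    rw [Finset.mem_filter] at hx
    have h := hcp x hx.1
    have hff := hx.2
    simp only [hf, Prod.mk.injEq] at hff
    rw [hff.2.2.1] at h
    refine ⟨h.2.2.2.1, le_trans ?_ (hT x hx.1).2.2.2⟩
    exact_mod_cast h.2.2.2.2.1
  have hsub : T.image f ⊆ codes := by
    intro k hk
    obtain ⟨x, hx, rfl⟩ := Finset.mem_image.1 hk
    have h := hcp x hx
    simp only [hcodes, hf, Finset.mem_product, Finset.mem_univ, Fintype.mem_piFinset,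
      Finset.mem_Icc, true_and]
    refine ⟨fun i => abs_le.1 (h.1 i), fun i => abs_le.1 (h.2.1 i), ?_⟩
    rcases Int.sign_trichotomy x.2 with h | h | h <;> rw [h] <;> norm_num
  have hlog : 0 ≤ Real.log B := Real.log_nonneg (by linarith)
  have hCnn : 0 ≤ ∑ c ∈ codes, Cα c.2.2.1 := Finset.sum_nonneg fun c _ => (hCpos _).le
  calc (T.card : ℝ) ≤ ∑ k ∈ T.image f, Cα k.2.2.1 * (B * (L : ℝ) ^ 4) := hstep
    _ ≤ ∑ k ∈ codes, Cα k.2.2.1 * (B * (L : ℝ) ^ 4) :=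
        Finset.sum_le_sum_of_subset_of_nonneg hsub fun k _ _ => by
          have := (hCpos k.2.2.1).le
          positivity
    _ = (∑ k ∈ codes, Cα k.2.2.1) * (B * (L : ℝ) ^ 4) := by rw [Finset.sum_mul]
    _ ≤ (∑ k ∈ codes, Cα k.2.2.1) * (B * (6 * Real.log B) ^ 4) := by gcongr
    _ = (∑ k ∈ codes, Cα k.2.2.1) * 6 ^ 4 * (B * Real.log B ^ 4) := by ring
    _ ≤ _ := by
      have : 0 ≤ B * Real.log B ^ 4 := by positivity
      nlinarith

/-! ### From solutions to integral points: the upper bound -/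

theorem encard_le_of_card_le {ι : Type*} {X : Set ι} {R : ℝ}
    (h : ∀ T : Finset ι, (∀ x ∈ T, x ∈ X) → (T.card : ℝ) ≤ R) :
    (X.encard : ℝ≥0∞) ≤ ENNReal.ofReal R := by
  have hfin : X.Finite := by
    by_contra hinf
    obtain ⟨T, hT, hc⟩ := Set.Infinite.exists_subset_card_eq hinf (⌊R⌋₊ + 1)
    have h1 := h T fun x hx => hT hx
    have h2 := Nat.lt_floor_add_one R
    rw [hc] at h1
    push_cast at h1
    linarith
  have h1 := h hfin.toFinset fun x hx => hfin.mem_toFinset.1 hx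
  rw [hfin.encard_eq_coe_toFinset_card, ENat.toENNReal_coe, ← ENNReal.ofReal_natCast]
  exact ENNReal.ofReal_le_ofReal h1

theorem sum_encard_toENNReal {ι κ : Type*} (s : Finset ι) (V : ι → Set κ)
    (h : (s : Set ι).PairwiseDisjoint V) :
    ∑ n ∈ s, ((V n).encard : ℝ≥0∞) = ((⋃ n ∈ s, V n).encard : ℝ≥0∞) := by
  classical
  induction s using Finset.induction_on with
  | empty => simp
  | insert a s ha ih =>
    rw [Finset.sum_insert ha, ih (h.subset (by simp)), Finset.set_biUnion_insert,
      Set.encard_union_eq, ENat.toENNReal_add]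
    rw [Set.disjoint_iUnion₂_right]
    intro n hn
    exact h (by simp) (by simp [hn]) (by rintro rfl; exact ha hn)

/-- The integers `x - eᵢ n` and `y` attached to an integral point `(x, y)`. -/
noncomputable def pointData (e₁ e₂ e₃ : ℤ) (n : ℕ+) :
    (twistCurve e₁ e₂ e₃ n).toAffine.Point → (Fin 3 → ℤ) × ℤ
  | .zero => 0
  | .some x y _ => (fun i => x.num - ![e₁, e₂, e₃] i * (n : ℕ), y.num)

theorem exists_intCast_of_mem {e₁ e₂ e₃ : ℤ} {n : ℕ+} {P : (twistCurve e₁ e₂ e₃ n).toAffine.Point}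
    (hP : P ∈ nontrivialIntegralPoints e₁ e₂ e₃ n) :
    ∃ (m k : ℤ) (h : (twistCurve e₁ e₂ e₃ n).toAffine.Nonsingular (m : ℚ) (k : ℚ)),
      P = .some (m : ℚ) (k : ℚ) h ∧ k ≠ 0 ∧
      k ^ 2 = (m - e₁ * (n : ℕ)) * (m - e₂ * (n : ℕ)) * (m - e₃ * (n : ℕ)) := by
  obtain ⟨x, y, h, rfl, ⟨m, rfl⟩, hy⟩ := hP
  have heq := (twistCurve_equation_iff e₁ e₂ e₃ n m y).1 h.1
  have hyint : y ^ 2 = (((m - e₁ * (n : ℕ)) * (m - e₂ * (n : ℕ)) * (m - e₃ * (n : ℕ)) : ℤ) : ℚ) := by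
    rw [heq]; push_cast; ring
  have hden : y.den = 1 := by
    have h1 : (y ^ 2).den = 1 := by rw [hyint]; exact Rat.den_intCast _
    rw [Rat.den_pow] at h1
    simpa using h1
  have hnum : (y.num : ℚ) = y := (Rat.den_eq_one_iff y).1 hden
  generalize y.num = k at hnum
  subst hnum
  exact ⟨m, k, h, rfl, by exact_mod_cast hy, by exact_mod_cast hyint⟩

theorem integralPointSum_le {e₁ e₂ e₃ : ℤ} (h₁₂ : e₁ ≠ e₂) (h₂₃ : e₂ ≠ e₃) (h₃₁ : e₃ ≠ e₁) :
    ∃ C : ℝ, 0 < C ∧ ∀ B : ℝ, 2 ≤ B →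
      integralPointSum e₁ e₂ e₃ B ≤ ENNReal.ofReal (C * (B * Real.log B ^ 4)) := by
  classical
  -- These coefficients are orthogonal to `(1, 1, 1)` and to `(e₁, e₂, e₃)`, hence to every `(x - eᵢ
  -- n)`.
  have ha : ∀ i, (![e₂ - e₃, e₃ - e₁, e₁ - e₂] : Fin 3 → ℤ) i ≠ 0 := by
    simp only [Fin.forall_fin_succ, Fin.forall_fin_zero]
    exact ⟨sub_ne_zero.2 h₂₃, sub_ne_zero.2 h₃₁, sub_ne_zero.2 h₁₂, trivial⟩
  obtain ⟨C, hC, hcard⟩ := exists_card_solutions_le ha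
  refine ⟨C, hC, fun B hB => ?_⟩
  set S : ∀ n : ℕ+, Set (twistCurve e₁ e₂ e₃ n).toAffine.Point := fun n =>
    {P ∈ nontrivialIntegralPoints e₁ e₂ e₃ n | naiveHeight P ≤ B} with hS
  set V : ℕ+ → Set ((Fin 3 → ℤ) × ℤ) := fun n => pointData e₁ e₂ e₃ n '' S n with hV
  have hdata : ∀ n, ∀ P ∈ S n, ∃ m k : ℤ, pointData e₁ e₂ e₃ n P
      = (fun i => m - ![e₁, e₂, e₃] i * (n : ℕ), k) ∧ k ≠ 0 ∧
      k ^ 2 = (m - e₁ * (n : ℕ)) * (m - e₂ * (n : ℕ)) * (m - e₃ * (n : ℕ)) ∧ |(k : ℝ)| ≤ B ^ 3 := by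
    intro n P hP
    obtain ⟨m, k, h, rfl, hk, heq⟩ := exists_intCast_of_mem hP.1
    refine ⟨m, k, by simp [pointData], hk, heq, ?_⟩
    have h1 : (|((k : ℚ) : ℝ)|) ^ (1 / 3 : ℝ) ≤ B := (le_max_left _ _).trans hP.2
    rw [Rat.cast_intCast] at h1
    calc |(k : ℝ)| = ((|(k : ℝ)|) ^ (1 / 3 : ℝ)) ^ 3 := by
          rw [← Real.rpow_natCast, ← Real.rpow_mul (abs_nonneg _)]; norm_num
      _ ≤ B ^ 3 := by gcongr
  have hinj : ∀ n, Set.InjOn (pointData e₁ e₂ e₃ n) (S n) := by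
    intro n P hP P' hP' h
    obtain ⟨m, k, hns, rfl, -⟩ := exists_intCast_of_mem hP.1
    obtain ⟨m', k', hns', rfl, -⟩ := exists_intCast_of_mem hP'.1
    simp only [pointData, Rat.num_intCast, Prod.mk.injEq] at h
    have h0 := congrFun h.1 0
    simp only [Matrix.cons_val_zero, sub_left_inj] at h0
    obtain ⟨-, hk⟩ := h
    subst h0
    subst hk
    rfl
  -- The difference of the first two entries is `(e₂ - e₁) n`, which recovers `n`; so different
  -- curves have disjoint data.
  have hdisj : ∀ s : Finset ℕ+, (s : Set ℕ+).PairwiseDisjoint V := by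
    intro s n _ n' _ hne
    rw [Function.onFun, Set.disjoint_left]
    rintro _ ⟨P, hP, rfl⟩ ⟨P', hP', h⟩
    obtain ⟨m, k, hd, -⟩ := hdata n P hP
    obtain ⟨m', k', hd', -⟩ := hdata n' P' hP'
    rw [hd, hd'] at h
    have h0 := congrFun (congrArg Prod.fst h) 0
    have h1 := congrFun (congrArg Prod.fst h) 1
    simp at h0 h1
    have h2 : (e₁ - e₂) * ((n : ℕ) : ℤ) = (e₁ - e₂) * ((n' : ℕ) : ℤ) := by linear_combination h0 - h1
    have h3 := mul_left_cancel₀ (sub_ne_zero.2 h₁₂) h2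
    exact hne (PNat.coe_injective (by exact_mod_cast h3))
  rw [integralPointSum, ENNReal.tsum_eq_iSup_sum]
  refine iSup_le fun s => ?_
  have h1 : ∑ n ∈ s, ((S n).encard : ℝ≥0∞) = ∑ n ∈ s, ((V n).encard : ℝ≥0∞) :=
    Finset.sum_congr rfl fun n _ => by rw [hV, (hinj n).encard_image]
  refine h1.le.trans ?_
  rw [sum_encard_toENNReal s V (hdisj s)]
  refine encard_le_of_card_le fun T hT => hcard B hB T fun x hx => ?_
  obtain ⟨n, -, P, hP, rfl⟩ := Set.mem_iUnion₂.1 (hT x hx)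
  obtain ⟨m, k, hd, hk, heq, hle⟩ := hdata n P hP
  rw [hd]
  refine ⟨hk, ?_, ?_, hle⟩
  · simp; ring
  · simp; exact heq.symm

/-! ### The lower bound -/

/-- With `f = (u - e₁)(u - e₂)(u - e₃)` and `n = f t²`, the point `(u f t², f² t³)` lies on `E_n`,
as both sides of the equation equal `f⁴ t⁶`. Its height is at most a constant times `t`, and
different `t ≥ 1` give different `n`. -/
theorem le_integralPointSum (e₁ e₂ e₃ : ℤ) :
    ∃ c : ℝ, 0 < c ∧ ∃ B₀ : ℝ, ∀ B : ℝ, B₀ ≤ B →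
      ENNReal.ofReal (c * B) ≤ integralPointSum e₁ e₂ e₃ B := by
  classical
  -- Large enough that every `u - eᵢ` is at least 1, which makes `f` positive.
  set u : ℤ := |e₁| + |e₂| + |e₃| + 1 with hu
  have b₁ := abs_nonneg e₁
  have b₂ := abs_nonneg e₂
  have b₃ := abs_nonneg e₃
  have p₁ : 1 ≤ u - e₁ := by have := le_abs_self e₁; linarith
  have p₂ : 1 ≤ u - e₂ := by have := le_abs_self e₂; linarith
  have p₃ : 1 ≤ u - e₃ := by have := le_abs_self e₃; linarith
  have hu1 : 1 ≤ u := by linarith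
  obtain ⟨f, hf⟩ : ∃ f : ℕ, (f : ℤ) = (u - e₁) * (u - e₂) * (u - e₃) :=
    ⟨((u - e₁) * (u - e₂) * (u - e₃)).toNat, Int.toNat_of_nonneg (by positivity)⟩
  have hf1 : 0 < f := by
    have : (0 : ℤ) < f := by rw [hf]; positivity
    exact_mod_cast this
  have hfR : (1 : ℝ) ≤ f := by exact_mod_cast hf1
  have huR : (1 : ℝ) ≤ u := by exact_mod_cast hu1
  set H : ℝ := u * f ^ 2 with hH
  have hHpos : 0 < H := by positivity
  set N : ℕ → ℕ+ := fun k => ⟨(k + 1) ^ 2 * f, by positivity⟩ with hN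
  have hNinj : Function.Injective N := by
    intro k k' h
    have h1 : (k + 1) ^ 2 * f = (k' + 1) ^ 2 * f := congrArg PNat.val h
    have h2 := Nat.pow_left_injective two_ne_zero (Nat.eq_of_mul_eq_mul_right hf1 h1)
    simpa using h2
  refine ⟨1 / (2 * H), by positivity, 2 * H, fun B hB => ?_⟩
  have hmem : ∀ k : ℕ, ((k + 1 : ℕ) : ℝ) * H ≤ B →
      ({P ∈ nontrivialIntegralPoints e₁ e₂ e₃ (N k) | naiveHeight P ≤ B}).Nonempty := by
    intro k hk
    set t : ℕ := k + 1 with ht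
    have ht1 : (1 : ℝ) ≤ t := by rw [ht]; push_cast; linarith [(Nat.cast_nonneg k : (0 : ℝ) ≤ k)]
    have hfQ : (f : ℚ) = (u - e₁) * (u - e₂) * (u - e₃) := by exact_mod_cast congrArg (Int.cast (R := ℚ)) hf
    have hNk : (((N k : ℕ+) : ℕ) : ℚ) = (t : ℚ) ^ 2 * f := by
      simp only [hN, ht, PNat.mk_coe]; push_cast; ring
    have heq : (twistCurve e₁ e₂ e₃ (N k)).toAffine.Equation
        ((u * f * t ^ 2 : ℤ) : ℚ) ((f ^ 2 * t ^ 3 : ℤ) : ℚ) := by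
      rw [twistCurve_equation_iff, hNk]
      push_cast
      linear_combination (t : ℚ) ^ 6 * (f : ℚ) ^ 3 * hfQ
    have hy0 : ((f ^ 2 * t ^ 3 : ℤ) : ℚ) ≠ 0 := by
      have : (0 : ℚ) < ((f ^ 2 * t ^ 3 : ℤ) : ℚ) := by
        rw [ht]; push_cast; positivity
      exact this.ne'
    have hns : (twistCurve e₁ e₂ e₃ (N k)).toAffine.Nonsingular
        ((u * f * t ^ 2 : ℤ) : ℚ) ((f ^ 2 * t ^ 3 : ℤ) : ℚ) := by
      rw [WeierstrassCurve.Affine.nonsingular_iff]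
      refine ⟨heq, Or.inr ?_⟩
      simp only [twistCurve, zero_mul, sub_zero]
      intro h
      exact hy0 (by linarith)
    refine ⟨.some _ _ hns, ⟨_, _, hns, rfl, ⟨_, rfl⟩, hy0⟩, ?_⟩
    simp only [naiveHeight, Rat.cast_intCast]
    refine (max_le ?_ ?_).trans hk
    · have h0 : (0 : ℝ) ≤ (f ^ 2 * t ^ 3 : ℤ) := by push_cast; positivity
      rw [abs_of_nonneg h0]
      have h1 : (((f ^ 2 * t ^ 3 : ℤ)) : ℝ) ≤ (t * H) ^ 3 := by
        push_cast
        have : (f : ℝ) ^ 2 ≤ H ^ 3 := by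
          have e1 : (f : ℝ) ^ 2 ≤ H := by rw [hH]; exact le_mul_of_one_le_left (by positivity) huR
          have e2 : (1 : ℝ) ≤ H := (one_le_pow₀ hfR).trans e1
          exact e1.trans (le_self_pow₀ e2 (by norm_num))
        calc (f : ℝ) ^ 2 * t ^ 3 ≤ H ^ 3 * t ^ 3 := by gcongr
          _ = (t * H) ^ 3 := by ring
      calc _ ≤ ((t * H : ℝ) ^ 3) ^ (1 / 3 : ℝ) := Real.rpow_le_rpow h0 h1 (by norm_num)
        _ = t * H := by
          rw [← Real.rpow_natCast, ← Real.rpow_mul (by positivity)]; norm_num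
    · have h0 : (0 : ℝ) ≤ (u * f * t ^ 2 : ℤ) := by push_cast; positivity
      rw [abs_of_nonneg h0]
      have h1 : (((u * f * t ^ 2 : ℤ)) : ℝ) ≤ (t * H) ^ 2 := by
        push_cast
        have : (u : ℝ) * f ≤ H ^ 2 := by
          rw [hH]
          have e1 : (f : ℝ) ≤ f ^ 4 := le_self_pow₀ hfR (by norm_num)
          have e2 : (u : ℝ) ≤ u ^ 2 := le_self_pow₀ huR (by norm_num)
          calc (u : ℝ) * f ≤ u ^ 2 * f ^ 4 := by gcongr
            _ = _ := by ring
        calc (u : ℝ) * f * t ^ 2 ≤ H ^ 2 * t ^ 2 := by gcongr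
          _ = (t * H) ^ 2 := by ring
      calc _ ≤ ((t * H : ℝ) ^ 2) ^ (1 / 2 : ℝ) := Real.rpow_le_rpow h0 h1 (by norm_num)
        _ = t * H := by
          rw [← Real.rpow_natCast, ← Real.rpow_mul (by positivity)]; norm_num
  set M := ⌊B / H⌋₊ with hM
  have hBH : 2 ≤ B / H := by rw [le_div_iff₀ hHpos]; exact hB
  have hM1 : 1 / (2 * H) * B ≤ M := by
    have h1 := Nat.lt_floor_add_one (B / H)
    rw [← hM] at h1
    have h2 : 1 / (2 * H) * B = B / H / 2 := by field_simp
    rw [h2]; linarith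
  have hMle : (M : ℝ) * H ≤ B := by
    have := Nat.floor_le (by linarith : (0 : ℝ) ≤ B / H)
    rwa [le_div_iff₀ hHpos] at this
  calc ENNReal.ofReal (1 / (2 * H) * B) ≤ ENNReal.ofReal (M : ℝ) := ENNReal.ofReal_le_ofReal hM1
    _ = ∑ n ∈ (Finset.range M).image N, (1 : ℝ≥0∞) := by
        rw [Finset.sum_const, Finset.card_image_of_injective _ hNinj, Finset.card_range,
          ENNReal.ofReal_natCast, nsmul_one]
    _ ≤ ∑ n ∈ (Finset.range M).image N,
          (({P ∈ nontrivialIntegralPoints e₁ e₂ e₃ n | naiveHeight P ≤ B}).encard : ℝ≥0∞) := by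
        apply Finset.sum_le_sum
        intro n hn
        obtain ⟨k, hk, rfl⟩ := Finset.mem_image.1 hn
        have hkM : ((k + 1 : ℕ) : ℝ) ≤ M := by exact_mod_cast Finset.mem_range.1 hk
        have := Set.one_le_encard_iff_nonempty.2 (hmem k ((by gcongr : _ ≤ (M : ℝ) * H).trans hMle))
        rw [← ENat.toENNReal_one]
        exact ENat.toENNReal_le.2 this
    _ ≤ integralPointSum e₁ e₂ e₃ B := ENNReal.sum_le_tsum _

/-! ### The two bounds together -/

/-- The upper bound holds with exponent 4 in all cases. For exponent 6 it is weakened by `3 (log B)²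
≥ 1`, valid because `log B ≥ 0.69`. -/
theorem theorem2 (e₁ e₂ e₃ : ℤ) (h₁₂ : e₁ ≠ e₂) (h₂₃ : e₂ ≠ e₃) (h₃₁ : e₃ ≠ e₁) :
    (∃ c : ℝ, 0 < c ∧ ∃ B₀ : ℝ, ∀ B : ℝ, B₀ ≤ B →
      ENNReal.ofReal (c * B) ≤ integralPointSum e₁ e₂ e₃ B) ∧
    (∃ C : ℝ, 0 < C ∧ ∀ B : ℝ, 2 ≤ B →
      integralPointSum e₁ e₂ e₃ B ≤
        ENNReal.ofReal (C * (B * Real.log B ^ logExponent e₁ e₂ e₃))) := by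
  refine ⟨le_integralPointSum e₁ e₂ e₃, ?_⟩
  obtain ⟨C, hC, hle⟩ := integralPointSum_le h₁₂ h₂₃ h₃₁
  refine ⟨3 * C, by positivity, fun B hB => (hle B hB).trans (ENNReal.ofReal_le_ofReal ?_)⟩
  have hlog : 0.69 ≤ Real.log B := by
    have := Real.log_le_log (by norm_num) hB
    linarith [Real.log_two_gt_d9]
  have key : Real.log B ^ 4 ≤ 3 * Real.log B ^ logExponent e₁ e₂ e₃ := by
    have h4 : 0 ≤ Real.log B ^ 4 := by positivity
    rw [logExponent]
    split_ifs
    · linarith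
    · have h2 : 1 ≤ 3 * Real.log B ^ 2 := by nlinarith
      calc Real.log B ^ 4 ≤ Real.log B ^ 4 * (3 * Real.log B ^ 2) := le_mul_of_one_le_right h4 h2
        _ = _ := by ring
  calc C * (B * Real.log B ^ 4) ≤ C * (B * (3 * Real.log B ^ logExponent e₁ e₂ e₃)) := by gcongr
    _ = _ := by ring
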